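/- **Setting.** Let $K\ge 1$, let $\mathcal X$ be a finite non-empty alphabet, $\mathcal Y_1,\dots,\mathcal Y_K$ finite alphabets, and let $P_{Y_1,\dots,Y_K|X}$ be a discrete memoryless broadcast channel (DM-BC) with marginal channels $P_{Y_j|X}$. Put $$B=\max_{x,x'}\min_{1\le j\le K} D\big(P_{Y_j|X}(\cdot|x)\,\|\,P_{Y_j|X}(\cdot|x')\big),\qquad B_j=\max_{x,x'} D\big(P_{Y_j|X}(\cdot|x)\,\|\,P_{Y_j|X}(\cdot|x')\big),$$ $$B_{\max}=\max_{j}B_j,\qquad C_j=\max_{P_X} I(X;Y_j)$$ (natural logarithms). An $(M,N)$-VLFT code (variable-length feedback code with termination, $M\in\mathbb N$, $N>0$) for a common message consists of a message $W$ uniform on $\{1,\dots,M\}$; encoders $X_n=f_n(W,Y_1^{n-1},\dots,Y_K^{n-1})$, $n\ge 1$; decoders $g^{(j)}_n:\mathcal Y_j^n\to\{1,\dots,M\}$; and, for each $j$, a stopping time $\tau_j$ of the filtration $(\sigma(Y_j^n))_{n\ge 0}$, such that $\tau=\max_j\tau_j$ satisfies $\mathbb E(\tau)\le N$. With $\hat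 W_j=g^{(j)}_{\tau_j}(Y_j^{\tau_j})$, its error probability is $\mathsf P_{\mathrm e}=\mathbb P\big(\bigcup_{j}\{\hat W_j\ne W\}\big)$. A pair $(R,E)$ with $R,E\ge 0$ is achievable if there is a family of $(M_N,N)$-VLFT codes, $N\in(0,\infty)$, with $M_N\ge 2$ and error probabilities $\mathsf P_{\mathrm e}(N)$, such that as $N\to\infty$ $$\liminf \frac{\ln M_N}{N}\ge R,\qquad \lim \mathsf P_{\mathrm e}(N)=0,\qquad \liminf\, -\frac{\ln \mathsf P_{\mathrm e}(N)}{N}\ge E .$$ The reliability function is $E(R)=\sup\{E:(R,E)\text{ is achievable}\}$. The DM-BC is *less capable* (with respect to $P_{Y_1|X}$) if $I(X;Y_1)\le\min_j I(X;Y_j)$ for all $P_X$; *stochastically degraded* if for each $j\ge 2$ there is a random variable $\tilde Y_1$ with $P_{\tilde Y_1|X}=P_{Y_1|X}$ and $X-Y_j-\tilde Y_1$ a Markov chain; *physically degraded* if $X-Y_j-Y_1$ is a Markov chain for each $j\ge 2$. **Theorem.** Suppose that $B_{\max}<\infty$. If the DM-BC is less capable, then $$B\Big(1-\frac{R}{C_1}\Big)\le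 E(R)\le B_1\Big(1-\frac{R}{C_1}\Big)\qquad\text{for all } 0\le R<C_1 .$$ If the DM-BC is stochastically degraded or physically degraded, then $$E(R)=B_1\Big(1-\frac{R}{C_1}\Big)\qquad\text{for all } 0\le R<C_1 .$$ -/

import Mathlib

open MeasureTheory ProbabilityTheory Filter Topology
open scoped ENNReal

noncomputable section

/-- A `K`-user discrete memoryless broadcast channel `P_{Y_1,…,Y_K|X}`, the receivers being numbered
`0, …, K-1`: for every input letter, a joint law of the `K` output letters. -/
abbrev BroadcastChannel {K : ℕ} (X : Type*) (Y : Fin K → Type*) :=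
  X → PMF (∀ j, Y j)

namespace BroadcastChannel

variable {K : ℕ} {X : Type*} {Y : Fin K → Type*}

/-- The channel `P_{Y_j|X}` to receiver `j`. -/
def marginal (ch : BroadcastChannel X Y) (j : Fin K) (x : X) : PMF (Y j) :=
  (ch x).map (fun y => y j)

/-! ### Information quantities -/

section Information

variable [∀ j, MeasurableSpace (Y j)]

/-- The relative entropy `D(P_{Y_j|X}(·|x) ‖ P_{Y_j|X}(·|x'))`, in nats (possibly `∞`). -/
def relEntropy (ch : BroadcastChannel X Y) (j : Fin K) (x x' : X) : ℝ≥0∞ :=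
  InformationTheory.klDiv (ch.marginal j x).toMeasure (ch.marginal j x').toMeasure

/-- `B = max_{x,x'} min_j D(P_{Y_j|X}(·|x) ‖ P_{Y_j|X}(·|x'))`. -/
def Bcommon (ch : BroadcastChannel X Y) : ℝ≥0∞ :=
  ⨆ (x : X) (x' : X), ⨅ j : Fin K, ch.relEntropy j x x'

/-- `B_j = max_{x,x'} D(P_{Y_j|X}(·|x) ‖ P_{Y_j|X}(·|x'))`. -/
def Buser (ch : BroadcastChannel X Y) (j : Fin K) : ℝ≥0∞ :=
  ⨆ (x : X) (x' : X), ch.relEntropy j x x'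

/-- `B_max = max_j B_j`. -/
def Bmax (ch : BroadcastChannel X Y) : ℝ≥0∞ :=
  ⨆ j : Fin K, ch.Buser j

variable [MeasurableSpace X]

/-- The mutual information `I(X;Y_j)`, in nats, when the input has law `P_X = p`: the relative
entropy of the joint law of `(X, Y_j)` with respect to the product of its marginals. -/
def mutualInfo (ch : BroadcastChannel X Y) (p : PMF X) (j : Fin K) : ℝ≥0∞ :=
  InformationTheory.klDiv
    (p.bind fun x => (ch.marginal j x).map (Prod.mk x)).toMeasure
    (p.toMeasure.prod (p.bind (ch.marginal j)).toMeasure)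

/-- `C_j = max_{P_X} I(X;Y_j)`. -/
def capacity (ch : BroadcastChannel X Y) (j : Fin K) : ℝ≥0∞ :=
  ⨆ p : PMF X, ch.mutualInfo p j

/-- `I(X;Y_1) ≤ min_j I(X;Y_j)` for all input laws. -/
def LessCapable [NeZero K] (ch : BroadcastChannel X Y) : Prop :=
  ∀ p : PMF X, ch.mutualInfo p 0 ≤ ⨅ j : Fin K, ch.mutualInfo p j

end Information

/-- For each receiver `j` there is `Ỹ_1` with `P_{Ỹ_1|X} = P_{Y_1|X}` and `X - Y_j - Ỹ_1`; here
`V` is the conditional law of `Ỹ_1` given `Y_j`. Only the marginal channels matter. In particular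
this holds if one and the same `Ỹ_1`, jointly distributed with all outputs, serves every `j`. -/
def StochasticallyDegraded [NeZero K] (ch : BroadcastChannel X Y) : Prop :=
  ∀ j : Fin K, j ≠ 0 → ∃ V : Y j → PMF (Y 0),
    ∀ x, ch.marginal 0 x = (ch.marginal j x).bind V

/-- `X - Y_j - Y_1` is a Markov chain for each `j`; `V` is the conditional law of `Y_1` given
`Y_j`. -/
def PhysicallyDegraded [NeZero K] (ch : BroadcastChannel X Y) : Prop :=
  ∀ j : Fin K, j ≠ 0 → ∃ V : Y j → PMF (Y 0),
    ∀ x, (ch x).map (fun y => (y j, y 0)) =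
      (ch.marginal j x).bind fun yj => (V yj).map (Prod.mk yj)

/-! ### Variable-length feedback codes -/

/-- Sample space: the message and the infinite sequence of output tuples. The outputs at (one-based)
time `n + 1` are stored at index `n`. -/
abbrev Sample (M : ℕ) (Y : Fin K → Type*) := Fin M × (ℕ → ∀ j, Y j)

/-- The first `n` outputs `Y_j^n` seen by receiver `j`. -/
def received {M : ℕ} (j : Fin K) (n : ℕ) (ω : Sample M Y) : Fin n → Y j :=
  fun i => ω.2 i j

variable [∀ j, MeasurableSpace (Y j)]

lemma measurable_received {M : ℕ} (j : Fin K) (n : ℕ) :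
    Measurable (received (Y := Y) (M := M) j n) := by
  refine measurable_pi_lambda _ fun i => ?_
  exact (measurable_pi_apply j).comp ((measurable_pi_apply (i : ℕ)).comp measurable_snd)

/-- The filtration `(σ(Y_j^n))_{n ≥ 0}` of receiver `j`. -/
def outputFiltration (M : ℕ) (Y : Fin K → Type*) [∀ j, MeasurableSpace (Y j)] (j : Fin K) :
    Filtration ℕ (inferInstance : MeasurableSpace (Sample M Y)) where
  seq n := MeasurableSpace.comap (received j n) inferInstance
  mono' := by
    intro m n hmn
    have h : (received (Y := Y) (M := M) j m) =
        (fun (v : Fin n → Y j) (i : Fin m) => v (Fin.castLE hmn i)) ∘ received j n := rfl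
    change MeasurableSpace.comap (received j m) _ ≤ MeasurableSpace.comap (received j n) _
    rw [h, ← MeasurableSpace.comap_comp]
    refine MeasurableSpace.comap_mono (Measurable.comap_le ?_)
    exact measurable_pi_lambda _ fun i => measurable_pi_apply _
  le' n := (measurable_received j n).comap_le

/-- The data of a variable-length feedback code with termination, with `M` messages, for a common
message. The bound on the expected length is imposed separately. -/
structure VLFTCode (M : ℕ) (X : Type*) (Y : Fin K → Type*) [∀ j, MeasurableSpace (Y j)] where
  /-- `encoder n w` is the input at time `n + 1`, given the `n` previous outputs of all receivers. -/
  encoder : (n : ℕ) → Fin M → (Fin n → ∀ j, Y j) → X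
  /-- `decoder j n` is the estimate of receiver `j` at time `n`. -/
  decoder : (j : Fin K) → (n : ℕ) → (Fin n → Y j) → Fin M
  /-- the (possibly infinite) time at which receiver `j` stops -/
  stopTime : Fin K → Sample M Y → ℕ∞
  stopTime_isStoppingTime : ∀ j, IsStoppingTime (outputFiltration M Y j) (stopTime j)

namespace VLFTCode

variable {M : ℕ}

/-- The stopping time `τ = max_j τ_j`. -/
def tau (c : VLFTCode M X Y) (ω : Sample M Y) : ℕ∞ := ⨆ j, c.stopTime j ω

/-- The event that some receiver `j` has `Ŵ_j ≠ W`, with `Ŵ_j = g^{(j)}_{τ_j}(Y_j^{τ_j})`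
(never stopping counts as an error). -/
def errorEvent (c : VLFTCode M X Y) : Set (Sample M Y) :=
  {ω | ∃ j, ¬ ∃ n : ℕ, c.stopTime j ω = n ∧ c.decoder j n (received j n ω) = ω.1}

variable [∀ j, Finite (Y j)] [∀ j, MeasurableSingletonClass (Y j)]

/-- The conditional law of the outputs at time `n + 2` given message `w` and the outputs at times
`1, …, n + 1`. -/
def stepKernel (c : VLFTCode M X Y) (ch : BroadcastChannel X Y) (w : Fin M) (n : ℕ) :
    Kernel (∀ _ : Finset.Iic n, ∀ j, Y j) (∀ j, Y j) :=
  Kernel.ofFunOfCountable fun past =>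
    (ch (c.encoder (n + 1) w fun i =>
      past ⟨i, Finset.mem_Iic.2 (Nat.lt_succ_iff.1 i.2)⟩)).toMeasure

instance (c : VLFTCode M X Y) (ch : BroadcastChannel X Y) (w : Fin M) (n : ℕ) :
    IsMarkovKernel (c.stepKernel ch w n) :=
  ⟨fun _ => PMF.toMeasure.isProbabilityMeasure _⟩

/-- The law of the output sequence given that message `w` is sent: at each time, the outputs have,
given the past, the law `ch x`, where `x` is the input chosen by the encoder. -/
def outputLaw (c : VLFTCode M X Y) (ch : BroadcastChannel X Y) (w : Fin M) :
    Measure (ℕ → ∀ j, Y j) :=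
  Kernel.trajMeasure (X := fun _ => ∀ j, Y j)
    (ch (c.encoder 0 w Fin.elim0)).toMeasure (c.stepKernel ch w)

/-- The joint law of the message, uniform on the `M` messages, and the outputs. -/
def law (c : VLFTCode M X Y) (ch : BroadcastChannel X Y) : Measure (Sample M Y) :=
  (M : ℝ≥0∞)⁻¹ • ∑ w : Fin M, (c.outputLaw ch w).map (Prod.mk w)

/-- The expected length `𝔼(τ)`. -/
def expectedLength (c : VLFTCode M X Y) (ch : BroadcastChannel X Y) : ℝ≥0∞ :=
  ∫⁻ ω, (c.tau ω : ℝ≥0∞) ∂(c.law ch)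

/-- The error probability. -/
def errorProb (c : VLFTCode M X Y) (ch : BroadcastChannel X Y) : ℝ≥0∞ :=
  c.law ch c.errorEvent

end VLFTCode

/-! ### The reliability function -/

variable [∀ j, Finite (Y j)] [∀ j, MeasurableSingletonClass (Y j)]

/-- `(R, E)` is an achievable rate-exponent pair: there are `(M_N, N)`-codes, `N` ranging over the
positive reals, with at least two messages, `liminf (ln M_N) / N ≥ R`, vanishing error probability
`P_N` and `liminf - (ln P_N) / N ≥ E` (with `-ln 0 = ∞`). -/
def Achievable (ch : BroadcastChannel X Y) (R E : ℝ) : Prop :=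
  0 ≤ R ∧ 0 ≤ E ∧ ∃ (M : ℝ → ℕ) (c : ∀ N : ℝ, VLFTCode (M N) X Y),
    (∀ N : ℝ, 0 < N → 2 ≤ M N ∧ (c N).expectedLength ch ≤ ENNReal.ofReal N) ∧
    (R : EReal) ≤ liminf (fun N : ℝ => ((Real.log (M N) / N : ℝ) : EReal)) atTop ∧
    Tendsto (fun N : ℝ => (c N).errorProb ch) atTop (𝓝 0) ∧
    (E : EReal) ≤ liminf (fun N : ℝ => -ENNReal.log ((c N).errorProb ch) / (N : EReal)) atTop

/-- `E(R) = sup {E : (R, E) is achievable}`, an extended real. -/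
def reliability (ch : BroadcastChannel X Y) (R : ℝ) : EReal :=
  sSup {e : EReal | ∃ E : ℝ, ch.Achievable R E ∧ e = (E : EReal)}

end BroadcastChannel

end

set_option linter.unusedSectionVars false

noncomputable section

namespace BroadcastChannel

/-! ### Inequalities for finite channels -/

/-! Upper bound. Only receiver 1 matters: its stopping time is at most the maximum, its error is
part of the common error, and the feedback from the other receivers merely makes the channel input
random given its own outputs. What remains is Burnashev's converse, proved by induction on a finite
tree of output prefixes. The cost of a transmission is its expected length plus its error mass times
a large multiplier. While every message has posterior at most 1 - d, the entropy of the message is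
the relevant potential; one channel use lowers it by at most C (`ChannelBounds.massEntropy_sub_le`).
Once one message has posterior above 1 - d, what is left is a test of that message against all the
others; a symmetric potential built from both log-likelihood ratios drops by at most B per use
(`ChannelBounds.testPotential_step`). Finite relative entropies on finite alphabets bound the
likelihood ratios, so a posterior cannot overshoot the threshold 1 - d by much. `Attains.entropy_le`
glues the two regimes: the cost is at least (log multiplier)/B + (log M)/C up to lower-order terms.
With multiplier exp(E'N), E' just below E, the error term stays bounded, and E/B + R/C ≤ 1 follows
(`Achievable.le`).

Lower bound. This is the scheme of Yamamoto and Itoh. A round consists of a block code for all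
receivers, obtained by Feinstein's maximal construction (`exists_block_code`), followed by a
confirmation block: x₀ repeated if every receiver decoded correctly, which the encoder sees from the
feedback, and x₁ repeated otherwise. Each receiver tests x₀ against x₁ and stops at its first
acceptance; rounds are repeated independently. Rejections are rare, so the expected length is about
one round, while a wrong decision requires some receiver to mistake x₁ for x₀, which has exponent up
to min_j D by Stein's lemma (`exists_test`). In the less capable case an input law that is nearly
optimal for receiver 1 serves all receivers, so the block code needs a fraction R/C_1 of the time
and the confirmation gets the rest.

Degraded channels. By data processing, receiver 1 has the smallest mutual informations and the
smallest relative entropies. Hence the channel is less capable and B = B_1, and the two bounds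
coincide. -/

theorem log_sum_le {ι : Type*} (s : Finset ι) (a b : ι → ℝ) (ha : ∀ i ∈ s, 0 ≤ a i)
    (hb : ∀ i ∈ s, 0 ≤ b i) (hab : ∀ i ∈ s, b i = 0 → a i = 0) :
    (∑ i ∈ s, a i) * Real.log ((∑ i ∈ s, a i) / ∑ i ∈ s, b i) ≤
      ∑ i ∈ s, a i * Real.log (a i / b i) := by
  set A := ∑ i ∈ s, a i with hA
  set B := ∑ i ∈ s, b i with hB
  have hA0 : 0 ≤ A := Finset.sum_nonneg ha
  rcases hA0.eq_or_lt with h0 | hApos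
  · have : ∀ i ∈ s, a i = 0 := (Finset.sum_eq_zero_iff_of_nonneg ha).1 h0.symm
    rw [← h0, zero_mul]
    exact (Finset.sum_eq_zero fun i hi => by rw [this i hi, zero_mul]).ge
  have hBpos : 0 < B := by
    refine (Finset.sum_nonneg hb).lt_of_ne fun h => hApos.ne' ?_
    have := (Finset.sum_eq_zero_iff_of_nonneg hb).1 h.symm
    exact Finset.sum_eq_zero fun i hi => hab i hi (this i hi)
  -- The tangent inequality `log x ≤ x - 1`, scaled so that equality holds at the ratio `A / B`; the
  -- correction terms cancel in the sum.
  have key : ∀ i ∈ s, a i * Real.log (A / B) + a i - b i * (A / B) ≤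
      a i * Real.log (a i / b i) := by
    intro i hi
    rcases (ha i hi).eq_or_lt with h | h
    · rw [← h]
      have := mul_nonneg (hb i hi) (div_nonneg hA0 hBpos.le)
      simp only [zero_mul]; linarith
    · have hbi : 0 < b i := (hb i hi).lt_of_ne fun h' => h.ne' (hab i hi h'.symm)
      have h1 := Real.log_le_sub_one_of_pos (x := (A / B) / (a i / b i)) (by positivity)
      rw [Real.log_div (by positivity) (by positivity)] at h1
      have h2 : a i * ((A / B) / (a i / b i)) = b i * (A / B) := by field_simp
      nlinarith
  have := Finset.sum_le_sum key
  rw [Finset.sum_sub_distrib, Finset.sum_add_distrib, ← Finset.sum_mul, ← Finset.sum_mul,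
    ← hA, ← hB] at this
  have h3 : B * (A / B) = A := by field_simp
  linarith

section Channel

variable {W X Y : Type*} [Fintype W] [Fintype X] [Fintype Y]

/-- The constants that enter the converse for a channel `p`: `B` bounds the relative entropies,
`C` the mutual informations (for unnormalized input laws), and `l` the likelihood ratios. -/
structure ChannelBounds (p : X → Y → ℝ) (B C l : ℝ) : Prop where
  nonneg : ∀ x b, 0 ≤ p x b
  sum_eq_one : ∀ x, ∑ b, p x b = 1
  B_pos : 0 < B
  C_pos : 0 < C
  l_pos : 0 < l
  ratio : ∀ x x' b, l * p x b ≤ p x' b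
  relEntropy_le : ∀ x x', ∑ b, p x b * Real.log (p x b / p x' b) ≤ B
  mutualInfo_le : ∀ q : X → ℝ, (∀ x, 0 ≤ q x) →
    ∑ x, ∑ b, q x * p x b * Real.log ((∑ x', q x') * p x b / ∑ x', q x' * p x' b) ≤
      (∑ x, q x) * C

/-- The masses of the outputs, when the input letters have masses `α`. -/
def push (p : X → Y → ℝ) (α : X → ℝ) (b : Y) : ℝ := ∑ x, α x * p x b

namespace ChannelBounds

variable {p : X → Y → ℝ} {B C l : ℝ}

theorem eq_zero (h : ChannelBounds p B C l) {x x' : X} {b : Y} (h0 : p x' b = 0) : p x b = 0 := by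
  have := h.ratio x x' b
  rw [h0] at this
  have := h.nonneg x b
  nlinarith [h.l_pos]

theorem push_nonneg (h : ChannelBounds p B C l) {α : X → ℝ} (hα : ∀ x, 0 ≤ α x) (b : Y) :
    0 ≤ push p α b :=
  Finset.sum_nonneg fun x _ => mul_nonneg (hα x) (h.nonneg x b)

theorem sum_push (h : ChannelBounds p B C l) (α : X → ℝ) : ∑ b, push p α b = ∑ x, α x := by
  unfold push
  rw [Finset.sum_comm]
  exact Finset.sum_congr rfl fun x _ => by rw [← Finset.mul_sum, h.sum_eq_one, mul_one]

theorem push_ratio (h : ChannelBounds p B C l) {α β : X → ℝ} (hα : ∀ x, 0 ≤ α x)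
    (hβ : ∀ x, 0 ≤ β x) (b : Y) :
    l * push p α b * ∑ x, β x ≤ (∑ x, α x) * push p β b := by
  unfold push
  rw [mul_assoc, Finset.sum_mul_sum, Finset.sum_mul_sum, Finset.mul_sum]
  refine Finset.sum_le_sum fun x _ => ?_
  rw [Finset.mul_sum]
  refine Finset.sum_le_sum fun x' _ => ?_
  have := mul_le_mul_of_nonneg_left (h.ratio x x' b) (mul_nonneg (hα x) (hβ x'))
  linarith

/-- Joint convexity of the relative entropy, for unnormalized mixtures of channel output laws. -/
theorem sum_push_mul_log_le (h : ChannelBounds p B C l) {α β : X → ℝ} (hα : ∀ x, 0 ≤ α x)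
    (hβ : ∀ x, 0 ≤ β x) (ha : 0 < ∑ x, α x) (hb : 0 < ∑ x, β x) :
    ∑ b, push p α b * Real.log (push p α b / push p β b) ≤
      (∑ x, α x) * Real.log ((∑ x, α x) / ∑ x, β x) + (∑ x, α x) * B := by
  set a := ∑ x, α x with hadef
  set t := ∑ x, β x with htdef
  have h1 : ∀ b, t * (push p α b * Real.log (push p α b / push p β b)) -
      t * (push p α b * Real.log (a / t)) ≤
      ∑ x, ∑ x', α x * β x' * (p x b * Real.log (p x b / p x' b)) := by
    intro b
    -- Both mixtures are written over pairs of letters with the same weights `α x * β x'`, which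
    -- cancel inside the logarithm. This scales the left side by `t`, divided out at the end.
    have hls := log_sum_le (Finset.univ : Finset (X × X))
      (fun z => α z.1 * β z.2 * p z.1 b) (fun z => α z.1 * β z.2 * p z.2 b)
      (fun z _ => mul_nonneg (mul_nonneg (hα _) (hβ _)) (h.nonneg _ _))
      (fun z _ => mul_nonneg (mul_nonneg (hα _) (hβ _)) (h.nonneg _ _))
      (fun z _ hz => by
        rcases mul_eq_zero.1 hz with hz | hz
        · rw [hz, zero_mul]
        · rw [h.eq_zero hz, mul_zero])
    have e1 : ∑ z : X × X, α z.1 * β z.2 * p z.1 b = push p α b * t := by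
      rw [Fintype.sum_prod_type, push, Finset.sum_mul_sum]
      exact Finset.sum_congr rfl fun x _ => Finset.sum_congr rfl fun x' _ => by ring
    have e2 : ∑ z : X × X, α z.1 * β z.2 * p z.2 b = a * push p β b := by
      rw [Fintype.sum_prod_type, push, Finset.sum_mul_sum]
      exact Finset.sum_congr rfl fun x _ => Finset.sum_congr rfl fun x' _ => by ring
    have e3 : ∑ z : X × X, α z.1 * β z.2 * p z.1 b *
        Real.log (α z.1 * β z.2 * p z.1 b / (α z.1 * β z.2 * p z.2 b)) =
        ∑ x, ∑ x', α x * β x' * (p x b * Real.log (p x b / p x' b)) := by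
      rw [Fintype.sum_prod_type]
      refine Finset.sum_congr rfl fun x _ => Finset.sum_congr rfl fun x' _ => ?_
      by_cases h0 : α x * β x' = 0
      · rw [h0]; ring
      · simp only [mul_div_mul_left _ _ h0]; ring
    rw [e1, e2, e3] at hls
    refine le_trans (le_of_eq ?_) hls
    rcases (h.push_nonneg hα b).eq_or_lt with h0 | h0
    · rw [← h0]; ring
    · have h0' : 0 < push p β b := by
        refine (h.push_nonneg hβ b).lt_of_ne fun hz => ?_
        have := h.push_ratio hα hβ b
        rw [← hz, mul_zero] at this
        have := mul_pos (mul_pos h.l_pos h0) hb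
        linarith
      rw [show push p α b * t / (a * push p β b) = (push p α b / push p β b) / (a / t) by
        field_simp, Real.log_div (div_pos h0 h0').ne' (div_pos ha hb).ne']
      ring
  have h2 := Finset.sum_le_sum fun b (_ : b ∈ Finset.univ) => h1 b
  have h3 : ∑ b, ∑ x, ∑ x', α x * β x' * (p x b * Real.log (p x b / p x' b)) ≤ a * t * B := by
    rw [Finset.sum_comm]
    simp_rw [Finset.sum_comm (s := (Finset.univ : Finset Y)), ← Finset.mul_sum]
    rw [hadef, htdef, Finset.sum_mul_sum, Finset.sum_mul]
    refine Finset.sum_le_sum fun x _ => ?_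
    rw [Finset.sum_mul]
    exact Finset.sum_le_sum fun x' _ =>
      mul_le_mul_of_nonneg_left (h.relEntropy_le x x') (mul_nonneg (hα x) (hβ x'))
  rw [Finset.sum_sub_distrib, ← Finset.mul_sum, ← Finset.mul_sum, ← Finset.sum_mul,
    h.sum_push α, ← hadef] at h2
  refine le_of_mul_le_mul_left ?_ hb
  linarith

end ChannelBounds

/-- The unnormalized entropy of a vector of masses. -/
def massEntropy (μ : W → ℝ) : ℝ := ∑ w, μ w * Real.log ((∑ w', μ w') / μ w)

/-- Comparison with the uniform law through `log x ≤ x - 1`; the additive `1` is the price of this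
crude form and is of lower order. -/
theorem massEntropy_le (μ : W → ℝ) (hμ : ∀ w, 0 ≤ μ w) {M : ℝ} (hM : (Fintype.card W : ℝ) ≤ M)
    (hM1 : 1 ≤ M) : massEntropy μ ≤ (∑ w, μ w) * (Real.log M + 1) := by
  set S := ∑ w, μ w with hS
  have hS0 : 0 ≤ S := Finset.sum_nonneg fun w _ => hμ w
  have key : ∀ w, μ w * Real.log (S / μ w) ≤ μ w * Real.log M + S / M := by
    intro w
    rcases (hμ w).eq_or_lt with h0 | h0
    · rw [← h0]; simp; positivity
    · have hSp : 0 < S := h0.trans_le (Finset.single_le_sum (fun w _ => hμ w) (Finset.mem_univ w))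
      have h1 := Real.log_le_sub_one_of_pos (x := (S / μ w) / M) (by positivity)
      rw [Real.log_div (by positivity) (by positivity)] at h1
      have h2 : μ w * ((S / μ w) / M) = S / M := by field_simp
      nlinarith
  have := Finset.sum_le_sum fun w (_ : w ∈ Finset.univ) => key w
  rw [Finset.sum_add_distrib, ← Finset.sum_mul, ← hS, Finset.sum_const, Finset.card_univ,
    nsmul_eq_mul] at this
  have h4 : (Fintype.card W : ℝ) * (S / M) ≤ S := by
    rw [mul_div_assoc', div_le_iff₀ (by linarith), mul_comm]
    exact mul_le_mul_of_nonneg_left hM hS0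
  unfold massEntropy
  linarith

/-- A Fano-type bound. The masses off `w₀` total at most a fraction `d` and are compared with the
uniform law; the term of `w₀` and the total comparison error each cost at most one unit of mass. -/
theorem massEntropy_le_of_concentrated (μ : W → ℝ) (hμ : ∀ w, 0 ≤ μ w) {M d : ℝ}
    (hM : (Fintype.card W : ℝ) ≤ M) (hM1 : 1 ≤ M) (w₀ : W)
    (hw₀ : (1 - d) * ∑ w, μ w ≤ μ w₀) :
    massEntropy μ ≤ (∑ w, μ w) * (2 + d * Real.log M) := by
  classical
  set S := ∑ w, μ w with hS
  have hS0 : 0 ≤ S := Finset.sum_nonneg fun w _ => hμ w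
  have hlog : 0 ≤ Real.log M := Real.log_nonneg hM1
  have key : ∀ w, μ w * Real.log (S / μ w) ≤
      (if w = w₀ then S else μ w * Real.log M) + S / M := by
    intro w
    rcases (hμ w).eq_or_lt with h0 | h0
    · rw [← h0]; split_ifs <;> simp <;> positivity
    · have hSp : 0 < S := h0.trans_le (Finset.single_le_sum (fun w _ => hμ w) (Finset.mem_univ w))
      split_ifs with hw
      · have h1 := Real.log_le_sub_one_of_pos (x := S / μ w) (by positivity)
        have h2 : μ w * (S / μ w) = S := by field_simp
        have : 0 ≤ S / M := by positivity
        nlinarith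
      · have h1 := Real.log_le_sub_one_of_pos (x := (S / μ w) / M) (by positivity)
        rw [Real.log_div (by positivity) (by positivity)] at h1
        have h2 : μ w * ((S / μ w) / M) = S / M := by field_simp
        nlinarith
  have := Finset.sum_le_sum fun w (_ : w ∈ Finset.univ) => key w
  rw [Finset.sum_add_distrib, Finset.sum_const, Finset.card_univ, nsmul_eq_mul,
    ← Finset.add_sum_erase _ (fun w => if w = w₀ then S else μ w * Real.log M)
      (Finset.mem_univ w₀), if_pos rfl] at this
  have h5 : ∑ w ∈ Finset.univ.erase w₀, (if w = w₀ then S else μ w * Real.log M) =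
      (S - μ w₀) * Real.log M := by
    rw [hS, ← Finset.add_sum_erase _ μ (Finset.mem_univ w₀), add_sub_cancel_left, Finset.sum_mul]
    exact Finset.sum_congr rfl fun w hw => by rw [if_neg (Finset.ne_of_mem_erase hw)]
  have h4 : (Fintype.card W : ℝ) * (S / M) ≤ S := by
    rw [mul_div_assoc', div_le_iff₀ (by linarith), mul_comm]
    exact mul_le_mul_of_nonneg_left hM hS0
  have h6 : (S - μ w₀) * Real.log M ≤ d * S * Real.log M :=
    mul_le_mul_of_nonneg_right (by linarith) hlog
  unfold massEntropy
  rw [h5] at this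
  linarith

/-- One use of the channel decreases the entropy of the message by at most the capacity. -/
theorem ChannelBounds.massEntropy_sub_le {p : X → Y → ℝ} {B C l : ℝ} (h : ChannelBounds p B C l)
    (v : W → X → ℝ) (hv : ∀ w x, 0 ≤ v w x) :
    massEntropy (fun w => ∑ x, v w x) ≤
      (∑ w, ∑ x, v w x) * C + ∑ b, massEntropy (fun w => push p (v w) b) := by
  set S := ∑ w, ∑ x, v w x with hS
  have hμ0 : ∀ w, 0 ≤ ∑ x, v w x := fun w => Finset.sum_nonneg fun x _ => hv w x
  have hS0 : 0 ≤ S := Finset.sum_nonneg fun w _ => hμ0 w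
  have hpn : ∀ w b, 0 ≤ push p (v w) b := fun w b => h.push_nonneg (hv w) b
  rcases hS0.eq_or_lt with h0 | hSpos
  · have hz : ∀ w, ∑ x, v w x = 0 := fun w =>
      (Finset.sum_eq_zero_iff_of_nonneg fun w _ => hμ0 w).1 h0.symm w (Finset.mem_univ _)
    have hz2 : ∀ w x, v w x = 0 := fun w x =>
      (Finset.sum_eq_zero_iff_of_nonneg fun x _ => hv w x).1 (hz w) x (Finset.mem_univ _)
    rw [← h0]
    simp [massEntropy, push, hz2]
  set q : X → ℝ := fun x => ∑ w, v w x with hq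
  set s : Y → ℝ := fun b => ∑ w, push p (v w) b with hs
  have hsq : ∀ b, s b = ∑ x, q x * p x b := by
    intro b
    simp only [hs, push, hq, Finset.sum_mul]
    exact Finset.sum_comm
  have hqS : ∑ x, q x = S := by simp only [hq, hS]; exact Finset.sum_comm
  have hq0 : ∀ x, 0 ≤ q x := fun x => Finset.sum_nonneg fun w _ => hv w x
  have hmi := h.mutualInfo_le q hq0
  simp_rw [hqS, ← hsq] at hmi
  -- For fixed message and output, the log-sum inequality over the inputs is the data processing
  -- step: the message tells no more about the output than the input does. Multiplying by `S`
  -- removes the normalization of the masses.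
  have key : ∀ w b, S * (push p (v w) b * Real.log (S / ∑ x, v w x)) -
      S * (push p (v w) b * Real.log (s b / push p (v w) b)) ≤
      S * ∑ x, v w x * p x b * Real.log (S * p x b / s b) := by
    intro w b
    rcases (hpn w b).eq_or_lt with hp0 | hp0
    · have hz : ∀ x, v w x * p x b = 0 := fun x =>
        (Finset.sum_eq_zero_iff_of_nonneg fun x _ => mul_nonneg (hv w x) (h.nonneg x b)).1
          hp0.symm x (Finset.mem_univ _)
      rw [← hp0]
      simp [hz]
    have hsb : 0 < s b := hp0.trans_le
      (Finset.single_le_sum (f := fun w => push p (v w) b) (fun w _ => hpn w b) (Finset.mem_univ w))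
    have hμw : 0 < ∑ x, v w x := by
      refine (hμ0 w).lt_of_ne fun hz => hp0.ne' ?_
      have := (Finset.sum_eq_zero_iff_of_nonneg fun x _ => hv w x).1 hz.symm
      exact Finset.sum_eq_zero fun x hx => by rw [this x hx, zero_mul]
    have hls := log_sum_le (Finset.univ : Finset X) (fun x => S * (v w x * p x b))
      (fun x => v w x * s b) (fun x _ => mul_nonneg hS0 (mul_nonneg (hv w x) (h.nonneg x b)))
      (fun x _ => mul_nonneg (hv w x) hsb.le) (fun x _ hx => by
        rw [(mul_eq_zero.1 hx).resolve_right hsb.ne', zero_mul, mul_zero])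
    rw [← Finset.mul_sum, ← Finset.sum_mul, show ∑ x, v w x * p x b = push p (v w) b from rfl]
      at hls
    have e1 : ∑ x, S * (v w x * p x b) * Real.log (S * (v w x * p x b) / (v w x * s b)) =
        S * ∑ x, v w x * p x b * Real.log (S * p x b / s b) := by
      rw [Finset.mul_sum]
      refine Finset.sum_congr rfl fun x _ => ?_
      by_cases h0 : v w x = 0
      · rw [h0]; ring
      · rw [show S * (v w x * p x b) = v w x * (S * p x b) by ring, mul_div_mul_left _ _ h0]; ring
    rw [e1] at hls
    refine le_trans (le_of_eq ?_) hls
    rw [show S * push p (v w) b / ((∑ x, v w x) * s b) =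
      (S / ∑ x, v w x) / (s b / push p (v w) b) by field_simp,
      Real.log_div (div_pos hSpos hμw).ne' (div_pos hsb hp0).ne']
    ring
  have h2 := Finset.sum_le_sum fun b (_ : b ∈ Finset.univ) =>
    Finset.sum_le_sum fun w (_ : w ∈ Finset.univ) => key w b
  have e2 : ∑ b, ∑ w, S * ∑ x, v w x * p x b * Real.log (S * p x b / s b) =
      S * ∑ x, ∑ b, q x * p x b * Real.log (S * p x b / s b) := by
    simp_rw [← Finset.mul_sum]
    congr 1
    rw [Finset.sum_comm (s := (Finset.univ : Finset X))]
    refine Finset.sum_congr rfl fun b _ => ?_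
    rw [Finset.sum_comm]
    refine Finset.sum_congr rfl fun x _ => ?_
    rw [← Finset.sum_mul, ← Finset.sum_mul]
  have e3 : ∑ b, ∑ w, push p (v w) b * Real.log (S / ∑ x, v w x) =
      massEntropy (fun w => ∑ x, v w x) := by
    rw [Finset.sum_comm]
    refine Finset.sum_congr rfl fun w _ => ?_
    rw [← Finset.sum_mul, h.sum_push]
  simp_rw [Finset.sum_sub_distrib, ← Finset.mul_sum] at h2
  simp_rw [← Finset.mul_sum] at e2
  rw [e2, e3] at h2
  refine le_of_mul_le_mul_left (a := S) ?_ hSpos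
  have h3 := mul_le_mul_of_nonneg_left hmi hS0
  have e4 : ∑ b, massEntropy (fun w => push p (v w) b) =
    ∑ b, ∑ w, push p (v w) b * Real.log (s b / push p (v w) b) := rfl
  rw [e4]
  linarith

end Channel

/-! ### The converse on a transmission tree: test potential and entropy. -/

section Converse

variable {W X Y : Type*} [Fintype W] [Fintype X] [Fintype Y]

/-- `Attains p μ len err`: when message `w` and the past have joint mass `μ w`, some sequential
transmission over the channel `p` with bounded horizon has further expected length `len` and error
mass `err`. In `go`, the number `v w x` is the joint mass of message `w` and channel input `x`. -/
inductive Attains (p : X → Y → ℝ) : (W → ℝ) → ℝ → ℝ → Prop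
  | halt (μ : W → ℝ) (w₀ : W) : Attains p μ 0 (∑ w, μ w - μ w₀)
  | go (v : W → X → ℝ) (hv : ∀ w x, 0 ≤ v w x) (len err : Y → ℝ)
      (h : ∀ b, Attains p (fun w => push p (v w) b) (len b) (err b)) :
      Attains p (fun w => ∑ x, v w x) (∑ w, ∑ x, v w x + ∑ b, len b) (∑ b, err b)

/-- A potential for the test between two hypotheses of masses `a` and `b`. -/
def testPotential (k a b : ℝ) : ℝ := a * Real.log (k * b / a) + b * Real.log (k * a / b)

theorem testPotential_eq_zero {k a b : ℝ} (h : a = 0 ∨ b = 0) : testPotential k a b = 0 := by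
  rcases h with h | h <;> simp [testPotential, h]

/-- This is the value at a halt that decides for `a`, with error mass `b`. With `k = K * B / 2` it
is at most `B` times the error weighted by `K`; the symmetry of the potential covers the opposite
decision. -/
theorem testPotential_le {k a b : ℝ} (hk : 0 < k) (ha : 0 ≤ a) (hb : 0 ≤ b) :
    testPotential k a b ≤ 2 * k * b := by
  rcases ha.eq_or_lt with ha | ha
  · rw [testPotential_eq_zero (Or.inl ha.symm)]; positivity
  rcases hb.eq_or_lt with hb | hb
  · rw [testPotential_eq_zero (Or.inr hb.symm), ← hb]; simp
  have h1 := Real.log_le_sub_one_of_pos (x := k * b / a) (by positivity)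
  have h2 := Real.log_le_sub_one_of_pos (x := a / b) (by positivity)
  have h3 := Real.log_le_sub_one_of_pos hk
  have e : Real.log (k * a / b) = Real.log k + Real.log (a / b) := by
    rw [mul_div_assoc, Real.log_mul hk.ne' (by positivity)]
  have e1 : a * (k * b / a) = k * b := by field_simp
  have e2 : b * (a / b) = a := by field_simp
  unfold testPotential
  rw [e]
  nlinarith

theorem testPotential_comm (k a b : ℝ) : testPotential k a b = testPotential k b a :=
  add_comm _ _

theorem testPotential_eq {k a b : ℝ} (hk : 0 < k) (ha : 0 < a) (hb : 0 < b) :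
    testPotential k a b = (a + b) * Real.log k - (a - b) * Real.log (a / b) := by
  unfold testPotential
  rw [mul_div_assoc, mul_div_assoc, Real.log_mul hk.ne' (by positivity),
    Real.log_mul hk.ne' (by positivity), Real.log_div hb.ne' ha.ne', Real.log_div ha.ne' hb.ne']
  ring

variable {p : X → Y → ℝ} {B C l : ℝ}

theorem push_eq_zero {X Y : Type*} [Fintype X] (p : X → Y → ℝ) {α : X → ℝ} (hα : ∀ x, 0 ≤ α x)
    (h0 : ∑ x, α x = 0) (b : Y) : push p α b = 0 := by
  have := (Finset.sum_eq_zero_iff_of_nonneg fun x _ => hα x).1 h0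
  exact Finset.sum_eq_zero fun x hx => by rw [this x hx, zero_mul]

theorem ChannelBounds.mul_log_push (h : ChannelBounds p B C l) {α β : X → ℝ}
    (hα : ∀ x, 0 ≤ α x) (hβ : ∀ x, 0 ≤ β x) (hb : 0 < ∑ x, β x) {k : ℝ} (hk : 0 < k) (b : Y) :
    push p α b * Real.log (k * push p β b / push p α b) =
      push p α b * Real.log k - push p α b * Real.log (push p α b / push p β b) := by
  rcases (h.push_nonneg hα b).eq_or_lt with h0 | h0
  · rw [← h0]; ring
  · have h0' : 0 < push p β b := by
      refine (h.push_nonneg hβ b).lt_of_ne fun hz => ?_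
      have := h.push_ratio hα hβ b
      rw [← hz, mul_zero] at this
      have := mul_pos (mul_pos h.l_pos h0) hb
      linarith
    rw [mul_div_assoc, Real.log_mul hk.ne' (by positivity), Real.log_div h0'.ne' h0.ne',
      Real.log_div h0.ne' h0'.ne']
    ring

/-- One use of the channel decreases the test potential by at most `B`. -/
theorem ChannelBounds.testPotential_step (h : ChannelBounds p B C l) {α β : X → ℝ}
    (hα : ∀ x, 0 ≤ α x) (hβ : ∀ x, 0 ≤ β x) {k : ℝ} (hk : 0 < k) :
    testPotential k (∑ x, α x) (∑ x, β x) ≤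
      B * (∑ x, α x + ∑ x, β x) + ∑ b, testPotential k (push p α b) (push p β b) := by
  have ha0 : 0 ≤ ∑ x, α x := Finset.sum_nonneg fun x _ => hα x
  have hb0 : 0 ≤ ∑ x, β x := Finset.sum_nonneg fun x _ => hβ x
  have hB := h.B_pos
  by_cases hz : (∑ x, α x) = 0 ∨ (∑ x, β x) = 0
  · rw [testPotential_eq_zero hz, Finset.sum_eq_zero fun b _ => testPotential_eq_zero ?_]
    · positivity
    · exact hz.imp (fun h' => push_eq_zero p hα h' b) fun h' => push_eq_zero p hβ h' b
  push Not at hz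
  have ha := ha0.lt_of_ne hz.1.symm
  have hb := hb0.lt_of_ne hz.2.symm
  have h1 := h.sum_push_mul_log_le hα hβ ha hb
  have h2 := h.sum_push_mul_log_le hβ hα hb ha
  unfold testPotential
  simp_rw [h.mul_log_push hα hβ hb hk, h.mul_log_push hβ hα ha hk]
  rw [Finset.sum_add_distrib, Finset.sum_sub_distrib, Finset.sum_sub_distrib, ← Finset.sum_mul,
    ← Finset.sum_mul, h.sum_push, h.sum_push, mul_div_assoc, mul_div_assoc,
    Real.log_mul hk.ne' (div_pos hb ha).ne', Real.log_mul hk.ne' (div_pos ha hb).ne']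
  have e1 : Real.log ((∑ x, α x) / ∑ x, β x) = -Real.log ((∑ x, β x) / ∑ x, α x) := by
    rw [← Real.log_inv, inv_div]
  rw [e1] at h1 ⊢
  rw [← neg_neg (Real.log ((∑ x, β x) / ∑ x, α x)), ← e1] at h2
  rw [e1] at h2
  simp only [neg_neg] at h2
  linarith

/-- Induction on the tree, all messages other than `w₀` being lumped into one hypothesis. Each use
costs at most `B` per unit of mass, which the term `B * len` pays for. -/
theorem Attains.testPotential_le (h : ChannelBounds p B C l) {K : ℝ} (hK : 0 < K) {μ : W → ℝ}
    {len err : ℝ} (hA : Attains p μ len err) (hμ : ∀ w, 0 ≤ μ w) (w₀ : W) :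
    testPotential (K * B / 2) (μ w₀) (∑ w, μ w - μ w₀) ≤ B * (len + K * err) := by
  have hB := h.B_pos
  have hk : 0 < K * B / 2 := by positivity
  induction hA with
  | halt μ w₁ =>
    have hb : 0 ≤ ∑ w, μ w - μ w₀ :=
      sub_nonneg.2 (Finset.single_le_sum (fun w _ => hμ w) (Finset.mem_univ w₀))
    rw [show B * (0 + K * (∑ w, μ w - μ w₁)) = 2 * (K * B / 2) * (∑ w, μ w - μ w₁) by ring]
    -- Deciding for `w₀` errs on all the other messages; deciding for another message errs at least
    -- on the mass of `w₀`.
    by_cases hw : w₁ = w₀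
    · rw [hw]
      exact BroadcastChannel.testPotential_le hk (hμ _) hb
    · rw [testPotential_comm]
      refine (BroadcastChannel.testPotential_le hk hb (hμ w₀)).trans ?_
      refine mul_le_mul_of_nonneg_left ?_ (by positivity)
      rw [le_sub_iff_add_le]
      exact Finset.add_le_sum (fun w _ => hμ w) (Finset.mem_univ w₀) (Finset.mem_univ w₁)
        (Ne.symm hw)
  | go v hv len err hch ih =>
    have hβ : ∀ x, 0 ≤ ∑ w, v w x - v w₀ x := fun x =>
      sub_nonneg.2 (Finset.single_le_sum (f := fun w => v w x) (fun w _ => hv w x)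
        (Finset.mem_univ w₀))
    have e1 : ∑ x, (∑ w, v w x - v w₀ x) = ∑ w, ∑ x, v w x - ∑ x, v w₀ x := by
      rw [Finset.sum_sub_distrib, Finset.sum_comm]
    have e2 : ∀ b, push p (fun x => ∑ w, v w x - v w₀ x) b =
        ∑ w, push p (v w) b - push p (v w₀) b := by
      intro b
      simp only [push, sub_mul, Finset.sum_sub_distrib, Finset.sum_mul]
      rw [Finset.sum_comm]
    have hs := h.testPotential_step (hv w₀) hβ hk
    simp_rw [e1, e2] at hs
    have hi := Finset.sum_le_sum fun b (_ : b ∈ Finset.univ) =>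
      ih b (fun w => h.push_nonneg (hv w) b)
    rw [← Finset.mul_sum, Finset.sum_add_distrib, ← Finset.mul_sum] at hi
    refine hs.trans ?_
    rw [show ∑ x, v w₀ x + (∑ w, ∑ x, v w x - ∑ x, v w₀ x) = ∑ w, ∑ x, v w x by ring]
    linarith

/-- The potential is `(a + b) log k` minus `(a - b) log (a / b)`, and the ratio `a / b` lies between
`1` and `1 / r`. Thus a moderately unbalanced pair of hypotheses still carries nearly the full
potential. -/
theorem le_testPotential {k a b r : ℝ} (hk : 0 < k) (hb : 0 < b) (hr : 0 < r)
    (hba : b ≤ a) (hrab : r * a ≤ b) :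
    (a + b) * (Real.log k - Real.log (1 / r)) ≤ testPotential k a b := by
  have ha : 0 < a := hb.trans_le hba
  rw [testPotential_eq hk ha hb]
  have h0 : 0 ≤ Real.log (a / b) := Real.log_nonneg ((one_le_div hb).2 hba)
  have h1 : Real.log (a / b) ≤ Real.log (1 / r) := by
    refine Real.log_le_log (by positivity) ?_
    rw [div_le_div_iff₀ hb hr]
    linarith
  nlinarith

/-- The converse along one transmission: length and error mass from an undecided state on. -/
theorem Attains.entropy_le (h : ChannelBounds p B C l) {K M c d : ℝ} (hK : 0 < K)
    (hM : (Fintype.card W : ℝ) ≤ M) (hM1 : 1 ≤ M) (hd : 0 < d) (hd2 : d ≤ 1 / 2) (hc : 0 ≤ c)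
    (hcC : c * C ≤ 1)
    (hKd : (Real.log (K * B / 2) - Real.log (1 / (l * d))) / B - c * (2 + d * Real.log M) +
      c * (Real.log M + 1) ≤ K * d)
    {μ : W → ℝ} {len err : ℝ} (hA : Attains p μ len err) (hμ : ∀ w, 0 ≤ μ w)
    (hund : ∀ w, μ w ≤ (1 - d) * ∑ w, μ w) :
    (∑ w, μ w) * ((Real.log (K * B / 2) - Real.log (1 / (l * d))) / B -
      c * (2 + d * Real.log M)) + c * massEntropy μ ≤ len + K * err := by
  have hB := h.B_pos
  have hl := h.l_pos
  have hk : 0 < K * B / 2 := by positivity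
  induction hA with
  -- A halt in an undecided state errs on at least the fraction `d` of the mass; `hKd` says that
  -- this alone outweighs the claimed lower bound.
  | halt μ w₁ =>
    have hS : 0 ≤ ∑ w, μ w := Finset.sum_nonneg fun w _ => hμ w
    have h1 := mul_le_mul_of_nonneg_left (massEntropy_le μ hμ hM hM1) hc
    have h2 := mul_le_mul_of_nonneg_left hKd hS
    have h3 := mul_le_mul_of_nonneg_left (hund w₁) hK.le
    nlinarith
  | go v hv len err hch ih =>
    have hμb : ∀ b w, 0 ≤ push p (v w) b := fun b w => h.push_nonneg (hv w) b
    have key : ∀ b, (∑ w, push p (v w) b) *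
        ((Real.log (K * B / 2) - Real.log (1 / (l * d))) / B - c * (2 + d * Real.log M)) +
        c * massEntropy (fun w => push p (v w) b) ≤ len b + K * err b := by
      intro b
      -- A child that is still undecided falls under the induction hypothesis. At a child that has
      -- become decided, the entropy is at most `2 + d * log M` per unit of mass, the term
      -- subtracted in the bound for this purpose, and the test potential takes over.
      by_cases hdec : ∀ w, push p (v w) b ≤ (1 - d) * ∑ w, push p (v w) b
      · exact ih b (hμb b) hdec
      push Not at hdec
      obtain ⟨w₀, hw₀⟩ := hdec
      have hSb : 0 ≤ ∑ w, push p (v w) b := Finset.sum_nonneg fun w _ => hμb b w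
      have ha' : 0 < push p (v w₀) b := lt_of_le_of_lt (mul_nonneg (by linarith) hSb) hw₀
      have ha : 0 < ∑ x, v w₀ x := by
        refine (Finset.sum_nonneg fun x _ => hv w₀ x).lt_of_ne fun hz => ha'.ne' ?_
        exact push_eq_zero p (hv w₀) hz.symm b
      have hβ : ∀ x, 0 ≤ ∑ w, v w x - v w₀ x := fun x =>
        sub_nonneg.2 (Finset.single_le_sum (f := fun w => v w x) (fun w _ => hv w x)
          (Finset.mem_univ w₀))
      have e1 : ∑ x, (∑ w, v w x - v w₀ x) = ∑ w, ∑ x, v w x - ∑ x, v w₀ x := by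
        rw [Finset.sum_sub_distrib, Finset.sum_comm]
      have e2 : push p (fun x => ∑ w, v w x - v w₀ x) b =
          ∑ w, push p (v w) b - push p (v w₀) b := by
        simp only [push, sub_mul, Finset.sum_sub_distrib, Finset.sum_mul]
        rw [Finset.sum_comm]
      have hr := h.push_ratio (hv w₀) hβ b
      rw [e1, e2] at hr
      have hrest : d * ∑ x, v w₀ x ≤ ∑ w, ∑ x, v w x - ∑ x, v w₀ x := by
        have h1 := hund w₀
        have h2 : ∑ x, v w₀ x ≤ ∑ w, ∑ x, v w x :=
          Finset.single_le_sum (f := fun w => ∑ x, v w x)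
            (fun w _ => Finset.sum_nonneg fun x _ => hv w x) (Finset.mem_univ w₀)
        nlinarith
      -- Control of the overshoot: before this use the other messages had at least `d` times the
      -- mass of `w₀`, and a single output can reduce this ratio at most by the factor `l`.
      have hratio : l * d * push p (v w₀) b ≤ ∑ w, push p (v w) b - push p (v w₀) b := by
        refine le_of_mul_le_mul_left ?_ ha
        refine le_trans ?_ hr
        have := mul_le_mul_of_nonneg_left hrest (mul_pos hl ha').le
        linarith
      have hb' : 0 < ∑ w, push p (v w) b - push p (v w₀) b :=
        lt_of_lt_of_le (by positivity) hratio
      have hG := Attains.testPotential_le h hK (hch b) (hμb b) w₀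
      have hG2 := (le_testPotential hk hb' (mul_pos hl hd) (by nlinarith) hratio).trans hG
      rw [add_sub_cancel] at hG2
      have hE := mul_le_mul_of_nonneg_left
        (massEntropy_le_of_concentrated _ (hμb b) hM hM1 w₀ hw₀.le) hc
      have hG3 : (∑ w, push p (v w) b) * ((Real.log (K * B / 2) - Real.log (1 / (l * d))) / B) ≤
          len b + K * err b := by
        rw [mul_div_assoc', div_le_iff₀ hB]
        linarith
      linarith
    have hsum := Finset.sum_le_sum fun b (_ : b ∈ Finset.univ) => key b
    rw [Finset.sum_add_distrib, Finset.sum_add_distrib, ← Finset.sum_mul, ← Finset.mul_sum,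
      ← Finset.mul_sum, Finset.sum_comm] at hsum
    simp_rw [h.sum_push] at hsum
    have hent := mul_le_mul_of_nonneg_left (h.massEntropy_sub_le v hv) hc
    have hS : 0 ≤ ∑ w, ∑ x, v w x :=
      Finset.sum_nonneg fun w _ => Finset.sum_nonneg fun x _ => hv w x
    have := mul_le_mul_of_nonneg_left hcC hS
    linarith

end Converse

/-! ### The law of the outputs under a code. -/

section Law

variable {K : ℕ} {X : Type*} {Y : Fin K → Type*} [∀ j, MeasurableSpace (Y j)] {M : ℕ}

/-- The first `n` outputs of all receivers. -/
def outputPrefix (n : ℕ) (ω : ℕ → ∀ j, Y j) : Fin n → ∀ j, Y j := fun i => ω i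

theorem measurable_outputPrefix (n : ℕ) : Measurable (outputPrefix (Y := Y) n) :=
  measurable_pi_lambda _ fun i => measurable_pi_apply (i : ℕ)

namespace VLFTCode

variable [∀ j, Finite (Y j)] [∀ j, MeasurableSingletonClass (Y j)]
  (c : VLFTCode M X Y) (ch : BroadcastChannel X Y) (w : Fin M)

instance : IsProbabilityMeasure (ch (c.encoder 0 w Fin.elim0)).toMeasure :=
  PMF.toMeasure.isProbabilityMeasure _

instance : IsProbabilityMeasure (c.outputLaw ch w) := by
  unfold outputLaw; infer_instance

theorem outputLaw_map_zero :
    (c.outputLaw ch w).map (fun ω => ω 0) = (ch (c.encoder 0 w Fin.elim0)).toMeasure := by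
  have h1 : (c.outputLaw ch w).map (Preorder.frestrictLe 0) =
      (ch (c.encoder 0 w Fin.elim0)).toMeasure.map
        (MeasurableEquiv.piUnique (fun _ : Finset.Iic 0 => ∀ j, Y j)).symm := by
    unfold outputLaw Kernel.trajMeasure
    rw [Measure.map_comp _ _ (by fun_prop), Kernel.traj_map_frestrictLe, Kernel.partialTraj_self]
    exact Measure.id_comp
  have h2 : (fun ω : ℕ → ∀ j, Y j => ω 0) =
      (fun v : (∀ _ : Finset.Iic 0, ∀ j, Y j) => v ⟨0, by simp⟩) ∘ Preorder.frestrictLe 0 := rfl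
  rw [h2, ← Measure.map_map (by fun_prop) (by fun_prop), h1, Measure.map_map (by fun_prop)
    (by fun_prop)]
  exact Measure.map_id

/-- The chain rule, through which the trajectory measure is used from here on. The first output is a
separate case: it comes from the initial law, the later ones from `stepKernel`. -/
theorem outputLaw_prefix_succ (n : ℕ) (u : Fin n → ∀ j, Y j) (z : ∀ j, Y j) :
    c.outputLaw ch w {ω | outputPrefix n ω = u ∧ ω n = z} =
      c.outputLaw ch w {ω | outputPrefix n ω = u} * ch (c.encoder n w u) z := by
  rcases n with _ | n
  · have hu : u = Fin.elim0 := Subsingleton.elim _ _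
    have h1 : {ω : ℕ → ∀ j, Y j | outputPrefix 0 ω = u ∧ ω 0 = z} = (fun ω => ω 0) ⁻¹' {z} := by
      ext ω; simp [eq_iff_true_of_subsingleton]
    have h2 : {ω : ℕ → ∀ j, Y j | outputPrefix 0 ω = u} = Set.univ := by
      ext ω; simp [eq_iff_true_of_subsingleton]
    rw [h1, h2, measure_univ, one_mul, ← Measure.map_apply (by fun_prop) (measurableSet_singleton z),
      c.outputLaw_map_zero, PMF.toMeasure_apply_singleton _ _ (measurableSet_singleton z), hu]
  · set v : ∀ _ : Finset.Iic n, ∀ j, Y j :=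
      fun i => u ⟨i, Nat.lt_succ_of_le (Finset.mem_Iic.1 i.2)⟩ with hv
    have hpre : ∀ ω : ℕ → ∀ j, Y j, outputPrefix (n + 1) ω = u ↔ Preorder.frestrictLe n ω = v := by
      intro ω
      constructor
      · rintro rfl; rfl
      · intro h
        funext i
        exact congrFun h ⟨i, Finset.mem_Iic.2 (Nat.lt_succ_iff.1 i.2)⟩
    have hc := Kernel.map_frestrictLe_trajMeasure_compProd_eq_map_trajMeasure
      (X := fun _ => ∀ j, Y j) (μ₀ := (ch (c.encoder 0 w Fin.elim0)).toMeasure)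
      (κ := c.stepKernel ch w) (a := n)
    have hc2 := congrArg (fun μ => μ ({v} ×ˢ {z})) hc
    rw [Measure.compProd_apply_prod (measurableSet_singleton v) (measurableSet_singleton z),
      lintegral_singleton, Measure.map_apply (by fun_prop) (measurableSet_singleton v),
      Measure.map_apply (by fun_prop) ((measurableSet_singleton v).prod (measurableSet_singleton z))]
      at hc2
    simp_rw [hpre]
    refine Eq.trans ?_ (hc2.symm.trans ?_)
    · rfl
    rw [mul_comm]
    congr 1
    exact PMF.toMeasure_apply_singleton _ _ (measurableSet_singleton z)

end VLFTCode

end Law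

/-- Measurability of `S` is not needed: the fibers of `f` are measurable and finitely many, so they
split the measure restricted to `S`. Error events can thus be handled without measurability proofs.
-/
theorem measure_eq_sum_fiber {Ω ι : Type*} [MeasurableSpace Ω] [Fintype ι] [MeasurableSpace ι]
    [MeasurableSingletonClass ι] (μ : Measure Ω) {f : Ω → ι} (hf : Measurable f) (S : Set Ω) :
    μ S = ∑ i, μ (S ∩ {ω | f ω = i}) := by
  have h := sum_measure_preimage_singleton (μ := μ.restrict S) (f := f) Finset.univ
    (fun y _ => hf (measurableSet_singleton y))
  simp only [Finset.coe_univ, Set.preimage_univ, Measure.restrict_apply_univ] at h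
  rw [← h]
  refine Finset.sum_congr rfl fun i _ => ?_
  rw [Measure.restrict_apply (hf (measurableSet_singleton i)), Set.inter_comm]
  rfl

theorem measureReal_eq_sum_fiber {Ω ι : Type*} [MeasurableSpace Ω] [Fintype ι] [MeasurableSpace ι]
    [MeasurableSingletonClass ι] (μ : Measure Ω) [IsFiniteMeasure μ] {f : Ω → ι}
    (hf : Measurable f) (S : Set Ω) :
    μ.real S = ∑ i, μ.real (S ∩ {ω | f ω = i}) := by
  rw [measureReal_def, measure_eq_sum_fiber μ hf S, ENNReal.toReal_sum fun i _ => measure_ne_top _ _]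
  rfl

/-! ### From a code to the transmission tree of one receiver. -/

section Law

variable {K : ℕ} {X : Type*} {Y : Fin K → Type*} [∀ j, MeasurableSpace (Y j)] {M : ℕ}

namespace VLFTCode

theorem stopTime_le_iff (c : VLFTCode M X Y) {j : Fin K} {n : ℕ} {ω ω' : Sample M Y}
    (h : received j n ω = received j n ω') : c.stopTime j ω ≤ n ↔ c.stopTime j ω' ≤ n := by
  obtain ⟨S, _, hS⟩ := c.stopTime_isStoppingTime j n
  have h1 : ∀ ω, c.stopTime j ω ≤ n ↔ received j n ω ∈ S := fun ω => (Set.ext_iff.1 hS ω).symm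
  rw [h1, h1, h]

theorem measurableSet_stopTime_le (c : VLFTCode M X Y) (j : Fin K) (n : ℕ) :
    MeasurableSet {ω | c.stopTime j ω ≤ n} :=
  (outputFiltration M Y j).le n _ (c.stopTime_isStoppingTime j n)

theorem received_snoc_iff (j : Fin K) (n : ℕ) (y : Fin n → Y j) (b : Y j) (ω : Sample M Y) :
    received j (n + 1) ω = (Fin.snoc y b : Fin (n + 1) → Y j) ↔
      received j n ω = y ∧ ω.2 n j = b := by
  constructor
  · intro h
    constructor
    · funext i
      have := congrFun h i.castSucc
      rwa [Fin.snoc_castSucc] at this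
    · have := congrFun h (Fin.last n)
      rwa [Fin.snoc_last] at this
  · rintro ⟨rfl, rfl⟩
    funext i
    refine Fin.lastCases ?_ (fun i => ?_) i
    · rw [Fin.snoc_last]; rfl
    · rw [Fin.snoc_castSucc]; rfl

variable [∀ j, Finite (Y j)] [∀ j, MeasurableSingletonClass (Y j)]
  (c : VLFTCode M X Y) (ch : BroadcastChannel X Y)

theorem law_apply (S : Set (Sample M Y)) :
    c.law ch S = (M : ℝ≥0∞)⁻¹ * ∑ w, c.outputLaw ch w (Prod.mk w ⁻¹' S) := by
  unfold law
  rw [Measure.smul_apply, Measure.finsetSum_apply, smul_eq_mul]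
  congr 1
  exact Finset.sum_congr rfl fun w _ => (measurableEmbedding_prodMk_left w).map_apply _ _

theorem isProbabilityMeasure_law (hM : M ≠ 0) : IsProbabilityMeasure (c.law ch) := by
  constructor
  rw [law_apply]
  simp only [Set.preimage_univ, measure_univ, Finset.sum_const, Finset.card_univ, Fintype.card_fin,
    nsmul_eq_mul, mul_one]
  exact ENNReal.inv_mul_cancel (by exact_mod_cast hM) (ENNReal.natCast_ne_top M)

theorem law_real_apply (S : Set (Sample M Y)) :
    (c.law ch).real S = (M : ℝ)⁻¹ * ∑ w, (c.outputLaw ch w).real (Prod.mk w ⁻¹' S) := by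
  rw [measureReal_def, law_apply, ENNReal.toReal_mul, ENNReal.toReal_inv, ENNReal.toReal_natCast,
    ENNReal.toReal_sum fun i _ => measure_ne_top _ _]
  rfl

end VLFTCode

theorem sum_marginal {K : ℕ} {X : Type*} {Y : Fin K → Type*} [∀ j, Fintype (Y j)] (ch : BroadcastChannel X Y)
    (j : Fin K) [DecidableEq (Y j)] (x : X) (b : Y j) :
    ∑ z : ∀ j, Y j, (if z j = b then ch x z else 0) = ch.marginal j x b := by
  unfold marginal
  rw [PMF.map_apply, tsum_fintype]
  refine Finset.sum_congr rfl fun z _ => ?_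
  by_cases h : z j = b <;> simp [h, eq_comm (a := b)]

namespace VLFTCode

variable [∀ j, Fintype (Y j)] [∀ j, MeasurableSingletonClass (Y j)]
  (c : VLFTCode M X Y) (ch : BroadcastChannel X Y)

theorem outputLaw_prefix_succ_marginal (w : Fin M) (n : ℕ) (u : Fin n → ∀ j, Y j) (j : Fin K)
    (b : Y j) :
    c.outputLaw ch w {ω | outputPrefix n ω = u ∧ ω n j = b} =
      c.outputLaw ch w {ω | outputPrefix n ω = u} * ch.marginal j (c.encoder n w u) b := by
  classical
  rw [measure_eq_sum_fiber _ (f := fun ω => ω n) (measurable_pi_apply n), ← sum_marginal,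
    Finset.mul_sum]
  refine Finset.sum_congr rfl fun z _ => ?_
  split_ifs with hz
  · rw [← c.outputLaw_prefix_succ]
    congr 1
    ext ω
    simp only [Set.mem_inter_iff, Set.mem_ofPred_eq]
    constructor
    · rintro ⟨⟨h1, -⟩, h2⟩; exact ⟨h1, h2⟩
    · rintro ⟨h1, h2⟩; exact ⟨⟨h1, by rw [h2, hz]⟩, h2⟩
  · rw [mul_zero]
    convert measure_empty (μ := c.outputLaw ch w)
    ext ω
    simp only [Set.mem_inter_iff, Set.mem_ofPred_eq, Set.mem_empty_iff_false, iff_false]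
    rintro ⟨⟨-, h1⟩, h2⟩
    exact hz (by rw [← h2, h1])

/-- The real-valued transition matrix of the channel to receiver `j`. -/
def _root_.BroadcastChannel.matrix (ch : BroadcastChannel X Y) (j : Fin K) (x : X) (b : Y j) : ℝ :=
  (ch.marginal j x b).toReal

/-- The encoder uses the outputs of all receivers, so the outputs of receiver `j` alone leave the
input random. Splitting into full prefixes and grouping them by the input they produce shows that
only the law of the input enters. -/
theorem outputLaw_step [Fintype X] (w : Fin M) (n : ℕ) (A : Set (Fin n → ∀ j, Y j)) (j : Fin K)
    (b : Y j) :
    (c.outputLaw ch w).real {ω | outputPrefix n ω ∈ A ∧ ω n j = b} =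
      push (ch.matrix j) (fun x => (c.outputLaw ch w).real
        {ω | outputPrefix n ω ∈ A ∧ c.encoder n w (outputPrefix n ω) = x}) b := by
  classical
  unfold push
  simp_rw [fun x => measureReal_eq_sum_fiber (c.outputLaw ch w) (measurable_outputPrefix n)
    {ω | outputPrefix n ω ∈ A ∧ c.encoder n w (outputPrefix n ω) = x}, Finset.sum_mul]
  rw [measureReal_eq_sum_fiber _ (measurable_outputPrefix n), Finset.sum_comm]
  refine Finset.sum_congr rfl fun u _ => ?_
  by_cases hu : u ∈ A
  · rw [Finset.sum_eq_single (c.encoder n w u)]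
    · have h1 : {ω | outputPrefix n ω ∈ A ∧ ω n j = b} ∩ {ω | outputPrefix n ω = u} =
          {ω : ℕ → ∀ j, Y j | outputPrefix n ω = u ∧ ω n j = b} := by
        ext ω
        constructor
        · rintro ⟨⟨-, h1⟩, h2⟩; exact ⟨h2, h1⟩
        · rintro ⟨h1, h2⟩; exact ⟨⟨by rwa [h1], h2⟩, h1⟩
      have h2 : {ω | outputPrefix n ω ∈ A ∧ c.encoder n w (outputPrefix n ω) = c.encoder n w u} ∩
          {ω | outputPrefix n ω = u} = {ω : ℕ → ∀ j, Y j | outputPrefix n ω = u} := by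
        ext ω
        constructor
        · rintro ⟨-, h2⟩; exact h2
        · rintro h1
          exact ⟨⟨by rwa [show outputPrefix n ω = u from h1],
            by rw [show outputPrefix n ω = u from h1]⟩, h1⟩
      rw [h1, h2, measureReal_def, c.outputLaw_prefix_succ_marginal, ENNReal.toReal_mul]
      rfl
    · intro x _ hx
      convert zero_mul _
      convert measureReal_empty
      ext ω
      simp only [Set.mem_inter_iff, Set.mem_ofPred_eq, Set.mem_empty_iff_false, iff_false]
      rintro ⟨⟨-, h1⟩, h2⟩
      exact hx (by rw [← h1, h2])
    · simp
  · have h0 : ∀ T : Set (ℕ → ∀ j, Y j), T ⊆ {ω | outputPrefix n ω ∈ A} →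
        (c.outputLaw ch w).real (T ∩ {ω | outputPrefix n ω = u}) = 0 := by
      intro T hT
      convert measureReal_empty
      ext ω
      simp only [Set.mem_inter_iff, Set.mem_ofPred_eq, Set.mem_empty_iff_false, iff_false]
      rintro ⟨h1, h2⟩
      exact hu (h2 ▸ hT h1)
    rw [h0 _ fun ω hω => hω.1, Finset.sum_eq_zero fun x _ => by rw [h0 _ fun ω hω => hω.1, zero_mul]]

/-- The joint mass of message `w` and the first `n` outputs `y` of receiver `j`. -/
def mass (j : Fin K) (n : ℕ) (y : Fin n → Y j) (w : Fin M) : ℝ :=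
  (M : ℝ)⁻¹ * (c.outputLaw ch w).real {ω | received j n (w, ω) = y}

theorem sum_mass_sub (j : Fin K) (n : ℕ) (y : Fin n → Y j) (w₀ : Fin M) :
    ∑ w, c.mass ch j n y w - c.mass ch j n y w₀ =
      (c.law ch).real {ω | received j n ω = y ∧ ω.1 ≠ w₀} := by
  classical
  rw [law_real_apply, ← Finset.add_sum_erase _ _ (Finset.mem_univ w₀), add_sub_cancel_left,
    ← Finset.add_sum_erase _ _ (Finset.mem_univ w₀)]
  have h0 : Prod.mk w₀ ⁻¹' {ω : Sample M Y | received j n ω = y ∧ ω.1 ≠ w₀} = ∅ := by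
    ext ω; simp
  rw [h0, measureReal_empty, zero_add, Finset.mul_sum]
  refine Finset.sum_congr rfl fun w hw => ?_
  unfold mass
  congr 2
  ext ω
  simp [Finset.ne_of_mem_erase hw]

theorem sum_mass (j : Fin K) (n : ℕ) (y : Fin n → Y j) :
    ∑ w, c.mass ch j n y w = (c.law ch).real {ω | received j n ω = y} := by
  rw [law_real_apply, Finset.mul_sum]
  rfl

/-- The event that receiver `j` has not stopped by time `H`, or errs. -/
def failure (j : Fin K) (H : ℕ) : Set (Sample M Y) :=
  {ω | (H : ℕ∞) < c.stopTime j ω ∨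
    ∃ n : ℕ, c.stopTime j ω = n ∧ c.decoder j n (received j n ω) ≠ ω.1}

/-- A node is a prefix `y` of receiver `j` before whose end it has not stopped, and `k` is the
remaining horizon. The tree follows the stopping rule and is cut at the horizon, where not having
stopped counts as failure. The expected length is the sum of the tail probabilities of the stopping
time. -/
theorem attains_of_node [Fintype X] (hM : M ≠ 0) (j : Fin K) (k : ℕ) : ∀ (n : ℕ) (y : Fin n → Y j),
    (∀ ω : Sample M Y, received j n ω = y → (n : ℕ∞) ≤ c.stopTime j ω) →
    ∃ len err : ℝ, Attains (ch.matrix j) (c.mass ch j n y) len err ∧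
      len ≤ ∑ i ∈ Finset.range k,
        (c.law ch).real ({ω | ((n + i : ℕ) : ℕ∞) < c.stopTime j ω} ∩ {ω | received j n ω = y}) ∧
      err ≤ (c.law ch).real (c.failure j (n + k) ∩ {ω | received j n ω = y}) := by
  have := c.isProbabilityMeasure_law ch hM
  induction k with
  | zero =>
    intro n y hy
    refine ⟨_, _, Attains.halt _ (c.decoder j n y), by simp, ?_⟩
    rw [sum_mass_sub]
    refine measureReal_mono ?_
    rintro ω ⟨h1, h2⟩
    refine ⟨?_, h1⟩
    rcases (hy ω h1).eq_or_lt with h3 | h3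
    · exact Or.inr ⟨n, h3.symm, by rw [h1]; exact h2.symm⟩
    · exact Or.inl h3
  | succ k ih =>
    intro n y hy
    -- By the stopping time property, stopping by time `n` depends on `y` only, so one sample point
    -- decides for the whole node.
    by_cases hs : ∃ ω : Sample M Y, received j n ω = y ∧ c.stopTime j ω ≤ n
    · obtain ⟨ω₀, h1, h2⟩ := hs
      refine ⟨_, _, Attains.halt _ (c.decoder j n y),
        Finset.sum_nonneg fun _ _ => measureReal_nonneg, ?_⟩
      rw [sum_mass_sub]
      refine measureReal_mono ?_
      rintro ω ⟨h3, h4⟩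
      have h5 := (c.stopTime_le_iff (h1.trans h3.symm)).1 h2
      exact ⟨Or.inr ⟨n, le_antisymm h5 (hy ω h3), by rw [h3]; exact h4.symm⟩, h3⟩
    push Not at hs
    have hch : ∀ b : Y j, ∃ len err : ℝ,
        Attains (ch.matrix j) (c.mass ch j (n + 1) (Fin.snoc y b : Fin (n + 1) → Y j)) len err ∧
        len ≤ ∑ i ∈ Finset.range k, (c.law ch).real
          ({ω | ((n + 1 + i : ℕ) : ℕ∞) < c.stopTime j ω} ∩
            {ω | received j (n + 1) ω = (Fin.snoc y b : Fin (n + 1) → Y j)}) ∧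
        err ≤ (c.law ch).real (c.failure j (n + 1 + k) ∩
          {ω | received j (n + 1) ω = (Fin.snoc y b : Fin (n + 1) → Y j)}) := by
      intro b
      refine ih (n + 1) _ fun ω hω => ?_
      have := hs ω ((received_snoc_iff j n y b ω).1 hω).1
      exact Order.add_one_le_of_lt this
    choose len err hA hlen herr using hch
    have hmass : ∀ b : Y j, c.mass ch j (n + 1) (Fin.snoc y b : Fin (n + 1) → Y j) = fun w =>
        push (ch.matrix j) (fun x => (M : ℝ)⁻¹ * (c.outputLaw ch w).real
          {ω | outputPrefix n ω ∈ {u | (fun i => u i j) = y} ∧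
            c.encoder n w (outputPrefix n ω) = x}) b := by
      intro b
      funext w
      have h1 := c.outputLaw_step ch w n {u | (fun i => u i j) = y} j b
      have h2 : {ω | received j (n + 1) (w, ω) = (Fin.snoc y b : Fin (n + 1) → Y j)} =
          {ω | outputPrefix n ω ∈ {u | (fun i => u i j) = y} ∧ ω n j = b} := by
        ext ω
        exact received_snoc_iff j n y b (w, ω)
      unfold mass
      rw [h2, h1]
      simp only [push, Finset.mul_sum, mul_assoc]
    have hmass0 : c.mass ch j n y = fun w => ∑ x, (M : ℝ)⁻¹ * (c.outputLaw ch w).real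
          {ω | outputPrefix n ω ∈ {u | (fun i => u i j) = y} ∧
            c.encoder n w (outputPrefix n ω) = x} := by
      funext w
      rw [← Finset.mul_sum]
      unfold mass
      congr 1
      let _ : MeasurableSpace X := ⊤
      have : MeasurableSingletonClass X := ⟨fun _ => trivial⟩
      have hm : Measurable fun ω : ℕ → ∀ j, Y j => c.encoder n w (outputPrefix n ω) :=
        Measurable.of_discrete.comp (measurable_outputPrefix n)
      rw [measureReal_eq_sum_fiber (c.outputLaw ch w) hm]
      rfl
    have hfib : ∀ S : Set (Sample M Y), (c.law ch).real (S ∩ {ω | received j n ω = y}) =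
        ∑ b, (c.law ch).real
          (S ∩ {ω | received j (n + 1) ω = (Fin.snoc y b : Fin (n + 1) → Y j)}) := by
      intro S
      have hm : Measurable fun ω : Sample M Y => ω.2 n j :=
        (measurable_pi_apply j).comp ((measurable_pi_apply n).comp measurable_snd)
      rw [measureReal_eq_sum_fiber (c.law ch) hm]
      refine Finset.sum_congr rfl fun b _ => ?_
      congr 1
      ext ω
      simp only [Set.mem_inter_iff, Set.mem_ofPred_eq, received_snoc_iff, and_assoc]
    have hgo := Attains.go (p := ch.matrix j) (fun w x => (M : ℝ)⁻¹ * (c.outputLaw ch w).real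
          {ω | outputPrefix n ω ∈ {u | (fun i => u i j) = y} ∧
            c.encoder n w (outputPrefix n ω) = x})
      (fun w x => mul_nonneg (by positivity) measureReal_nonneg) len err
      (fun b => by rw [← hmass b]; exact hA b)
    rw [← hmass0] at hgo
    refine ⟨_, _, hgo, ?_, ?_⟩
    · rw [Finset.sum_range_succ']
      have e2 : {ω : Sample M Y | ((n + 0 : ℕ) : ℕ∞) < c.stopTime j ω} ∩
          {ω | received j n ω = y} = {ω | received j n ω = y} :=
        Set.inter_eq_right.2 fun ω hω => hs ω hω
      rw [e2, sum_mass, add_comm]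
      refine add_le_add_left ?_ _
      refine (Finset.sum_le_sum fun b _ => hlen b).trans (le_of_eq ?_)
      rw [Finset.sum_comm]
      refine Finset.sum_congr rfl fun i _ => ?_
      rw [hfib, show n + (i + 1) = n + 1 + i by ring]
    · rw [hfib, show n + (k + 1) = n + 1 + k by ring]
      exact Finset.sum_le_sum fun b _ => herr b

end VLFTCode

end Law

/-! ### Relative entropy on finite alphabets as a sum. -/

section KullbackLeibler

variable {α : Type*} [Fintype α] [MeasurableSpace α] [MeasurableSingletonClass α]

theorem absolutelyContinuous_of_singleton {μ ν : Measure α} (h : ∀ a, ν {a} = 0 → μ {a} = 0) :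
    μ ≪ ν := by
  intro s hs
  have h1 : μ s = ∑ a, μ (s ∩ {ω | ω = a}) := measure_eq_sum_fiber μ measurable_id s
  rw [h1]
  refine Finset.sum_eq_zero fun a _ => ?_
  by_cases ha : a ∈ s
  · exact measure_mono_null Set.inter_subset_right
      (h a (measure_mono_null (Set.singleton_subset_iff.2 ha) hs))
  · rw [show s ∩ {ω | ω = a} = ∅ by ext x; simp; rintro h rfl; exact ha h, measure_empty]

theorem klDiv_ne_top_of_ac {μ ν : Measure α} [IsFiniteMeasure μ] (h : μ ≪ ν) :
    InformationTheory.klDiv μ ν ≠ ∞ :=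
  InformationTheory.klDiv_ne_top h Integrable.of_finite

theorem toReal_klDiv_eq_sum {μ ν : Measure α} [IsProbabilityMeasure μ] [IsProbabilityMeasure ν]
    (h : μ ≪ ν) : (InformationTheory.klDiv μ ν).toReal =
      ∑ a, μ.real {a} * Real.log (μ.real {a} / ν.real {a}) := by
  rw [InformationTheory.toReal_klDiv_of_measure_eq h (by simp),
    integral_fintype Integrable.of_finite]
  refine Finset.sum_congr rfl fun a _ => ?_
  rw [smul_eq_mul]
  by_cases ha : ν {a} = 0
  · rw [measureReal_def, h ha]; simp
  · congr 1
    unfold llr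
    have h1 := Measure.setLIntegral_rnDeriv h {a}
    rw [lintegral_singleton] at h1
    have h2 : (μ.rnDeriv ν a).toReal * ν.real {a} = μ.real {a} := by
      rw [measureReal_def, measureReal_def, ← h1, ENNReal.toReal_mul]
    have h3 : ν.real {a} ≠ 0 := by
      rw [measureReal_def, ENNReal.toReal_ne_zero]
      exact ⟨ha, measure_ne_top _ _⟩
    rw [← h2, mul_div_cancel_right₀ _ h3]

end KullbackLeibler

theorem sum_toReal_pmf {α : Type*} [Fintype α] (p : PMF α) : ∑ a, (p a).toReal = 1 := by
  rw [← ENNReal.toReal_sum fun a _ => p.apply_ne_top a, ← tsum_fintype (L := .unconditional _),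
    p.tsum_coe, ENNReal.toReal_one]

/-! ### The constants of a broadcast channel with finite `Bmax`. -/

section Bounds

variable {K : ℕ} {X : Type*} {Y : Fin K → Type*} [∀ j, Fintype (Y j)]

theorem matrix_nonneg (ch : BroadcastChannel X Y) (j : Fin K) (x : X) (b : Y j) :
    0 ≤ ch.matrix j x b := ENNReal.toReal_nonneg

theorem sum_matrix (ch : BroadcastChannel X Y) (j : Fin K) (x : X) : ∑ b, ch.matrix j x b = 1 :=
  sum_toReal_pmf _

theorem matrix_le_one (ch : BroadcastChannel X Y) (j : Fin K) (x : X) (b : Y j) :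
    ch.matrix j x b ≤ 1 := by
  rw [← ch.sum_matrix j x]
  exact Finset.single_le_sum (fun b _ => ch.matrix_nonneg j x b) (Finset.mem_univ b)

variable [∀ j, MeasurableSpace (Y j)] [∀ j, MeasurableSingletonClass (Y j)]

theorem relEntropy_ne_top {ch : BroadcastChannel X Y} (hB : ch.Bmax < ∞) (j : Fin K) (x x' : X) :
    ch.relEntropy j x x' ≠ ∞ :=
  ne_top_of_le_ne_top hB.ne
    ((le_iSup₂ (f := fun x x' => ch.relEntropy j x x') x x').trans (le_iSup ch.Buser j))

theorem Buser_ne_top {ch : BroadcastChannel X Y} (hB : ch.Bmax < ∞) (j : Fin K) :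
    ch.Buser j ≠ ∞ :=
  ne_top_of_le_ne_top hB.ne (le_iSup ch.Buser j)

theorem toMeasure_real_singleton {α : Type*} [MeasurableSpace α] [MeasurableSingletonClass α]
    (p : PMF α) (a : α) : p.toMeasure.real {a} = (p a).toReal := by
  rw [measureReal_def, PMF.toMeasure_apply_singleton _ _ (measurableSet_singleton a)]

theorem matrix_eq_zero {ch : BroadcastChannel X Y} (hB : ch.Bmax < ∞) {j : Fin K} {x x' : X}
    {b : Y j} (h : ch.matrix j x' b = 0) : ch.matrix j x b = 0 := by
  have hac := (InformationTheory.klDiv_ne_top_iff.1 (relEntropy_ne_top hB j x x')).1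
  unfold matrix at h ⊢
  rw [ENNReal.toReal_eq_zero_iff, or_iff_left (PMF.apply_ne_top _ _)] at h ⊢
  rw [← PMF.toMeasure_apply_singleton _ _ (measurableSet_singleton b)] at h ⊢
  exact hac h

theorem toReal_relEntropy {ch : BroadcastChannel X Y} (hB : ch.Bmax < ∞) (j : Fin K) (x x' : X) :
    (ch.relEntropy j x x').toReal =
      ∑ b, ch.matrix j x b * Real.log (ch.matrix j x b / ch.matrix j x' b) := by
  have hac := (InformationTheory.klDiv_ne_top_iff.1 (relEntropy_ne_top hB j x x')).1
  unfold relEntropy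
  rw [toReal_klDiv_eq_sum hac]
  simp only [toMeasure_real_singleton]
  rfl

variable [Fintype X] [MeasurableSpace X] [MeasurableSingletonClass X]

theorem mutualInfo_ne_top_and_toReal (ch : BroadcastChannel X Y) (p : PMF X) (j : Fin K) :
    ch.mutualInfo p j ≠ ∞ ∧ (ch.mutualInfo p j).toReal =
      ∑ x, ∑ b, (p x).toReal * ch.matrix j x b *
        Real.log (ch.matrix j x b / ∑ x', (p x').toReal * ch.matrix j x' b) := by
  classical
  have h1 : ∀ x b, (p.bind fun x => (ch.marginal j x).map (Prod.mk x)).toMeasure {(x, b)} =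
      p x * ch.marginal j x b := by
    intro x b
    rw [PMF.toMeasure_apply_singleton _ _ (measurableSet_singleton _), PMF.bind_apply, tsum_fintype,
      Finset.sum_eq_single x]
    · rw [PMF.map_apply, tsum_fintype, Finset.sum_eq_single b]
      · simp
      · intro b' _ hb'; simp [hb'.symm]
      · simp
    · intro x' _ hx'
      rw [PMF.map_apply, tsum_fintype, Finset.sum_eq_zero, mul_zero]
      intro b' _
      simp [hx'.symm]
    · simp
  have h2 : ∀ x b, (p.toMeasure.prod (p.bind (ch.marginal j)).toMeasure) {(x, b)} =
      p x * ∑ x', p x' * ch.marginal j x' b := by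
    intro x b
    rw [← Set.singleton_prod_singleton, Measure.prod_prod,
      PMF.toMeasure_apply_singleton _ _ (measurableSet_singleton _),
      PMF.toMeasure_apply_singleton _ _ (measurableSet_singleton _), PMF.bind_apply, tsum_fintype]
  have hac : (p.bind fun x => (ch.marginal j x).map (Prod.mk x)).toMeasure ≪
      p.toMeasure.prod (p.bind (ch.marginal j)).toMeasure := by
    refine absolutelyContinuous_of_singleton ?_
    rintro ⟨x, b⟩ h
    rw [h2] at h
    rw [h1]
    rcases mul_eq_zero.1 h with h | h
    · rw [h, zero_mul]
    · exact Finset.sum_eq_zero_iff.1 h x (Finset.mem_univ x)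
  refine ⟨klDiv_ne_top_of_ac hac, ?_⟩
  unfold mutualInfo
  rw [toReal_klDiv_eq_sum hac, Fintype.sum_prod_type]
  refine Finset.sum_congr rfl fun x _ => Finset.sum_congr rfl fun b _ => ?_
  rw [measureReal_def, measureReal_def, h1, h2, ENNReal.toReal_mul, ENNReal.toReal_mul,
    ENNReal.toReal_sum fun x' _ => ENNReal.mul_ne_top (p.apply_ne_top _) (PMF.apply_ne_top _ _)]
  simp_rw [ENNReal.toReal_mul]
  unfold matrix
  by_cases h0 : (p x).toReal = 0
  · simp [h0]
  · rw [mul_div_mul_left _ _ h0]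

/-- Mutual information averages the divergence of each output law from their mixture, and by
convexity each of these is at most an average of pairwise divergences. This yields `B > 0` whenever
`C > 0`. -/
theorem mutualInfo_le_Buser {ch : BroadcastChannel X Y} (hB : ch.Bmax < ∞) (p : PMF X)
    (j : Fin K) : ch.mutualInfo p j ≤ ch.Buser j := by
  obtain ⟨h1, h2⟩ := ch.mutualInfo_ne_top_and_toReal p j
  rw [← ENNReal.toReal_le_toReal h1 (Buser_ne_top hB j), h2]
  have hp := sum_toReal_pmf p
  have key : ∀ x b, ch.matrix j x b *
      Real.log (ch.matrix j x b / ∑ x', (p x').toReal * ch.matrix j x' b) ≤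
      ∑ x', (p x').toReal * (ch.matrix j x b * Real.log (ch.matrix j x b / ch.matrix j x' b)) := by
    intro x b
    have := log_sum_le Finset.univ (fun x' => (p x').toReal * ch.matrix j x b)
      (fun x' => (p x').toReal * ch.matrix j x' b)
      (fun _ _ => mul_nonneg ENNReal.toReal_nonneg (ch.matrix_nonneg _ _ _))
      (fun _ _ => mul_nonneg ENNReal.toReal_nonneg (ch.matrix_nonneg _ _ _))
      (fun x' _ h => by
        rcases mul_eq_zero.1 h with h | h
        · rw [h, zero_mul]
        · rw [matrix_eq_zero hB h, mul_zero])
    rw [← Finset.sum_mul, hp, one_mul] at this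
    refine this.trans (le_of_eq (Finset.sum_congr rfl fun x' _ => ?_))
    by_cases h0 : (p x').toReal = 0
    · simp [h0]
    · rw [mul_div_mul_left _ _ h0, mul_assoc]
  have hD : ∀ x x', ∑ b, ch.matrix j x b * Real.log (ch.matrix j x b / ch.matrix j x' b) ≤
      (ch.Buser j).toReal := by
    intro x x'
    rw [← toReal_relEntropy hB]
    exact ENNReal.toReal_mono (Buser_ne_top hB j)
      (le_iSup₂ (f := fun x x' => ch.relEntropy j x x') x x')
  have hx : ∀ x, ∑ b, ch.matrix j x b *
      Real.log (ch.matrix j x b / ∑ x', (p x').toReal * ch.matrix j x' b) ≤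
      (ch.Buser j).toReal := by
    intro x
    refine (Finset.sum_le_sum fun b _ => key x b).trans ?_
    rw [Finset.sum_comm]
    simp_rw [← Finset.mul_sum]
    refine (Finset.sum_le_sum fun x' _ =>
      mul_le_mul_of_nonneg_left (hD x x') ENNReal.toReal_nonneg).trans ?_
    rw [← Finset.sum_mul, hp, one_mul]
  simp_rw [mul_assoc, ← Finset.mul_sum]
  refine (Finset.sum_le_sum fun x _ =>
    mul_le_mul_of_nonneg_left (hx x) ENNReal.toReal_nonneg).trans ?_
  rw [← Finset.sum_mul, hp, one_mul]

theorem capacity_le_Buser {ch : BroadcastChannel X Y} (hB : ch.Bmax < ∞) (j : Fin K) :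
    ch.capacity j ≤ ch.Buser j := iSup_le fun p => mutualInfo_le_Buser hB p j

theorem capacity_ne_top {ch : BroadcastChannel X Y} (hB : ch.Bmax < ∞) (j : Fin K) :
    ch.capacity j ≠ ∞ := ne_top_of_le_ne_top (Buser_ne_top hB j) (capacity_le_Buser hB j)

theorem exists_channelBounds [Nonempty X] {ch : BroadcastChannel X Y} (hB : ch.Bmax < ∞)
    (j : Fin K) (hC : 0 < ch.capacity j) :
    ∃ l, ChannelBounds (ch.matrix j) (ch.Buser j).toReal (ch.capacity j).toReal l := by
  classical
  have hYne : Nonempty (Y j) := by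
    by_contra h
    rw [not_nonempty_iff] at h
    have := ch.sum_matrix j (Classical.arbitrary X)
    simp at this
  -- The constant `l` is the least positive transition probability, zeros being replaced by `1`. It
  -- bounds likelihood ratios because finite relative entropies force all inputs to have the same
  -- output support.
  obtain ⟨i₀, hi₀⟩ := Finite.exists_min fun z : X × Y j =>
    if ch.matrix j z.1 z.2 = 0 then 1 else ch.matrix j z.1 z.2
  set l := if ch.matrix j i₀.1 i₀.2 = 0 then 1 else ch.matrix j i₀.1 i₀.2 with hl
  have hl0 : 0 < l := by
    rw [hl]
    split_ifs with h
    · exact one_pos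
    · exact (ch.matrix_nonneg _ _ _).lt_of_ne (Ne.symm h)
  have hCpos : 0 < (ch.capacity j).toReal := ENNReal.toReal_pos hC.ne' (capacity_ne_top hB j)
  refine ⟨l, ⟨ch.matrix_nonneg j, ch.sum_matrix j, ?_, hCpos, hl0, ?_, ?_, ?_⟩⟩
  · exact hCpos.trans_le (ENNReal.toReal_mono (Buser_ne_top hB j) (capacity_le_Buser hB j))
  · intro x x' b
    by_cases h : ch.matrix j x' b = 0
    · rw [h, matrix_eq_zero hB h, mul_zero]
    · have := hi₀ (x', b)
      simp only [h, if_false] at this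
      have h1 := ch.matrix_le_one j x b
      have h2 := ch.matrix_nonneg j x b
      calc l * ch.matrix j x b ≤ l * 1 := mul_le_mul_of_nonneg_left h1 hl0.le
        _ ≤ ch.matrix j x' b := by rw [mul_one]; exact this
  · intro x x'
    rw [← toReal_relEntropy hB]
    exact ENNReal.toReal_mono (Buser_ne_top hB j)
      (le_iSup₂ (f := fun x x' => ch.relEntropy j x x') x x')
  · intro q hq
    rcases (Finset.sum_nonneg fun x (_ : x ∈ Finset.univ) => hq x).eq_or_lt with h0 | hpos
    · have hz : ∀ x, q x = 0 := fun x =>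
        (Finset.sum_eq_zero_iff_of_nonneg fun x _ => hq x).1 h0.symm x (Finset.mem_univ x)
      simp [hz]
    set Q := ∑ x, q x with hQ
    have hsum : ∑ x, ENNReal.ofReal (q x / Q) = 1 := by
      rw [← ENNReal.ofReal_sum_of_nonneg fun x _ => div_nonneg (hq x) hpos.le, ← Finset.sum_div,
        ← hQ, div_self hpos.ne', ENNReal.ofReal_one]
    set p : PMF X := PMF.ofFintype _ hsum with hp
    have hpx : ∀ x, (p x).toReal = q x / Q := fun x => by
      rw [hp, PMF.ofFintype_apply, ENNReal.toReal_ofReal (div_nonneg (hq x) hpos.le)]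
    have h1 : (ch.mutualInfo p j).toReal ≤ (ch.capacity j).toReal :=
      ENNReal.toReal_mono (capacity_ne_top hB j) (le_iSup (fun p => ch.mutualInfo p j) p)
    rw [(ch.mutualInfo_ne_top_and_toReal p j).2] at h1
    refine le_trans (le_of_eq ?_) (mul_le_mul_of_nonneg_left h1 hpos.le)
    rw [Finset.mul_sum]
    refine Finset.sum_congr rfl fun x _ => ?_
    rw [Finset.mul_sum]
    refine Finset.sum_congr rfl fun b _ => ?_
    simp_rw [hpx]
    have e : ∑ x', q x' / Q * ch.matrix j x' b = (∑ x', q x' * ch.matrix j x' b) / Q := by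
      rw [Finset.sum_div]
      exact Finset.sum_congr rfl fun x' _ => by ring
    rw [e, div_div_eq_mul_div, mul_comm (ch.matrix j x b) Q]
    field_simp

end Bounds

theorem le_neg_log_div_iff {P : ℝ≥0∞} {e N : ℝ} (hN : 0 < N) :
    (e : EReal) ≤ -ENNReal.log P / (N : EReal) ↔ P ≤ ENNReal.ofReal (Real.exp (-(e * N))) := by
  rw [EReal.le_div_iff_mul_le (by exact_mod_cast hN) (EReal.coe_ne_top N), EReal.le_neg,
    ← ENNReal.log_le_log_iff, ENNReal.log_ofReal_of_pos (Real.exp_pos _), Real.log_exp]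
  simp

/-! ### The converse for codes and for the exponent. -/

section Converse

variable {K : ℕ} {X : Type*} [Fintype X] {Y : Fin K → Type*} [∀ j, Fintype (Y j)]
  [∀ j, MeasurableSpace (Y j)] [∀ j, MeasurableSingletonClass (Y j)] {M : ℕ}

namespace VLFTCode

theorem failure_subset (c : VLFTCode M X Y) (j : Fin K) (H : ℕ) :
    c.failure j H ⊆ {ω | (H : ℕ∞) < c.stopTime j ω} ∪ c.errorEvent := by
  rintro ω (h | ⟨n, h1, h2⟩)
  · exact Or.inl h
  · refine Or.inr ⟨j, ?_⟩
    rintro ⟨m, h3, h4⟩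
    have : n = m := by exact_mod_cast h1.symm.trans h3
    exact h2 (this ▸ h4)

theorem sum_real_lt_stopTime_le (c : VLFTCode M X Y) (ch : BroadcastChannel X Y) (hM : M ≠ 0)
    (j : Fin K) (k : ℕ) {N : ℝ} (hN : 0 ≤ N) (hlen : c.expectedLength ch ≤ ENNReal.ofReal N) :
    ∑ i ∈ Finset.range k, (c.law ch).real {ω | (i : ℕ∞) < c.stopTime j ω} ≤ N := by
  have := c.isProbabilityMeasure_law ch hM
  have hms : ∀ i : ℕ, MeasurableSet {ω | (i : ℕ∞) < c.stopTime j ω} := by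
    intro i
    have := (c.measurableSet_stopTime_le j i).compl
    convert this using 1
    ext ω; simp
  have h1 : ∑ i ∈ Finset.range k, c.law ch {ω | (i : ℕ∞) < c.stopTime j ω} ≤
      c.expectedLength ch := by
    simp_rw [← lintegral_indicator_one (hms _)]
    rw [← lintegral_finsetSum _ fun i _ => measurable_one.indicator (hms i)]
    refine lintegral_mono fun ω => ?_
    have h2 : c.stopTime j ω ≤ c.tau ω := le_iSup (fun j => c.stopTime j ω) j
    have h3 : (∑ i ∈ Finset.range k, {ω | (i : ℕ∞) < c.stopTime j ω}.indicator 1 ω : ℝ≥0∞) ≤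
        (c.stopTime j ω : ℝ≥0∞) := by
      induction hs : c.stopTime j ω using ENat.recTopCoe with
      | top => simp
      | coe m =>
        simp only [Set.indicator_apply, Set.mem_ofPred_eq, hs, Nat.cast_lt, Pi.one_apply]
        rw [← Finset.sum_filter, Finset.sum_const, nsmul_eq_mul, mul_one]
        have : (Finset.filter (fun i => i < m) (Finset.range k)).card ≤ m := by
          refine (Finset.card_le_card (t := Finset.range m) ?_).trans (Finset.card_range m).le
          intro i hi
          exact Finset.mem_range.2 (Finset.mem_filter.1 hi).2
        exact_mod_cast this
    exact h3.trans (by exact_mod_cast h2)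
  have h4 : (∑ i ∈ Finset.range k, c.law ch {ω | (i : ℕ∞) < c.stopTime j ω}).toReal ≤ N :=
    ENNReal.toReal_le_of_le_ofReal hN (h1.trans hlen)
  rwa [ENNReal.toReal_sum fun i _ => measure_ne_top _ _] at h4

/-- Truncation at time `k` adds to the error the probability of running longer. It is at most `N /
k` by Markov's inequality: each of the first `k` tail probabilities is at least this one, and
together they are at most `N`. -/
theorem exists_attains (c : VLFTCode M X Y) (ch : BroadcastChannel X Y) (hM : M ≠ 0) (j : Fin K)
    {N : ℝ} (hN : 0 ≤ N) (hlen : c.expectedLength ch ≤ ENNReal.ofReal N) (k : ℕ) (hk : 0 < k) :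
    ∃ len err : ℝ, Attains (ch.matrix j) (fun _ : Fin M => (M : ℝ)⁻¹) len err ∧ len ≤ N ∧
      err ≤ (c.errorProb ch).toReal + N / k := by
  have := c.isProbabilityMeasure_law ch hM
  obtain ⟨len, err, hA, hl, he⟩ := c.attains_of_node ch hM j k 0 Fin.elim0 fun ω _ => by simp
  have hmass : c.mass ch j 0 Fin.elim0 = fun _ : Fin M => (M : ℝ)⁻¹ := by
    funext w
    unfold mass
    have : {ω : ℕ → ∀ j, Y j | received j 0 (w, ω) = Fin.elim0} = Set.univ := by
      ext ω; simp [eq_iff_true_of_subsingleton]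
    rw [this, probReal_univ, mul_one]
  have huniv : {ω : Sample M Y | received j 0 ω = Fin.elim0} = Set.univ := by
    ext ω; simp [eq_iff_true_of_subsingleton]
  simp_rw [huniv, Set.inter_univ, zero_add] at hl he
  rw [hmass] at hA
  have hsum := c.sum_real_lt_stopTime_le ch hM j k hN hlen
  refine ⟨len, err, hA, hl.trans hsum, he.trans ?_⟩
  refine (measureReal_mono (c.failure_subset j k)).trans ((measureReal_union_le _ _).trans ?_)
  rw [add_comm]
  refine add_le_add le_rfl ?_
  rw [le_div_iff₀ (by exact_mod_cast hk), mul_comm]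
  refine le_trans (le_of_eq ?_) ((Finset.sum_le_sum (f := fun _ =>
    (c.law ch).real {ω | (k : ℕ∞) < c.stopTime j ω}) fun i hi => ?_).trans hsum)
  · simp
  · refine measureReal_mono fun ω (hω : (k : ℕ∞) < _) => lt_trans ?_ hω
    exact_mod_cast Finset.mem_range.1 hi

/-- The converse for a single code. -/
theorem converse (c : VLFTCode M X Y) {ch : BroadcastChannel X Y} {j : Fin K} {B C l : ℝ}
    (h : ChannelBounds (ch.matrix j) B C l) (hM : 2 ≤ M) {N : ℝ} (hN : 0 ≤ N)
    (hlen : c.expectedLength ch ≤ ENNReal.ofReal N) {Q a d : ℝ} (hQ : 0 < Q) (hd : 0 < d)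
    (hd2 : d ≤ 1 / 2) (ha : 0 ≤ a) (haC : a * C ≤ 1)
    (hQd : (Real.log (Q * B / 2) - Real.log (1 / (l * d))) / B - a * (2 + d * Real.log M) +
      a * (Real.log M + 1) ≤ Q * d) :
    (Real.log (Q * B / 2) - Real.log (1 / (l * d))) / B - a * (2 + d * Real.log M) +
      a * Real.log M ≤ N + Q * (c.errorProb ch).toReal := by
  have hM0 : (0 : ℝ) < M := by exact_mod_cast (by omega : 0 < M)
  have hM2 : (2 : ℝ) ≤ M := by exact_mod_cast hM
  have hsum1 : ∑ _w : Fin M, (M : ℝ)⁻¹ = 1 := by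
    simp [hM0.ne']
  have hent : massEntropy (fun _ : Fin M => (M : ℝ)⁻¹) = Real.log M := by
    unfold massEntropy
    rw [hsum1]
    simp [hM0.ne']
  have key : ∀ k : ℕ, 0 < k → (Real.log (Q * B / 2) - Real.log (1 / (l * d))) / B -
      a * (2 + d * Real.log M) + a * Real.log M ≤
      N + Q * ((c.errorProb ch).toReal + N / k) := by
    intro k hk
    obtain ⟨len, err, hA, h1, h2⟩ := c.exists_attains ch (by omega) j hN hlen k hk
    have h3 := hA.entropy_le h (M := M) hQ (by simp) (by linarith) hd hd2 ha haC hQd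
      -- The initial state is undecided: `1 / M ≤ 1 / 2 ≤ 1 - d`.
      (fun w => by positivity) (fun w => by
        rw [hsum1, mul_one, inv_le_comm₀ hM0 (by linarith)]
        refine le_trans ?_ hM2
        rw [inv_le_comm₀ (by linarith) (by norm_num)]
        linarith)
    rw [hsum1, hent, one_mul] at h3
    have := mul_le_mul_of_nonneg_left h2 hQ.le
    linarith
  have hlim : Tendsto (fun k : ℕ => N + Q * ((c.errorProb ch).toReal + N / k)) atTop
      (𝓝 (N + Q * ((c.errorProb ch).toReal + 0))) :=
    ((tendsto_const_div_atTop_nhds_zero_nat N).const_add _).const_mul _ |>.const_add _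
  rw [add_zero] at hlim
  exact ge_of_tendsto hlim (eventually_atTop.2 ⟨1, fun k hk => key k hk⟩)

end VLFTCode

theorem Achievable.le {ch : BroadcastChannel X Y} {j : Fin K} {B C l R E : ℝ}
    (h : ChannelBounds (ch.matrix j) B C l) (hRC : R < C) (hA : ch.Achievable R E) :
    E ≤ B * (1 - R / C) := by
  obtain ⟨hR, hE, M, c, hMc, hrate, -, hexp⟩ := hA
  have hB := h.B_pos
  have hC := h.C_pos
  by_contra hlt
  push Not at hlt
  have hRC1 : R / C < 1 := (div_lt_one hC).2 hRC
  have hRC0 : 0 ≤ R / C := by positivity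
  have hEpos : 0 < E := lt_of_le_of_lt (mul_nonneg hB.le (by linarith)) hlt
  -- The excess `g` over the claimed bound is divided up: lowering `E` to `E₁` costs at most `g /
  -- 4`, and so does the double factor `1 - t` on the rate. An excess of `g / 2` remains. The other
  -- entries of the minima keep `E₁` positive and `t ≤ 1 / 2`.
  set g := E / B + R / C - 1 with hg
  have hgpos : 0 < g := by
    have : 1 - R / C < E / B := by rw [lt_div_iff₀ hB]; linarith
    linarith
  set t := min (g / 8) (1 / 2) with ht
  have ht0 : 0 < t := by positivity
  have ht2 : t ≤ 1 / 2 := min_le_right _ _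
  have htg : t ≤ g / 8 := min_le_left _ _
  set E₁ := E - min (B * g / 4) (E / 2) with hE₁
  have hE₁pos : 0 < E₁ := by
    have := min_le_right (B * g / 4) (E / 2)
    linarith
  have hE₁lt : E₁ < E := by
    have : 0 < min (B * g / 4) (E / 2) := by positivity
    linarith
  have hE₁B : E / B - g / 4 ≤ E₁ / B := by
    have e : E₁ / B = E / B - min (B * g / 4) (E / 2) / B := sub_div _ _ _
    rw [e]
    have : min (B * g / 4) (E / 2) / B ≤ g / 4 := by
      rw [div_le_iff₀ hB]
      refine (min_le_left _ _).trans (le_of_eq (by ring))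
    linarith
  set R₁ := (1 - t) * R with hR₁
  have hR₁0 : 0 ≤ R₁ := mul_nonneg (by linarith) hR
  have hR₁C : R / C - g / 4 ≤ (1 - t) * (R₁ / C) := by
    have e : (1 - t) * (R₁ / C) = R / C - 2 * (t * (R / C)) + t * t * (R / C) := by
        rw [hR₁]; ring
    have e1 : 0 ≤ t * (1 - R / C) := mul_nonneg ht0.le (by linarith)
    have e2 : 0 ≤ t * t * (R / C) := by positivity
    rw [e]
    linarith
  have hexp₁ : ∀ᶠ N : ℝ in atTop,
      (E₁ : EReal) < -ENNReal.log ((c N).errorProb ch) / (N : EReal) :=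
    eventually_lt_of_lt_liminf (lt_of_lt_of_le (by exact_mod_cast hE₁lt) hexp)
  have hrate₁ : ∀ᶠ N : ℝ in atTop, R₁ * N ≤ Real.log (M N) := by
    rcases hR.eq_or_lt with h0 | h0
    · filter_upwards [eventually_gt_atTop 0] with N hN
      rw [hR₁, ← h0, mul_zero, zero_mul]
      exact Real.log_nonneg (by exact_mod_cast (by have := (hMc N hN).1; omega : 1 ≤ M N))
    · have : R₁ < R := by
        have := mul_pos ht0 h0
        have e : R₁ = R - t * R := by rw [hR₁]; ring
        linarith
      filter_upwards [eventually_lt_of_lt_liminf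
        (lt_of_lt_of_le (EReal.coe_lt_coe_iff.2 this) hrate), eventually_gt_atTop 0] with N h1 hN
      rw [EReal.coe_lt_coe_iff, lt_div_iff₀ hN] at h1
      exact h1.le
  set κ := (Real.log (B / 2) - Real.log (1 / (l * t))) / B with hκ
  set s := t * E₁ ^ 2 / 2 with hs
  have hs0 : 0 < s := by positivity
  have hbig : ∀ᶠ N : ℝ in atTop, 1 - κ + 2 / C < g / 2 * N ∧
      (E₁ / B + R₁ / C) + (|κ| + 1 / C) ≤ s * N := by
    refine ((tendsto_id.const_mul_atTop (by positivity : 0 < g / 2)).eventually_gt_atTop _).and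
      ((tendsto_id.const_mul_atTop hs0).eventually_ge_atTop _)
  obtain ⟨N, hexpN, hrateN, ⟨hbig1, hbig2⟩, hN1⟩ :=
    (hexp₁.and (hrate₁.and (hbig.and (eventually_ge_atTop 1)))).exists
  have hN : 0 < N := by linarith
  obtain ⟨hM2, hlen⟩ := hMc N hN
  have hlogM : 0 < Real.log (M N) := Real.log_pos (by exact_mod_cast (by omega : 1 < M N))
  have hPe := (le_neg_log_div_iff hN).1 hexpN.le
  have hPe' : Real.exp (E₁ * N) * ((c N).errorProb ch).toReal ≤ 1 := by
    have := ENNReal.toReal_le_of_le_ofReal (Real.exp_pos _).le hPe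
    calc _ ≤ Real.exp (E₁ * N) * Real.exp (-(E₁ * N)) :=
          mul_le_mul_of_nonneg_left this (Real.exp_pos _).le
      _ = 1 := by rw [← Real.exp_add, add_neg_cancel, Real.exp_zero]
  -- The weight of the entropy is chosen so that `a * log M = R₁ / C * N` exactly. The rate
  -- hypothesis gives `a ≤ 1 / C`, and the condition `hcond` stays harmless even when `log M` grows
  -- much faster than `N`.
  set a := R₁ * N / (C * Real.log (M N)) with hadef
  have ha0 : 0 ≤ a := by positivity
  have haM : a * Real.log (M N) = R₁ / C * N := by rw [hadef]; field_simp
  have haC : a * C ≤ 1 := by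
    have : a * C = R₁ * N / Real.log (M N) := by rw [hadef]; field_simp
    rw [this, div_le_one hlogM]
    exact hrateN
  have haC' : a ≤ 1 / C := by rw [le_div_iff₀ hC]; exact haC
  have hlogQ : (Real.log (Real.exp (E₁ * N) * B / 2) - Real.log (1 / (l * t))) / B =
      E₁ / B * N + κ := by
    rw [mul_div_assoc, Real.log_mul (Real.exp_pos _).ne' (by positivity), Real.log_exp, hκ]
    ring
  have hquad := Real.quadratic_le_exp_of_nonneg (x := E₁ * N) (by positivity)
  have hcond : (Real.log (Real.exp (E₁ * N) * B / 2) - Real.log (1 / (l * t))) / B -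
      a * (2 + t * Real.log (M N)) + a * (Real.log (M N) + 1) ≤ Real.exp (E₁ * N) * t := by
    rw [hlogQ]
    have e1 : 0 ≤ a * (t * Real.log (M N)) := by positivity
    have e2 : s * N ^ 2 ≤ Real.exp (E₁ * N) * t := by
      have : s * N ^ 2 = (E₁ * N) ^ 2 / 2 * t := by rw [hs]; ring
      rw [this]
      refine mul_le_mul_of_nonneg_right ?_ ht0.le
      have : 0 ≤ E₁ * N := by positivity
      linarith
    have e3 : (E₁ / B + R₁ / C) * N + (|κ| + 1 / C) ≤ s * N ^ 2 := by
      have h1 := mul_le_mul_of_nonneg_right hbig2 hN.le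
      have h2 : (|κ| + 1 / C) ≤ (|κ| + 1 / C) * N := le_mul_of_one_le_right (by positivity) hN1
      rw [add_mul] at h1
      rw [sq, ← mul_assoc]
      linarith
    have e4 := le_abs_self κ
    have e5 : (0 : ℝ) ≤ 1 / C := by positivity
    have e6 : a * (2 + t * Real.log (M N)) = 2 * a + a * (t * Real.log (M N)) := by ring
    have e7 : a * (Real.log (M N) + 1) = R₁ / C * N + a := by rw [mul_add, haM, mul_one]
    rw [e6, e7]
    linarith
  have hfin := (c N).converse h hM2 hN.le hlen (Real.exp_pos (E₁ * N)) ht0 ht2 ha0 haC hcond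
  rw [hlogQ] at hfin
  have e6 : a * (2 + t * Real.log (M N)) = 2 * a + t * (R₁ / C * N) := by rw [← haM]; ring
  rw [e6, haM] at hfin
  have e8 : (1 + g / 2) * N ≤ (E₁ / B + (1 - t) * (R₁ / C)) * N :=
    mul_le_mul_of_nonneg_right (by linarith) hN.le
  have e9 : 2 / C = 2 * (1 / C) := by ring
  linarith

end Converse

/-! ### Exponential bounds for sums of i.i.d. variables. -/

section Chernoff

variable {Ω : Type*} [Fintype Ω]

/-- Second-order expansion of the exponential: the tilted sum is at most `1 - s * m + s ^ 2 * G ^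
2`, and `s = m / (2 * G ^ 2)` makes this `1 - s * m / 2`. -/
theorem exists_tilt_lt_one {ρ g : Ω → ℝ} (hρ : ∀ a, 0 ≤ ρ a) (hρ1 : ∑ a, ρ a = 1)
    (hg : 0 < ∑ a, ρ a * g a) : ∃ s, 0 ≤ s ∧ ∑ a, ρ a * Real.exp (-(s * g a)) < 1 := by
  set m := ∑ a, ρ a * g a with hm
  set G := 1 + ∑ a, |g a| with hG
  have hG1 : 1 ≤ G := by
    have : 0 ≤ ∑ a, |g a| := Finset.sum_nonneg fun a _ => abs_nonneg _
    linarith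
  have hgG : ∀ a, |g a| ≤ G := fun a => by
    have := Finset.single_le_sum (f := fun a => |g a|) (fun a _ => abs_nonneg _) (Finset.mem_univ a)
    linarith
  have hmG : m ≤ G := by
    calc m ≤ ∑ a, ρ a * G := Finset.sum_le_sum fun a _ =>
          mul_le_mul_of_nonneg_left ((le_abs_self _).trans (hgG a)) (hρ a)
      _ = G := by rw [← Finset.sum_mul, hρ1, one_mul]
  set s := m / (2 * G ^ 2) with hs
  have hs0 : 0 < s := by positivity
  have hsG : s * G ≤ 1 := by
    have : s * G = m / (2 * G) := by rw [hs]; field_simp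
    rw [this, div_le_one (by positivity)]
    linarith
  refine ⟨s, hs0.le, ?_⟩
  have key : ∀ a, ρ a * Real.exp (-(s * g a)) ≤ ρ a * (1 + s ^ 2 * G ^ 2) - s * (ρ a * g a) := by
    intro a
    have h1 : |(-(s * g a))| ≤ s * G := by
      rw [abs_neg, abs_mul, abs_of_pos hs0]
      exact mul_le_mul_of_nonneg_left (hgG a) hs0.le
    have h2 := (abs_le.1 (Real.abs_exp_sub_one_sub_id_le (h1.trans hsG))).2
    have h3 : (-(s * g a)) ^ 2 ≤ s ^ 2 * G ^ 2 := by
      rw [← mul_pow, ← sq_abs]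
      exact pow_le_pow_left₀ (abs_nonneg _) h1 2
    have h4 : Real.exp (-(s * g a)) ≤ 1 + s ^ 2 * G ^ 2 - s * g a := by linarith
    calc _ ≤ ρ a * (1 + s ^ 2 * G ^ 2 - s * g a) := mul_le_mul_of_nonneg_left h4 (hρ a)
      _ = _ := by ring
  have h5 := Finset.sum_le_sum fun a (_ : a ∈ Finset.univ) => key a
  rw [Finset.sum_sub_distrib, ← Finset.sum_mul, hρ1, one_mul, ← Finset.mul_sum, ← hm] at h5
  have h6 : s ^ 2 * G ^ 2 = s * m / 2 := by rw [hs]; field_simp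
  have : 0 < s * m := by positivity
  linarith

/-- Chernoff's bound: a lower deviation of an i.i.d. sum has exponentially small probability. -/
theorem exists_chernoff {ρ g : Ω → ℝ} (hρ : ∀ a, 0 ≤ ρ a) (hρ1 : ∑ a, ρ a = 1)
    (hg : 0 < ∑ a, ρ a * g a) : ∃ θ, 0 ≤ θ ∧ θ < 1 ∧ ∀ (n : ℕ) (S : Finset (Fin n → Ω)),
      (∀ ω ∈ S, (∀ i, 0 < ρ (ω i)) → ∑ i, g (ω i) ≤ 0) →
      ∑ ω ∈ S, ∏ i, ρ (ω i) ≤ θ ^ n := by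
  obtain ⟨s, hs0, hs⟩ := exists_tilt_lt_one hρ hρ1 hg
  refine ⟨_, Finset.sum_nonneg fun a _ => mul_nonneg (hρ a) (Real.exp_pos _).le, hs, ?_⟩
  intro n S hS
  have e : (∑ a, ρ a * Real.exp (-(s * g a))) ^ n =
      ∑ ω : Fin n → Ω, ∏ i, (ρ (ω i) * Real.exp (-(s * g (ω i)))) := by
    have h := Fintype.sum_pow (fun a => ρ a * Real.exp (-(s * g a))) n
    exact h
  rw [e]
  have hnn : ∀ ω : Fin n → Ω, 0 ≤ ∏ i, (ρ (ω i) * Real.exp (-(s * g (ω i)))) := fun ω =>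
    Finset.prod_nonneg fun i _ => mul_nonneg (hρ _) (Real.exp_pos _).le
  refine le_trans (Finset.sum_le_sum fun ω hω => ?_)
    (Finset.sum_le_sum_of_subset_of_nonneg (Finset.subset_univ S) fun ω _ _ => hnn ω)
  -- Sequences of probability zero contribute nothing; setting them aside lets later applications
  -- use log-likelihoods only where they are meaningful.
  by_cases hpos : ∀ i, 0 < ρ (ω i)
  · rw [Finset.prod_mul_distrib, ← Real.exp_sum]
    refine le_mul_of_one_le_right (Finset.prod_nonneg fun i _ => hρ _) (Real.one_le_exp ?_)
    rw [Finset.sum_neg_distrib, ← Finset.mul_sum, Left.nonneg_neg_iff]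
    exact mul_nonpos_of_nonneg_of_nonpos hs0 (hS ω hω hpos)
  · push Not at hpos
    obtain ⟨i, hi⟩ := hpos
    rw [Finset.prod_eq_zero (Finset.mem_univ i) (le_antisymm hi (hρ _))]
    exact hnn ω

end Chernoff

/-! ### Feinstein's construction for several receivers. -/

section Feinstein

variable {ι A : Type*} {B : ι → Type*} [Fintype ι] [Fintype A] [∀ j, Fintype (B j)]

open scoped Classical in
/-- Feinstein's maximal code construction, for several receivers. -/
theorem exists_codewords (V : ∀ j, A → B j → ℝ) (hV : ∀ j x b, 0 ≤ V j x b) (Q : A → ℝ)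
    (hQ : ∀ x, 0 ≤ Q x) (hQ1 : ∑ x, Q x = 1) (T : ∀ j, A → Finset (B j)) {ε η : ℝ}
    (hT : ∀ j x, ∑ b ∈ T j x, ∑ x', Q x' * V j x' b ≤ ε)
    (hη : ∀ j, ∑ x, Q x * ∑ b ∈ (T j x)ᶜ, V j x b ≤ η) (m : ℕ) :
    ∃ cw : ℕ → A, ∀ i < m,
      ∑ j, ∑ b with ¬ (b ∈ T j (cw i) ∧ ∀ i' < i, b ∉ T j (cw i')), V j (cw i) b ≤
        Fintype.card ι * (η + i * ε) := by
  induction m with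
  | zero =>
    have : Nonempty A := by
      by_contra h
      rw [not_nonempty_iff] at h
      simp at hQ1
    exact ⟨fun _ => Classical.arbitrary A, by simp⟩
  | succ m ih =>
    obtain ⟨cw, hcw⟩ := ih
    have hx : ∃ x, ∑ j, ∑ b with ¬ (b ∈ T j x ∧ ∀ i' < m, b ∉ T j (cw i')), V j x b ≤
        Fintype.card ι * (η + m * ε) := by
      by_contra hcon
      replace hcon := fun x => not_le.1 fun h => hcon ⟨x, h⟩
      have h1 : ∀ x, ∑ j, ∑ b with ¬ (b ∈ T j x ∧ ∀ i' < m, b ∉ T j (cw i')), V j x b ≤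
          ∑ j, (∑ b ∈ (T j x)ᶜ, V j x b + ∑ i ∈ Finset.range m, ∑ b ∈ T j (cw i), V j x b) := by
        refine fun x => Finset.sum_le_sum fun j _ => ?_
        have e : ∀ S : Finset (B j), ∑ b ∈ S, V j x b = ∑ b, if b ∈ S then V j x b else 0 := by
          intro S; simp
        simp_rw [e ((T j x)ᶜ), fun i => e (T j (cw i))]
        rw [Finset.sum_comm, ← Finset.sum_add_distrib, Finset.sum_filter]
        refine Finset.sum_le_sum fun b _ => ?_
        have h0 : ∀ i ∈ Finset.range m, 0 ≤ if b ∈ T j (cw i) then V j x b else 0 := by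
          intro i _
          split_ifs
          exacts [hV j x b, le_rfl]
        by_cases hb : b ∈ T j x
        · by_cases hb2 : ∃ i' < m, b ∈ T j (cw i')
          · obtain ⟨i', hi', hb2⟩ := hb2
            have := Finset.single_le_sum h0 (Finset.mem_range.2 hi')
            simp only [hb2, if_true] at this
            have h3 : ¬ (b ∈ T j x ∧ ∀ i' < m, b ∉ T j (cw i')) := fun h => h.2 i' hi' hb2
            rw [if_pos h3, if_neg (by simpa using hb), zero_add]
            exact this
          · push Not at hb2
            rw [if_neg (not_not.2 ⟨hb, hb2⟩)]
            exact add_nonneg (by split_ifs; exacts [hV j x b, le_rfl]) (Finset.sum_nonneg h0)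
        · rw [if_pos fun h => hb h.1, if_pos (by simpa using hb)]
          exact le_add_of_nonneg_right (Finset.sum_nonneg h0)
      -- Averaging over a random next codeword of law `Q`: the output then has the mixture law,
      -- which gives each of the `m` earlier decoding sets mass at most `ε`. So not every choice can
      -- be bad.
      have h2 : ∑ x, Q x * (Fintype.card ι * (η + m * ε)) < ∑ x, Q x *
          ∑ j, (∑ b ∈ (T j x)ᶜ, V j x b + ∑ i ∈ Finset.range m, ∑ b ∈ T j (cw i), V j x b) := by
        obtain ⟨x₀, hx₀⟩ : ∃ x, 0 < Q x := by
          by_contra h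
          push Not at h
          have : ∑ x, Q x ≤ 0 := Finset.sum_nonpos fun x _ => h x
          linarith
        exact Finset.sum_lt_sum
          (fun x _ => mul_le_mul_of_nonneg_left ((hcon x).le.trans (h1 x)) (hQ x))
          ⟨x₀, Finset.mem_univ _, mul_lt_mul_of_pos_left ((hcon x₀).trans_le (h1 x₀)) hx₀⟩
      have h3 : ∑ x, Q x *
          ∑ j, (∑ b ∈ (T j x)ᶜ, V j x b + ∑ i ∈ Finset.range m, ∑ b ∈ T j (cw i), V j x b) ≤
          ∑ _j : ι, (η + m * ε) := by
        simp_rw [Finset.mul_sum (s := (Finset.univ : Finset ι))]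
        rw [Finset.sum_comm]
        refine Finset.sum_le_sum fun j _ => ?_
        simp_rw [mul_add, Finset.sum_add_distrib]
        refine add_le_add (hη j) ?_
        simp_rw [Finset.mul_sum (s := Finset.range m)]
        rw [Finset.sum_comm]
        refine (Finset.sum_le_sum (g := fun _ => ε) fun i _ => ?_).trans (by simp)
        simp_rw [Finset.mul_sum]
        rw [Finset.sum_comm]
        exact hT j (cw i)
      rw [← Finset.sum_mul, hQ1, one_mul] at h2
      rw [Finset.sum_const, Finset.card_univ, nsmul_eq_mul] at h3
      exact absurd h2 (not_lt.2 h3)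
    obtain ⟨x, hx⟩ := hx
    refine ⟨Function.update cw m x, fun i hi => ?_⟩
    have hlt : ∀ i' < m, Function.update cw m x i' = cw i' := fun i' h =>
      Function.update_of_ne h.ne _ _
    rcases (Nat.lt_succ_iff_lt_or_eq.1 hi) with h | rfl
    · have e : ∀ j b, (∀ i' < i, b ∉ T j (Function.update cw m x i')) ↔
          ∀ i' < i, b ∉ T j (cw i') := fun j b =>
        forall₂_congr fun i' hi' => by rw [hlt i' (hi'.trans h)]
      simp_rw [hlt i h, e]
      exact hcw i h
    · have e : ∀ j b, (∀ i' < i, b ∉ T j (Function.update cw i x i')) ↔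
          ∀ i' < i, b ∉ T j (cw i') := fun j b =>
        forall₂_congr fun i' hi' => by rw [hlt i' hi']
      simp_rw [Function.update_self, e]
      exact hx

open scoped Classical in
/-- A code for a common message whose maximal error probability is controlled. -/
theorem exists_code (V : ∀ j, A → B j → ℝ) (hV : ∀ j x b, 0 ≤ V j x b) (Q : A → ℝ)
    (hQ : ∀ x, 0 ≤ Q x) (hQ1 : ∑ x, Q x = 1) (T : ∀ j, A → Finset (B j)) {ε η : ℝ} (hε : 0 ≤ ε)
    (hT : ∀ j x, ∑ b ∈ T j x, ∑ x', Q x' * V j x' b ≤ ε)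
    (hη : ∀ j, ∑ x, Q x * ∑ b ∈ (T j x)ᶜ, V j x b ≤ η) (M : ℕ) (hM : 0 < M) :
    ∃ (cw : Fin M → A) (φ : ∀ j, B j → Fin M), ∀ w,
      ∑ j, ∑ b with φ j b ≠ w, V j (cw w) b ≤ Fintype.card ι * (η + M * ε) := by
  obtain ⟨cw, hcw⟩ := exists_codewords V hV Q hQ hQ1 T hT hη M
  -- Decoding picks the first message whose set contains the output; the sets minus the earlier ones
  -- are disjoint, so this message is unique. The default `0` is arbitrary: such outputs already
  -- count as errors.
  refine ⟨fun w => cw w, fun j b =>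
    if h : ∃ w : Fin M, b ∈ T j (cw w) ∧ ∀ i' < (w : ℕ), b ∉ T j (cw i') then h.choose else ⟨0, hM⟩,
    fun w => ?_⟩
  refine le_trans (Finset.sum_le_sum fun j _ => ?_) ((hcw w w.2).trans ?_)
  · refine Finset.sum_le_sum_of_subset_of_nonneg ?_ fun b _ _ => hV j _ b
    intro b hb
    simp only [Finset.mem_filter_univ] at hb ⊢
    intro hw
    refine hb ?_
    have h : ∃ w : Fin M, b ∈ T j (cw w) ∧ ∀ i' < (w : ℕ), b ∉ T j (cw i') := ⟨w, hw⟩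
    rw [dif_pos h]
    obtain ⟨h1, h2⟩ := h.choose_spec
    refine Fin.ext (le_antisymm ?_ ?_)
    · by_contra hlt
      exact h2 w (not_le.1 hlt) hw.1
    · by_contra hlt
      exact hw.2 _ (not_le.1 hlt) h1
  · have : (w : ℝ) ≤ M := by exact_mod_cast w.2.le
    gcongr

end Feinstein

theorem sum_pi_prod {α R : Type*} [CommSemiring R] [Fintype α] {n : ℕ} (f : Fin n → α → R) :
    ∑ v : Fin n → α, ∏ i, f i (v i) = ∏ i, ∑ a, f i a := by
  classical
  rw [Finset.prod_univ_sum, Fintype.piFinset_univ]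

theorem log_prod_div {n : ℕ} {f g : Fin n → ℝ} (hf : ∀ i, 0 < f i) (hg : ∀ i, 0 < g i) :
    ∑ i, Real.log (f i / g i) = Real.log ((∏ i, f i) / ∏ i, g i) := by
  rw [← Finset.prod_div_distrib, Real.log_prod fun i _ => (div_pos (hf i) (hg i)).ne']

/-! ### Typical sets, block codes and Stein tests. -/

section BlockCode

variable {ι X : Type*} [Fintype X] {Y : ι → Type*} [Fintype ι] [Nonempty ι] [∀ j, Fintype (Y j)]

open scoped Classical in
/-- Sets of typical outputs for one receiver. -/
theorem exists_typical {B : Type*} [Fintype B] (p : X → B → ℝ) (hp : ∀ x b, 0 ≤ p x b)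
    (hp1 : ∀ x, ∑ b, p x b = 1) (P : X → ℝ) (hP : ∀ x, 0 ≤ P x) (hP1 : ∑ x, P x = 1) {r : ℝ}
    (hr : r < ∑ x, ∑ b, P x * p x b * Real.log (p x b / ∑ x', P x' * p x' b)) :
    ∃ θ : ℝ, 0 ≤ θ ∧ θ < 1 ∧ ∀ n : ℕ, ∃ T : (Fin n → X) → Finset (Fin n → B),
      (∀ x, ∑ b ∈ T x, ∑ x' : Fin n → X, (∏ i, P (x' i)) * ∏ i, p (x' i) (b i) ≤
        Real.exp (-(n * r))) ∧
      ∑ x : Fin n → X, (∏ i, P (x i)) * ∑ b ∈ (T x)ᶜ, ∏ i, p (x i) (b i) ≤ θ ^ n := by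
  obtain ⟨q, hq⟩ : ∃ q : B → ℝ, ∀ b, q b = ∑ x', P x' * p x' b := ⟨_, fun _ => rfl⟩
  simp_rw [← hq] at hr
  have h1 : ∑ a : X × B, P a.1 * p a.1 a.2 = 1 := by
    rw [Fintype.sum_prod_type]
    simp_rw [← Finset.mul_sum, hp1, mul_one, hP1]
  obtain ⟨θ, hθ0, hθ1, hθ⟩ := exists_chernoff (ρ := fun a : X × B => P a.1 * p a.1 a.2)
    (g := fun a => Real.log (p a.1 a.2 / q a.2) - r)
    (fun a => mul_nonneg (hP _) (hp _ _)) h1 (by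
      simp_rw [mul_sub, Finset.sum_sub_distrib, ← Finset.sum_mul, h1]
      rw [Fintype.sum_prod_type, one_mul, sub_pos]
      exact hr)
  -- Typical outputs are those whose likelihood ratio of channel law to output law is at least `exp
  -- (n * r)`. Change of measure bounds their output mass; Chernoff's bound shows that atypical
  -- pairs are rare.
  refine ⟨θ, hθ0, hθ1, fun n => ⟨fun x => Finset.univ.filter fun b =>
    Real.exp (n * r) * ∏ i, q (b i) ≤ ∏ i, p (x i) (b i), ?_, ?_⟩⟩
  · intro x
    have h1 : ∀ b : Fin n → B,
        ∑ x' : Fin n → X, (∏ i, P (x' i)) * ∏ i, p (x' i) (b i) = ∏ i, q (b i) := by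
      intro b
      simp_rw [← Finset.prod_mul_distrib, hq]
      exact sum_pi_prod fun i x => P x * p x (b i)
    simp_rw [h1]
    refine (Finset.sum_le_sum (g := fun b => Real.exp (-(n * r)) * ∏ i, p (x i) (b i))
      fun b hb => ?_).trans ?_
    · rw [Real.exp_neg, ← div_eq_inv_mul, le_div_iff₀' (Real.exp_pos _)]
      exact (Finset.mem_filter_univ b).1 hb
    rw [← Finset.mul_sum]
    refine mul_le_of_le_one_right (Real.exp_pos _).le ?_
    refine (Finset.sum_le_sum_of_subset_of_nonneg (Finset.subset_univ _)
      fun b _ _ => Finset.prod_nonneg fun i _ => hp _ _).trans ?_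
    rw [sum_pi_prod fun i => p (x i)]
    simp [hp1]
  · refine le_trans (le_of_eq ?_) (hθ n (Finset.univ.filter fun ω =>
      ¬ Real.exp (n * r) * ∏ i, q (ω i).2 ≤ ∏ i, p (ω i).1 (ω i).2) ?_)
    · rw [Finset.sum_filter, ← (Equiv.arrowProdEquivProdArrow (Fin n) (fun _ => X)
        (fun _ => B)).symm.sum_comp, Fintype.sum_prod_type]
      refine Finset.sum_congr rfl fun x _ => ?_
      rw [Finset.mul_sum, Finset.compl_filter, Finset.sum_filter]
      refine Finset.sum_congr rfl fun b _ => ?_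
      rw [← Finset.prod_mul_distrib]
      rfl
    · intro ω hω hpos
      have hω' := not_le.1 ((Finset.mem_filter_univ ω).1 hω)
      have hp' : ∀ i, 0 < p (ω i).1 (ω i).2 := fun i =>
        (hp _ _).lt_of_ne fun h => by have := hpos i; rw [← h, mul_zero] at this; exact this.ne rfl
      have hq' : ∀ i, 0 < q (ω i).2 := fun i => by
        rw [hq]
        exact (hpos i).trans_le (Finset.single_le_sum (f := fun x => P x * p x (ω i).2)
          (fun x _ => mul_nonneg (hP x) (hp _ _)) (Finset.mem_univ (ω i).1))
      rw [Finset.sum_sub_distrib, log_prod_div hp' hq', sub_nonpos]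
      simp only [Finset.sum_const, Finset.card_univ, Fintype.card_fin, nsmul_eq_mul]
      rw [Real.log_le_iff_le_exp (div_pos (Finset.prod_pos fun i _ => hp' i)
        (Finset.prod_pos fun i _ => hq' i)), div_le_iff₀ (Finset.prod_pos fun i _ => hq' i)]
      exact hω'.le

open scoped Classical in
/-- Block codes for a common message at any rate below `min_j I(X;Y_j)`. -/
theorem exists_block_code (p : ∀ j, X → Y j → ℝ) (hp : ∀ j x b, 0 ≤ p j x b)
    (hp1 : ∀ j x, ∑ b, p j x b = 1) (P : X → ℝ) (hP : ∀ x, 0 ≤ P x) (hP1 : ∑ x, P x = 1) {r : ℝ}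
    (hr : ∀ j, r < ∑ x, ∑ b, P x * p j x b * Real.log (p j x b / ∑ x', P x' * p j x' b)) :
    ∃ θ : ℝ, 0 ≤ θ ∧ θ < 1 ∧ ∀ n M : ℕ, 0 < M →
      ∃ (cw : Fin M → Fin n → X) (φ : ∀ j, (Fin n → Y j) → Fin M), ∀ w,
        ∑ j, ∑ b with φ j b ≠ w, ∏ i, p j (cw w i) (b i) ≤
          Fintype.card ι * (θ ^ n + M * Real.exp (-(n * r))) := by
  choose θ hθ0 hθ1 hθ using fun j => exists_typical (p j) (hp j) (hp1 j) P hP hP1 (hr j)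
  obtain ⟨j₀, hj₀⟩ := Finite.exists_max θ
  refine ⟨θ j₀, hθ0 j₀, hθ1 j₀, fun n M hM => ?_⟩
  choose T hT hη using fun j => hθ j n
  have hQ1 : ∑ x : Fin n → X, ∏ i, P (x i) = 1 := by
    rw [sum_pi_prod fun _ => P]
    simp [hP1]
  have hη' : ∀ j, ∑ x : Fin n → X, (∏ i, P (x i)) * ∑ b ∈ (T j x)ᶜ, ∏ i, p j (x i) (b i) ≤
      θ j₀ ^ n := fun j => (hη j).trans (pow_le_pow_left₀ (hθ0 j) (hj₀ j) n)
  exact exists_code (fun j (x : Fin n → X) b => ∏ i, p j (x i) (b i))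
    (fun j x b => Finset.prod_nonneg fun i _ => hp _ _ _) (fun x => ∏ i, P (x i))
    (fun x => Finset.prod_nonneg fun i _ => hP _) hQ1 T (ε := Real.exp (-(n * r)))
    (η := θ j₀ ^ n) (Real.exp_pos _).le (by exact hT) (fun j => by
      convert hη' j) M hM

open scoped Classical in
/-- Stein's lemma, in the direction needed here: tests with vanishing error of the first kind whose
error of the second kind has exponent `γ`. -/
theorem exists_test {B : Type*} [Fintype B] (p₀ p₁ : B → ℝ) (hp₀ : ∀ b, 0 ≤ p₀ b)
    (hp₁ : ∀ b, 0 ≤ p₁ b) (hs₀ : ∑ b, p₀ b = 1) (hs₁ : ∑ b, p₁ b = 1)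
    (hac : ∀ b, p₁ b = 0 → p₀ b = 0) {γ : ℝ}
    (hγ : γ = 0 ∨ γ < ∑ b, p₀ b * Real.log (p₀ b / p₁ b)) :
    ∃ θ : ℝ, 0 ≤ θ ∧ θ < 1 ∧ ∀ n : ℕ, ∃ A : Finset (Fin n → B),
      ∑ b ∈ Aᶜ, ∏ i, p₀ (b i) ≤ θ ^ n ∧ ∑ b ∈ A, ∏ i, p₁ (b i) ≤ Real.exp (-(n * γ)) := by
  rcases hγ with rfl | hγ
  -- Always accepting serves exponent zero, where no positive divergence need be available.
  · refine ⟨0, le_rfl, one_pos, fun n => ⟨Finset.univ, ?_, ?_⟩⟩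
    · simp
    · rw [sum_pi_prod fun _ => p₁]
      simp [hs₁]
  · obtain ⟨θ, hθ0, hθ1, hθ⟩ := exists_chernoff (ρ := p₀)
      (g := fun b => Real.log (p₀ b / p₁ b) - γ) hp₀ hs₀ (by
        simp_rw [mul_sub, Finset.sum_sub_distrib, ← Finset.sum_mul, hs₀]
        linarith)
    refine ⟨θ, hθ0, hθ1, fun n => ⟨Finset.univ.filter fun b =>
      Real.exp (n * γ) * ∏ i, p₁ (b i) ≤ ∏ i, p₀ (b i), ?_, ?_⟩⟩
    · refine hθ n _ fun b hb hpos => ?_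
      rw [Finset.mem_compl, Finset.mem_filter_univ, not_le] at hb
      have hpos' : ∀ i, 0 < p₁ (b i) := fun i =>
        (hp₁ _).lt_of_ne fun h => (hpos i).ne' (hac _ h.symm)
      rw [Finset.sum_sub_distrib, log_prod_div hpos hpos', sub_nonpos]
      simp only [Finset.sum_const, Finset.card_univ, Fintype.card_fin, nsmul_eq_mul]
      rw [Real.log_le_iff_le_exp (div_pos (Finset.prod_pos fun i _ => hpos i)
        (Finset.prod_pos fun i _ => hpos' i)), div_le_iff₀ (Finset.prod_pos fun i _ => hpos' i)]
      exact hb.le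
    · have h2 : ∀ b ∈ Finset.univ.filter fun b : Fin n → B =>
          Real.exp (n * γ) * ∏ i, p₁ (b i) ≤ ∏ i, p₀ (b i),
          ∏ i, p₁ (b i) ≤ Real.exp (-(n * γ)) * ∏ i, p₀ (b i) := by
        intro b hb
        rw [Real.exp_neg, ← div_eq_inv_mul, le_div_iff₀' (Real.exp_pos _)]
        exact (Finset.mem_filter_univ b).1 hb
      refine (Finset.sum_le_sum h2).trans ?_
      rw [← Finset.mul_sum]
      refine mul_le_of_le_one_right (Real.exp_pos _).le ?_
      refine (Finset.sum_le_sum_of_subset_of_nonneg (Finset.subset_univ _)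
        fun b _ _ => Finset.prod_nonneg fun i _ => hp₀ _).trans ?_
      rw [sum_pi_prod fun _ => p₀]
      simp [hs₀]

end BlockCode

/-! ### Repetition of independent rounds. -/

/-- One round, of length `L`, of a repetition scheme: an encoder and, for each receiver, an
acceptance region and a decoder. -/
structure RoundCode {K : ℕ} (M L : ℕ) (X : Type*) (Y : Fin K → Type*) where
  encoder : (i : ℕ) → Fin M → (Fin i → ∀ j, Y j) → X
  accept : ∀ j, Set (Fin L → Y j)
  decoder : ∀ j, (Fin L → Y j) → Fin M

namespace RoundCode

variable {K M L : ℕ} {X : Type*} {Y : Fin K → Type*}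

/-- The outputs of round `k`. -/
def block (L k : ℕ) (ω : ℕ → ∀ j, Y j) : Fin L → ∀ j, Y j := fun i => ω (L * k + i)

/-- The outputs of receiver `j`, extracted from the outputs of all receivers. -/
def userBlock (j : Fin K) (u : Fin L → ∀ j, Y j) : Fin L → Y j := fun i => u i j

theorem block_eq_of_prefix_eq {k n : ℕ} (h : L * (k + 1) ≤ n) {ω ω' : ℕ → ∀ j, Y j}
    (he : outputPrefix n ω = outputPrefix n ω') : block L k ω = block L k ω' := by
  funext i
  have : L * k + i < n := lt_of_lt_of_le (by rw [mul_add_one]; have := i.2; omega) h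
  exact congrFun he ⟨L * k + i, this⟩

/-- Round outputs for which some receiver does not accept. -/
def rejected (r : RoundCode M L X Y) : Set (Fin L → ∀ j, Y j) :=
  {u | ∃ j, userBlock j u ∉ r.accept j}

/-- Round outputs for which some receiver accepts a wrong message. -/
def wronglyAccepted (r : RoundCode M L X Y) (w : Fin M) : Set (Fin L → ∀ j, Y j) :=
  {u | ∃ j, userBlock j u ∈ r.accept j ∧ r.decoder j (userBlock j u) ≠ w}

/-- The probability of the outputs `u` in a round, when message `w` is sent. -/
def prob (r : RoundCode M L X Y) (ch : BroadcastChannel X Y) (w : Fin M)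
    (u : Fin L → ∀ j, Y j) : ℝ≥0∞ :=
  ∏ i : Fin L, ch (r.encoder i w fun t => u ⟨t, t.2.trans i.2⟩) (u i)

/-- The event that no round before round `k` is accepted by all receivers. -/
def pending (r : RoundCode M L X Y) (k : ℕ) : Set (ℕ → ∀ j, Y j) :=
  {ω | ∀ k' < k, block L k' ω ∈ r.rejected}

variable [∀ j, MeasurableSpace (Y j)]

theorem received_eq_iff (j : Fin K) (n : ℕ) (ω ω' : Sample M Y) :
    received j n ω = received j n ω' ↔ ∀ i < n, ω.2 i j = ω'.2 i j :=
  ⟨fun h i hi => congrFun h ⟨i, hi⟩, fun h => funext fun i => h i i.2⟩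

/-- The end of the first round accepted by receiver `j`. -/
def stopTime (r : RoundCode M L X Y) (j : Fin K) (ω : Sample M Y) : ℕ∞ :=
  ⨅ (k : ℕ) (_ : userBlock j (block L k ω.2) ∈ r.accept j), ((L * (k + 1) : ℕ) : ℕ∞)

theorem stopTime_le_iff (r : RoundCode M L X Y) (j : Fin K) (ω : Sample M Y) (n : ℕ) :
    r.stopTime j ω ≤ n ↔ ∃ k, userBlock j (block L k ω.2) ∈ r.accept j ∧ L * (k + 1) ≤ n := by
  -- An infimum lies strictly below a bound exactly when some member does, hence the passage from `≤
  -- n` to `< n + 1`.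
  rw [← ENat.lt_natCast_add_one_iff, stopTime]
  simp only [iInf_lt_iff]
  refine exists_congr fun k => ?_
  rw [exists_prop]
  refine and_congr_right fun _ => ?_
  rw [ENat.lt_natCast_add_one_iff]
  exact Nat.cast_le

theorem stopTime_eq (r : RoundCode M L X Y) (j : Fin K) (ω : Sample M Y) {k : ℕ}
    (hk : userBlock j (block L k ω.2) ∈ r.accept j)
    (hmin : ∀ k' < k, userBlock j (block L k' ω.2) ∉ r.accept j) :
    r.stopTime j ω = (L * (k + 1) : ℕ) := by
  refine le_antisymm (iInf₂_le k hk) (le_iInf₂ fun k' hk' => ?_)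
  rw [Nat.cast_le]
  exact Nat.mul_le_mul_left _ (Nat.succ_le_succ (not_lt.1 fun h => hmin k' h hk'))

theorem isStoppingTime [∀ j, Finite (Y j)] [∀ j, MeasurableSingletonClass (Y j)]
    (r : RoundCode M L X Y) (j : Fin K) :
    IsStoppingTime (outputFiltration M Y j) (r.stopTime j) := by
  intro n
  refine ⟨received j n '' {ω | r.stopTime j ω ≤ n}, MeasurableSet.of_discrete, ?_⟩
  ext ω
  constructor
  · rintro ⟨ω', h1, h2⟩
    obtain ⟨k, hk, hkn⟩ := (r.stopTime_le_iff j ω' n).1 h1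
    refine (r.stopTime_le_iff j ω n).2 ⟨k, ?_, hkn⟩
    convert hk using 1
    funext i
    refine (((received_eq_iff j n _ _).1 h2) _ ?_).symm
    refine lt_of_lt_of_le ?_ hkn
    rw [mul_add_one]; have := i.2; omega
  · exact fun h => ⟨ω, h, rfl⟩

variable [∀ j, Finite (Y j)] [∀ j, MeasurableSingletonClass (Y j)]

/-- The code which repeats the rounds; each receiver stops when it accepts for the first time. -/
def repeated [NeZero M] (r : RoundCode M L X Y) : VLFTCode M X Y where
  encoder n w past := r.encoder (n % L) w fun t =>
    past ⟨L * (n / L) + t, by have := t.2; have := Nat.div_add_mod n L; omega⟩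
  decoder j n v :=
    -- The estimate uses the last `L` outputs. Finite stopping times are multiples `L * (k + 1)`, so
    -- the default `0` never matters.
    if h : L ≤ n then r.decoder j fun i => v ⟨n - L + i, by have := i.2; omega⟩ else 0
  stopTime := r.stopTime
  stopTime_isStoppingTime := r.isStoppingTime

variable [NeZero M] (r : RoundCode M L X Y)

theorem repeated_encoder (k i : ℕ) (hi : i < L) (w : Fin M) (ω : ℕ → ∀ j, Y j) :
    r.repeated.encoder (L * k + i) w (outputPrefix (L * k + i) ω) =
      r.encoder i w fun t => ω (L * k + t) := by
  have h1 : (L * k + i) / L = k := by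
    rw [Nat.mul_add_div (by omega), Nat.div_eq_of_lt hi, add_zero]
  have h2 : (L * k + i) % L = i := by rw [Nat.mul_add_mod, Nat.mod_eq_of_lt hi]
  have h3 : r.repeated.encoder (L * k + i) w (outputPrefix (L * k + i) ω) =
      (fun a b => r.encoder b w fun t : Fin b => ω (L * a + t)) ((L * k + i) / L)
        ((L * k + i) % L) := rfl
  rw [h3, h1, h2]

theorem repeated_decoder (j : Fin K) (k : ℕ) (ω : Sample M Y) :
    r.repeated.decoder j (L * (k + 1)) (received j (L * (k + 1)) ω) =
      r.decoder j (userBlock j (block L k ω.2)) := by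
  have h : L ≤ L * (k + 1) := Nat.le_mul_of_pos_right L (Nat.succ_pos k)
  refine (dif_pos h).trans ?_
  congr 1
  funext i
  change ω.2 (L * (k + 1) - L + i) j = ω.2 (L * k + i) j
  rw [mul_add_one, Nat.add_sub_cancel]

variable (ch : BroadcastChannel X Y)

theorem outputLaw_prefix_add (w : Fin M) (ω₀ : ℕ → ∀ j, Y j) (k : ℕ) (i : ℕ) (hi : i ≤ L) :
    r.repeated.outputLaw ch w {ω | outputPrefix (L * k + i) ω = outputPrefix (L * k + i) ω₀} =
      r.repeated.outputLaw ch w {ω | outputPrefix (L * k) ω = outputPrefix (L * k) ω₀} *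
        ∏ t : Fin i, ch (r.encoder t w fun s => ω₀ (L * k + s)) (ω₀ (L * k + t)) := by
  induction i with
  | zero => simp
  | succ i ih =>
    have h1 : {ω | outputPrefix (L * k + (i + 1)) ω = outputPrefix (L * k + (i + 1)) ω₀} =
        {ω : ℕ → ∀ j, Y j | outputPrefix (L * k + i) ω = outputPrefix (L * k + i) ω₀ ∧
          ω (L * k + i) = ω₀ (L * k + i)} := by
      ext ω
      constructor
      · intro h
        exact ⟨funext fun t => congrFun h ⟨t, t.2.trans (Nat.lt_succ_self _)⟩,
          congrFun h ⟨L * k + i, Nat.lt_succ_self _⟩⟩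
      · rintro ⟨h2, h3⟩
        funext t
        rcases Nat.lt_succ_iff_lt_or_eq.1 t.2 with h | h
        · exact congrFun h2 ⟨t, h⟩
        · change ω t = ω₀ t
          rw [h]; exact h3
    rw [h1, r.repeated.outputLaw_prefix_succ, ih (by omega), Fin.prod_univ_castSucc,
      repeated_encoder r k i (by omega), mul_assoc]
    rfl

theorem outputLaw_block (hL : 0 < L) (w : Fin M) (k : ℕ) (v : Fin (L * k) → ∀ j, Y j)
    (u : Fin L → ∀ j, Y j) :
    r.repeated.outputLaw ch w {ω | outputPrefix (L * k) ω = v ∧ block L k ω = u} =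
      r.repeated.outputLaw ch w {ω | outputPrefix (L * k) ω = v} * r.prob ch w u := by
  obtain ⟨ω₀, hv, hu⟩ : ∃ ω₀ : ℕ → ∀ j, Y j, outputPrefix (L * k) ω₀ = v ∧ block L k ω₀ = u := by
    refine ⟨fun t => if h : t < L * k then v ⟨t, h⟩ else
      u ⟨(t - L * k) % L, Nat.mod_lt _ hL⟩, ?_, ?_⟩
    · funext t
      exact dif_pos t.2
    · funext i
      refine (dif_neg (by omega)).trans ?_
      congr 1
      refine Fin.ext ?_
      change (L * k + i - L * k) % L = i
      rw [Nat.add_sub_cancel_left, Nat.mod_eq_of_lt i.2]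
  have h1 : {ω : ℕ → ∀ j, Y j | outputPrefix (L * k) ω = v ∧ block L k ω = u} =
      {ω | outputPrefix (L * k + L) ω = outputPrefix (L * k + L) ω₀} := by
    ext ω
    rw [← hv, ← hu]
    constructor
    · rintro ⟨h2, h3⟩
      funext t
      rcases lt_or_ge (t : ℕ) (L * k) with h | h
      · exact congrFun h2 ⟨t, h⟩
      · have := congrFun h3 ⟨t - L * k, by have := t.2; omega⟩
        change ω (L * k + (t - L * k)) = ω₀ (L * k + (t - L * k)) at this
        rwa [Nat.add_sub_cancel' h] at this
    · intro h
      exact ⟨funext fun t => congrFun h ⟨t, t.2.trans_le (Nat.le_add_right _ _)⟩,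
        funext fun i => congrFun h ⟨L * k + i, by have := i.2; omega⟩⟩
  rw [h1, r.outputLaw_prefix_add ch w ω₀ k L le_rfl, hv, ← hu]
  rfl

open scoped Classical in
/-- The rounds are independent, given the message. -/
theorem outputLaw_inter_block [∀ j, Fintype (Y j)] (hL : 0 < L) (w : Fin M) (k : ℕ)
    (A : Set (ℕ → ∀ j, Y j))
    (hA : ∀ ω ω', outputPrefix (L * k) ω = outputPrefix (L * k) ω' → ω ∈ A → ω' ∈ A)
    (T : Set (Fin L → ∀ j, Y j)) :
    r.repeated.outputLaw ch w (A ∩ {ω | block L k ω ∈ T}) =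
      r.repeated.outputLaw ch w A * ∑ u with u ∈ T, r.prob ch w u := by
  have hm : Measurable fun ω : ℕ → ∀ j, Y j => (outputPrefix (L * k) ω, block L k ω) :=
    (measurable_outputPrefix _).prodMk (measurable_pi_lambda _ fun i => measurable_pi_apply _)
  rw [measure_eq_sum_fiber _ hm, measure_eq_sum_fiber _ (measurable_outputPrefix (L * k)) A,
    Fintype.sum_prod_type, Finset.sum_mul]
  refine Finset.sum_congr rfl fun v _ => ?_
  rw [Finset.mul_sum, Finset.sum_filter]
  refine Finset.sum_congr rfl fun u _ => ?_
  by_cases hv : ∃ ω ∈ A, outputPrefix (L * k) ω = v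
  · obtain ⟨ω₁, hω₁, hv⟩ := hv
    have e1 : A ∩ {ω | outputPrefix (L * k) ω = v} = {ω | outputPrefix (L * k) ω = v} :=
      Set.inter_eq_right.2 fun ω hω => hA ω₁ ω (hv.trans hω.symm) hω₁
    rw [e1]
    split_ifs with hu
    · rw [← r.outputLaw_block ch hL w k v u]
      congr 1
      ext ω
      constructor
      · rintro ⟨-, h2⟩
        exact Prod.ext_iff.1 h2
      · rintro ⟨h2, h3⟩
        exact ⟨⟨hA ω₁ ω (hv.trans h2.symm) hω₁, by rw [← h3] at hu; exact hu⟩, Prod.ext h2 h3⟩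
    · convert measure_empty (μ := r.repeated.outputLaw ch w)
      ext ω
      simp only [Set.mem_inter_iff, Set.mem_ofPred_eq, Set.mem_empty_iff_false, iff_false]
      rintro ⟨⟨-, h2⟩, h3⟩
      have h4 : block L k ω = u := (Prod.ext_iff.1 h3).2
      exact hu (by rw [← h4]; exact h2)
  · have e1 : A ∩ {ω | outputPrefix (L * k) ω = v} = ∅ := by
      ext ω
      simp only [Set.mem_inter_iff, Set.mem_ofPred_eq, Set.mem_empty_iff_false, iff_false]
      exact fun h => hv ⟨ω, h⟩
    rw [e1, measure_empty, zero_mul, ite_self]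
    convert measure_empty (μ := r.repeated.outputLaw ch w)
    ext ω
    simp only [Set.mem_inter_iff, Set.mem_ofPred_eq, Set.mem_empty_iff_false, iff_false]
    rintro ⟨⟨h2, -⟩, h3⟩
    exact hv ⟨ω, h2, (Prod.ext_iff.1 h3).1⟩

theorem pending_of_prefix_eq (k : ℕ) (ω ω' : ℕ → ∀ j, Y j)
    (h : outputPrefix (L * k) ω = outputPrefix (L * k) ω') (hω : ω ∈ r.pending k) :
    ω' ∈ r.pending k := fun k' hk' => by
  rw [← block_eq_of_prefix_eq (Nat.mul_le_mul_left L hk') h]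
  exact hω k' hk'

theorem measurableSet_pending (k : ℕ) : MeasurableSet (r.pending k) := by
  have : r.pending k = outputPrefix (L * k) ⁻¹' (outputPrefix (L * k) '' r.pending k) := by
    ext ω
    constructor
    · exact fun h => ⟨ω, h, rfl⟩
    · rintro ⟨ω', h1, h2⟩
      exact r.pending_of_prefix_eq k ω' ω h2 h1
  rw [this]
  exact measurable_outputPrefix _ MeasurableSet.of_discrete

open scoped Classical in
theorem outputLaw_pending [∀ j, Fintype (Y j)] (hL : 0 < L) (w : Fin M) (k : ℕ) :
    r.repeated.outputLaw ch w (r.pending k) = (∑ u with u ∈ r.rejected, r.prob ch w u) ^ k := by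
  induction k with
  | zero =>
    have : r.pending 0 = Set.univ := Set.eq_univ_of_forall fun ω k' hk' => absurd hk' (by omega)
    rw [this, measure_univ, pow_zero]
  | succ k ih =>
    rw [pow_succ, ← ih, ← r.outputLaw_inter_block ch hL w k _ (r.pending_of_prefix_eq k)]
    congr 1
    ext ω
    constructor
    · exact fun h => ⟨fun k' hk' => h k' (by omega), h k (by omega)⟩
    · rintro ⟨h1, h2⟩ k' hk'
      rcases Nat.lt_succ_iff_lt_or_eq.1 hk' with h | rfl
      exacts [h1 k' h, h2]

/-- If some round is accepted by all receivers, then receiver `j` accepts, and the rounds before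
its first accepted one are not accepted by all. -/
theorem exists_first_accepted {ω : ℕ → ∀ j, Y j} {k₀ : ℕ} (hk₀ : block L k₀ ω ∉ r.rejected)
    (j : Fin K) : ∃ k ≤ k₀, userBlock j (block L k ω) ∈ r.accept j ∧
      (∀ k' < k, userBlock j (block L k' ω) ∉ r.accept j) ∧ ω ∈ r.pending k := by
  classical
  have hacc : userBlock j (block L k₀ ω) ∈ r.accept j := by
    by_contra h
    exact hk₀ ⟨j, h⟩
  have hex : ∃ k, userBlock j (block L k ω) ∈ r.accept j := ⟨k₀, hacc⟩
  exact ⟨Nat.find hex, Nat.find_min' hex hacc, Nat.find_spec hex, fun k' hk' => Nat.find_min hex hk',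
    fun k' hk' => ⟨j, Nat.find_min hex hk'⟩⟩

/-- Each receiver stops no later than the first round accepted by all, so the length is at most `L`
times the number of rounds begun up to then. If there is no such round, the right side is infinite.
-/
theorem tau_le (hL : 0 < L) (ω : Sample M Y) : (r.repeated.tau ω : ℝ≥0∞) ≤
    ∑' k, (Prod.snd ⁻¹' r.pending k : Set (Sample M Y)).indicator (fun _ => (L : ℝ≥0∞)) ω := by
  classical
  by_cases h : ∃ k₀, block L k₀ ω.2 ∉ r.rejected
  · have hspec := Nat.find_spec h
    have hpend : ∀ k ≤ Nat.find h, ω.2 ∈ r.pending k := fun k hk k' hk' =>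
      not_not.1 (Nat.find_min h (hk'.trans_le hk))
    have h1 : r.repeated.tau ω ≤ (L * (Nat.find h + 1) : ℕ) := by
      refine iSup_le fun j => ?_
      refine (r.stopTime_le_iff j ω _).2 ⟨Nat.find h, ?_, le_rfl⟩
      by_contra hj
      exact hspec ⟨j, hj⟩
    calc (r.repeated.tau ω : ℝ≥0∞) ≤ ((L * (Nat.find h + 1) : ℕ) : ℝ≥0∞) := by exact_mod_cast h1
      _ = ∑ k ∈ Finset.range (Nat.find h + 1), (L : ℝ≥0∞) := by
        rw [Finset.sum_const, Finset.card_range, nsmul_eq_mul]; push_cast; ring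
      _ = ∑ k ∈ Finset.range (Nat.find h + 1), (Prod.snd ⁻¹' r.pending k :
          Set (Sample M Y)).indicator (fun _ => (L : ℝ≥0∞)) ω := by
        refine Finset.sum_congr rfl fun k hk => ?_
        have : ω ∈ (Prod.snd ⁻¹' r.pending k : Set (Sample M Y)) :=
          hpend k (Nat.lt_succ_iff.1 (Finset.mem_range.1 hk))
        rw [Set.indicator_of_mem this]
      _ ≤ _ := ENNReal.sum_le_tsum _
  · push Not at h
    have : ∀ k, (Prod.snd ⁻¹' r.pending k : Set (Sample M Y)).indicator
        (fun _ => (L : ℝ≥0∞)) ω = L := fun k => by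
      have : ω ∈ (Prod.snd ⁻¹' r.pending k : Set (Sample M Y)) := fun k' _ => h k'
      rw [Set.indicator_of_mem this]
    simp_rw [this]
    rw [ENNReal.tsum_const_eq_top_of_ne_zero (by exact_mod_cast hL.ne')]
    exact le_top

theorem law_le_of_forall (c : VLFTCode M X Y) {S : Set (Sample M Y)} {β : ℝ≥0∞}
    (h : ∀ w, c.outputLaw ch w (Prod.mk w ⁻¹' S) ≤ β) : c.law ch S ≤ β := by
  rw [c.law_apply]
  refine (mul_le_mul_right (Finset.sum_le_sum fun w _ => h w) _).trans ?_
  rw [Finset.sum_const, Finset.card_univ, Fintype.card_fin, nsmul_eq_mul, ← mul_assoc,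
    ENNReal.inv_mul_cancel (by exact_mod_cast NeZero.ne M) (ENNReal.natCast_ne_top M), one_mul]

open scoped Classical in
theorem expectedLength_le [∀ j, Fintype (Y j)] (hL : 0 < L) {δ : ℝ≥0∞}
    (hδ : ∀ w, ∑ u with u ∈ r.rejected, r.prob ch w u ≤ δ) :
    r.repeated.expectedLength ch ≤ L * (1 - δ)⁻¹ := by
  have hm : ∀ k, MeasurableSet (Prod.snd ⁻¹' r.pending k : Set (Sample M Y)) := fun k =>
    measurable_snd (r.measurableSet_pending k)
  refine (lintegral_mono fun ω => r.tau_le hL ω).trans ?_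
  rw [lintegral_tsum fun k => (measurable_const.indicator (hm k)).aemeasurable,
    ← ENNReal.tsum_geometric, ← ENNReal.tsum_mul_left]
  refine ENNReal.tsum_le_tsum fun k => ?_
  rw [lintegral_indicator_const (hm k)]
  refine mul_le_mul_right (law_le_of_forall ch _ fun w => ?_) _
  rw [← Set.preimage_comp]
  refine (r.outputLaw_pending ch hL w k).le.trans (pow_le_pow_left' (hδ w) k)

open scoped Classical in
-- An error needs either rejection in every round, a null event as `δ < 1`, or a wrong acceptance in
-- a round `k` still pending. Independence gives the latter probability at most `β * δ ^ k`, a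
-- geometric series.
theorem errorProb_le [∀ j, Fintype (Y j)] (hL : 0 < L) {δ β : ℝ≥0∞} (hδ1 : δ < 1)
    (hδ : ∀ w, ∑ u with u ∈ r.rejected, r.prob ch w u ≤ δ)
    (hβ : ∀ w, ∑ u with u ∈ r.wronglyAccepted w, r.prob ch w u ≤ β) :
    r.repeated.errorProb ch ≤ β * (1 - δ)⁻¹ := by
  refine law_le_of_forall ch _ fun w => ?_
  have hsub : Prod.mk w ⁻¹' r.repeated.errorEvent ⊆ (⋂ k, r.pending k) ∪
      ⋃ k, (r.pending k ∩ {ω | block L k ω ∈ r.wronglyAccepted w}) := by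
    rintro ω ⟨j, hj⟩
    by_cases h : ∃ k₀, block L k₀ ω ∉ r.rejected
    · obtain ⟨k₀, hk₀⟩ := h
      obtain ⟨k, -, h1, h2, h3⟩ := r.exists_first_accepted hk₀ j
      refine Or.inr (Set.mem_iUnion.2 ⟨k, h3, j, h1, fun hdec => hj ⟨L * (k + 1), ?_, ?_⟩⟩)
      · exact r.stopTime_eq j (w, ω) h1 h2
      · rw [r.repeated_decoder]
        exact hdec
    · push Not at h
      exact Or.inl (Set.mem_iInter.2 fun k k' _ => h k')
  have h0 : r.repeated.outputLaw ch w (⋂ k, r.pending k) = 0 := by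
    have hle : ∀ k, r.repeated.outputLaw ch w (⋂ k, r.pending k) ≤ δ ^ k := fun k =>
      (measure_mono (Set.iInter_subset _ k)).trans
        ((r.outputLaw_pending ch hL w k).le.trans (pow_le_pow_left' (hδ w) k))
    exact le_antisymm (ge_of_tendsto' (ENNReal.tendsto_pow_atTop_nhds_zero_of_lt_one hδ1) hle)
      zero_le
  refine (measure_mono hsub).trans ((measure_union_le _ _).trans ?_)
  rw [h0, zero_add, ← ENNReal.tsum_geometric, ← ENNReal.tsum_mul_left]
  refine (measure_iUnion_le _).trans (ENNReal.tsum_le_tsum fun k => ?_)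
  rw [r.outputLaw_inter_block ch hL w k _ (r.pending_of_prefix_eq k), mul_comm,
    r.outputLaw_pending ch hL w k]
  exact mul_le_mul' (hβ w) (pow_le_pow_left' (hδ w) k)

end RoundCode
theorem sum_filter_exists_le {α κ : Type*} [Fintype α] [Fintype κ] (p : κ → α → Prop)
    [∀ j, DecidablePred (p j)] [DecidablePred fun a => ∃ j, p j a] (f : α → ℝ≥0∞) :
    ∑ a with ∃ j, p j a, f a ≤ ∑ j, ∑ a with p j a, f a := by
  simp_rw [Finset.sum_filter]
  rw [Finset.sum_comm]
  refine Finset.sum_le_sum fun a _ => ?_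
  split_ifs with h
  · obtain ⟨j, hj⟩ := h
    refine le_trans ?_ (Finset.single_le_sum (f := fun j => if p j a then f a else 0)
      (fun _ _ => zero_le) (Finset.mem_univ j))
    simp [hj]
  · exact zero_le

/-! ### Two-phase rounds: block code and confirmation. -/

section TwoPhase

variable {K : ℕ} {X : Type*} {Y : Fin K → Type*} [∀ j, Fintype (Y j)] {M : ℕ}

open scoped Classical in
theorem sum_prod_marginal (ch : BroadcastChannel X Y) (j : Fin K) {n : ℕ} (x : Fin n → X)
    (S : Set (Fin n → Y j)) :
    ∑ u : Fin n → ∀ j, Y j with (fun i => u i j) ∈ S, ∏ i, ch (x i) (u i) =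
      ∑ b with b ∈ S, ∏ i, ch.marginal j (x i) (b i) := by
  have h1 : ∀ b : Fin n → Y j, ∏ i, ch.marginal j (x i) (b i) =
      ∑ u : Fin n → ∀ j, Y j, if (fun i => u i j) = b then ∏ i, ch (x i) (u i) else 0 := by
    intro b
    rw [Finset.prod_congr rfl fun i _ => (sum_marginal ch j (x i) (b i)).symm]
    rw [← sum_pi_prod fun i z => if z j = b i then ch (x i) z else 0]
    refine Finset.sum_congr rfl fun u _ => ?_
    by_cases h : (fun i => u i j) = b
    · rw [if_pos h]
      exact Finset.prod_congr rfl fun i _ => if_pos (congrFun h i)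
    · rw [if_neg h]
      obtain ⟨i, hi⟩ := Function.ne_iff.1 h
      exact Finset.prod_eq_zero (Finset.mem_univ i) (if_neg hi)
  simp_rw [h1]
  rw [Finset.sum_comm, Finset.sum_filter]
  refine Finset.sum_congr rfl fun u _ => ?_
  rw [Finset.sum_ite_eq]
  simp

theorem sum_prod_channel (ch : BroadcastChannel X Y) {n : ℕ} (x : Fin n → X) :
    ∑ u : Fin n → ∀ j, Y j, ∏ i, ch (x i) (u i) = 1 := by
  classical
  rw [sum_pi_prod fun i => ch (x i)]
  refine Finset.prod_eq_one fun i _ => ?_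
  rw [← tsum_fintype (L := .unconditional _), PMF.tsum_coe]

/-- A round in two phases: a block code, then a confirmation `x₀` if all receivers have decoded the
message correctly, and `x₁` otherwise. -/
def RoundCode.twoPhase {n₁ n₂ : ℕ} (cw : Fin M → Fin n₁ → X) (φ : ∀ j, (Fin n₁ → Y j) → Fin M)
    (x₀ x₁ : X) (A : ∀ j, Finset (Fin n₂ → Y j)) : RoundCode M (n₁ + n₂) X Y where
  encoder i w past := open scoped Classical in
    if h : i < n₁ then cw w ⟨i, h⟩
    else if ∀ j, φ j (fun t => past ⟨t, t.2.trans_le (not_lt.1 h)⟩ j) = w then x₀ else x₁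
  accept j := {b | (fun i => b (Fin.natAdd n₁ i)) ∈ A j}
  decoder j b := φ j fun i => b (Fin.castAdd n₂ i)

namespace RoundCode

variable {n₁ n₂ : ℕ} (cw : Fin M → Fin n₁ → X) (φ : ∀ j, (Fin n₁ → Y j) → Fin M)
    (x₀ x₁ : X) (A : ∀ j, Finset (Fin n₂ → Y j)) (ch : BroadcastChannel X Y)

open scoped Classical in
theorem twoPhase_prob (w : Fin M) (u : Fin n₁ → ∀ j, Y j) (u' : Fin n₂ → ∀ j, Y j) :
    (twoPhase cw φ x₀ x₁ A).prob ch w (Fin.append u u') = (∏ i, ch (cw w i) (u i)) *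
      ∏ i, ch (if ∀ j, φ j (fun t => u t j) = w then x₀ else x₁) (u' i) := by
  unfold prob
  rw [Fin.prod_univ_add]
  congr 1
  · refine Finset.prod_congr rfl fun i _ => ?_
    rw [Fin.append_left]
    congr 2
    exact dif_pos i.2
  · refine Finset.prod_congr rfl fun i _ => ?_
    rw [Fin.append_right]
    congr 2
    refine (dif_neg (by simp)).trans ?_
    have : ∀ (t : Fin n₁) (ht : (t : ℕ) < n₁ + n₂), Fin.append u u' ⟨t, ht⟩ = u t :=
      fun t _ => Fin.append_left u u' t
    simp_rw [this]

open scoped Classical in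
theorem sum_twoPhase (w : Fin M) (S : Set (Fin (n₁ + n₂) → ∀ j, Y j)) :
    ∑ u with u ∈ S, (twoPhase cw φ x₀ x₁ A).prob ch w u =
      ∑ u : Fin n₁ → ∀ j, Y j, (∏ i, ch (cw w i) (u i)) * ∑ u' with Fin.append u u' ∈ S,
        ∏ i, ch (if ∀ j, φ j (fun t => u t j) = w then x₀ else x₁) (u' i) := by
  rw [Finset.sum_filter, ← (Fin.appendEquiv n₁ n₂).sum_comp, Fintype.sum_prod_type]
  refine Finset.sum_congr rfl fun u _ => ?_
  rw [Finset.mul_sum, Finset.sum_filter]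
  refine Finset.sum_congr rfl fun u' _ => ?_
  rw [← twoPhase_prob cw φ x₀ x₁ A ch]
  rfl

open scoped Classical in
-- A rejection comes from a decoding error in the first phase or from a receiver that fails to
-- recognize `x₀` after a correct one.
theorem sum_rejected_le (w : Fin M) :
    ∑ u with u ∈ (twoPhase cw φ x₀ x₁ A).rejected, (twoPhase cw φ x₀ x₁ A).prob ch w u ≤
      ∑ j, ∑ b with φ j b ≠ w, ∏ i, ch.marginal j (cw w i) (b i) +
      ∑ j, ∑ b with b ∉ A j, ∏ i, ch.marginal j x₀ (b i) := by
  rw [sum_twoPhase]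
  have h1 : ∀ u : Fin n₁ → ∀ j, Y j, (∏ i, ch (cw w i) (u i)) *
      ∑ u' with Fin.append u u' ∈ (twoPhase cw φ x₀ x₁ A).rejected,
        ∏ i, ch (if ∀ j, φ j (fun t => u t j) = w then x₀ else x₁) (u' i) ≤
      (if ∃ j, φ j (fun t => u t j) ≠ w then ∏ i, ch (cw w i) (u i) else 0) +
      (∏ i, ch (cw w i) (u i)) * ∑ j, ∑ b with b ∉ A j, ∏ i, ch.marginal j x₀ (b i) := by
    intro u
    by_cases h : ∀ j, φ j (fun t => u t j) = w
    · refine le_add_left (mul_le_mul_right ?_ _)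
      rw [if_pos h]
      have e : ∀ u' : Fin n₂ → ∀ j, Y j,
          Fin.append u u' ∈ (twoPhase cw φ x₀ x₁ A).rejected ↔
            ∃ j, (fun i => u' i j) ∈ {b | b ∉ A j} := by
        intro u'
        refine exists_congr fun j => ?_
        simp [twoPhase, userBlock]
      simp_rw [e]
      refine (sum_filter_exists_le _ _).trans (Finset.sum_le_sum fun j _ => ?_)
      convert (sum_prod_marginal ch j (fun _ => x₀) {b | b ∉ A j}).le
    · rw [if_pos (not_forall.1 h)]
      refine le_add_right (mul_le_of_le_one_right' ?_)
      refine (Finset.sum_le_sum_of_subset (Finset.filter_subset _ _)).trans ?_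
      exact (sum_prod_channel ch fun _ => _).le
  refine (Finset.sum_le_sum fun u _ => h1 u).trans ?_
  rw [Finset.sum_add_distrib, ← Finset.sum_mul, sum_prod_channel, one_mul, ← Finset.sum_filter]
  refine add_le_add_left ((sum_filter_exists_le _ _).trans (Finset.sum_le_sum fun j _ => ?_)) _
  convert (sum_prod_marginal ch j (cw w) {b | φ j b ≠ w}).le

open scoped Classical in
-- If receiver `j` decodes wrongly, the encoder sends `x₁`, so a wrong acceptance also requires its
-- test to take `x₁` for `x₀`. The two phases use fresh channel noise, whence the product.
theorem sum_wronglyAccepted_le (w : Fin M) :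
    ∑ u with u ∈ (twoPhase cw φ x₀ x₁ A).wronglyAccepted w, (twoPhase cw φ x₀ x₁ A).prob ch w u ≤
      ∑ j, (∑ b with φ j b ≠ w, ∏ i, ch.marginal j (cw w i) (b i)) *
        ∑ b with b ∈ A j, ∏ i, ch.marginal j x₁ (b i) := by
  refine le_trans (le_of_eq (Finset.sum_congr ?_ fun _ _ => rfl)) ((sum_filter_exists_le
    (fun j u => userBlock j u ∈ (twoPhase cw φ x₀ x₁ A).accept j ∧
      (twoPhase cw φ x₀ x₁ A).decoder j (userBlock j u) ≠ w) _).trans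
        (Finset.sum_le_sum fun j _ => ?_))
  · ext u
    rw [Finset.mem_filter_univ, Finset.mem_filter_univ]
    rfl
  have h := sum_twoPhase cw φ x₀ x₁ A ch w {u | userBlock j u ∈ (twoPhase cw φ x₀ x₁ A).accept j ∧
    (twoPhase cw φ x₀ x₁ A).decoder j (userBlock j u) ≠ w}
  have h1 := sum_prod_marginal ch j (cw w) {b | φ j b ≠ w}
  have h2 := sum_prod_marginal ch j (fun _ => x₁) {b | b ∈ A j}
  simp only [Set.mem_ofPred_eq] at h h1 h2
  rw [← h1, ← h2]
  refine le_trans (le_of_eq (by convert h)) ?_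
  rw [Finset.sum_mul, Finset.sum_filter]
  refine Finset.sum_le_sum fun u _ => ?_
  have e : ∀ u' : Fin n₂ → ∀ j, Y j,
      userBlock j (Fin.append u u') ∈ (twoPhase cw φ x₀ x₁ A).accept j ∧
        (twoPhase cw φ x₀ x₁ A).decoder j (userBlock j (Fin.append u u')) ≠ w ↔
      (fun i => u' i j) ∈ A j ∧ φ j (fun i => u i j) ≠ w := by
    intro u'
    simp [twoPhase, userBlock]
  simp_rw [e]
  by_cases hw : φ j (fun i => u i j) = w
  · simp [hw]
  · rw [if_pos hw, if_neg fun h => hw (h j)]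
    simp [hw]

end RoundCode

end TwoPhase
-- Achievable pairs from two-phase rounds.
section Achievability

variable {K : ℕ} {X : Type*} {Y : Fin K → Type*} [∀ j, Fintype (Y j)]

theorem sum_prod_marginal_eq_ofReal (ch : BroadcastChannel X Y) (j : Fin K) {n : ℕ}
    (x : Fin n → X) (S : Finset (Fin n → Y j)) :
    ∑ b ∈ S, ∏ i, ch.marginal j (x i) (b i) =
      ENNReal.ofReal (∑ b ∈ S, ∏ i, ch.matrix j (x i) (b i)) := by
  rw [ENNReal.ofReal_sum_of_nonneg fun b _ => Finset.prod_nonneg fun i _ => ch.matrix_nonneg _ _ _]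
  refine Finset.sum_congr rfl fun b _ => ?_
  rw [ENNReal.ofReal_prod_of_nonneg fun i _ => ch.matrix_nonneg _ _ _]
  exact Finset.prod_congr rfl fun i _ => (ENNReal.ofReal_toReal (PMF.apply_ne_top _ _)).symm

variable [∀ j, MeasurableSpace (Y j)] [∀ j, MeasurableSingletonClass (Y j)]

/-- The performance of the repetition of two-phase rounds, in terms of the lengths of the phases. -/
theorem exists_repeated_code [NeZero K] [Fintype X] [MeasurableSpace X]
    [MeasurableSingletonClass X] {ch : BroadcastChannel X Y} (hB : ch.Bmax < ∞) (P : PMF X) {r : ℝ}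
    (hr : ∀ j, r < (ch.mutualInfo P j).toReal) (x₀ x₁ : X) {γ : ℝ}
    (hγ : γ = 0 ∨ ∀ j, γ < (ch.relEntropy j x₀ x₁).toReal) :
    ∃ θ : ℝ, 0 ≤ θ ∧ θ < 1 ∧ ∀ n₁ n₂ M : ℕ, 0 < M → 0 < n₁ + n₂ → ∀ η δ : ℝ,
      K * (θ ^ n₁ + M * Real.exp (-(n₁ * r))) ≤ η → η + K * θ ^ n₂ ≤ δ → δ < 1 →
      ∃ c : VLFTCode M X Y,
        c.expectedLength ch ≤ ENNReal.ofReal ((n₁ + n₂ : ℕ) / (1 - δ)) ∧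
        c.errorProb ch ≤ ENNReal.ofReal (η * Real.exp (-(n₂ * γ)) / (1 - δ)) := by
  classical
  have : Nonempty (Fin K) := ⟨0⟩
  obtain ⟨θ₁, hθ₁0, hθ₁1, hcode⟩ := exists_block_code ch.matrix ch.matrix_nonneg ch.sum_matrix
    (fun x => (P x).toReal) (fun _ => ENNReal.toReal_nonneg) (sum_toReal_pmf P) (r := r)
    (fun j => by rw [← (ch.mutualInfo_ne_top_and_toReal P j).2]; exact hr j)
  choose θ₂ hθ₂0 hθ₂1 htest using fun j => exists_test (ch.matrix j x₀) (ch.matrix j x₁)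
    (ch.matrix_nonneg j x₀) (ch.matrix_nonneg j x₁) (ch.sum_matrix j x₀) (ch.sum_matrix j x₁)
    (fun b => matrix_eq_zero hB) (γ := γ)
    (hγ.imp_right fun h => by rw [← toReal_relEntropy hB]; exact h j)
  obtain ⟨j₀, hj₀⟩ := Finite.exists_max θ₂
  refine ⟨max θ₁ (θ₂ j₀), le_max_of_le_left hθ₁0, max_lt hθ₁1 (hθ₂1 j₀), ?_⟩
  intro n₁ n₂ M hM hL η δ hη hδ hδ1
  have : NeZero M := ⟨hM.ne'⟩
  obtain ⟨cw, φ, hcw⟩ := hcode n₁ M hM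
  choose A hA₀ hA₁ using fun j => htest j n₂
  have hE : ∀ w, ∑ j, ∑ b with φ j b ≠ w, ∏ i, ch.matrix j (cw w i) (b i) ≤ η := by
    intro w
    refine (hcw w).trans (le_trans ?_ hη)
    rw [Fintype.card_fin]
    have := pow_le_pow_left₀ hθ₁0 (le_max_left θ₁ (θ₂ j₀)) n₁
    gcongr
  have hEnn : ∀ w j, 0 ≤ ∑ b with φ j b ≠ w, ∏ i, ch.matrix j (cw w i) (b i) := fun w j =>
    Finset.sum_nonneg fun b _ => Finset.prod_nonneg fun i _ => ch.matrix_nonneg _ _ _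
  have hη0 : 0 ≤ η := (Finset.sum_nonneg fun j _ => hEnn ⟨0, hM⟩ j).trans (hE ⟨0, hM⟩)
  have hF : ∑ j, ∑ b with b ∉ A j, ∏ i, ch.matrix j x₀ (b i) ≤
      K * max θ₁ (θ₂ j₀) ^ n₂ := by
    have h1 : ∀ j, ∑ b with b ∉ A j, ∏ i, ch.matrix j x₀ (b i) ≤ max θ₁ (θ₂ j₀) ^ n₂ := by
      intro j
      refine le_trans (le_of_eq (Finset.sum_congr ?_ fun _ _ => rfl)) ((hA₀ j).trans
        (pow_le_pow_left₀ (hθ₂0 j) ((hj₀ j).trans (le_max_right _ _)) n₂))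
      ext b; simp
    refine (Finset.sum_le_sum fun j _ => h1 j).trans ?_
    simp
  have hFnn : ∀ j, 0 ≤ ∑ b with b ∉ A j, ∏ i, ch.matrix j x₀ (b i) := fun j =>
    Finset.sum_nonneg fun b _ => Finset.prod_nonneg fun i _ => ch.matrix_nonneg _ _ _
  have hδ0 : 0 ≤ δ := le_trans (add_nonneg hη0 (by positivity)) hδ
  have hrej : ∀ w, ∑ u with u ∈ (RoundCode.twoPhase cw φ x₀ x₁ A).rejected,
      (RoundCode.twoPhase cw φ x₀ x₁ A).prob ch w u ≤ ENNReal.ofReal δ := by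
    intro w
    refine (RoundCode.sum_rejected_le cw φ x₀ x₁ A ch w).trans ?_
    simp_rw [sum_prod_marginal_eq_ofReal ch _ (cw w),
      fun j => sum_prod_marginal_eq_ofReal ch j (n := n₂) (fun _ => x₀)]
    rw [← ENNReal.ofReal_sum_of_nonneg fun j _ => hEnn w j,
      ← ENNReal.ofReal_sum_of_nonneg fun j _ => hFnn j,
      ← ENNReal.ofReal_add (Finset.sum_nonneg fun j _ => hEnn w j)
        (Finset.sum_nonneg fun j _ => hFnn j)]
    exact ENNReal.ofReal_le_ofReal ((add_le_add (hE w) hF).trans hδ)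
  have hwr : ∀ w, ∑ u with u ∈ (RoundCode.twoPhase cw φ x₀ x₁ A).wronglyAccepted w,
      (RoundCode.twoPhase cw φ x₀ x₁ A).prob ch w u ≤
        ENNReal.ofReal (η * Real.exp (-(n₂ * γ))) := by
    intro w
    refine (RoundCode.sum_wronglyAccepted_le cw φ x₀ x₁ A ch w).trans ?_
    simp_rw [sum_prod_marginal_eq_ofReal ch _ (cw w),
      fun j => sum_prod_marginal_eq_ofReal ch j (n := n₂) (fun _ => x₁)]
    simp_rw [← ENNReal.ofReal_mul (hEnn w _)]
    have h1 : ∀ j, 0 ≤ ∑ b with b ∈ A j, ∏ i, ch.matrix j x₁ (b i) := fun j =>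
      Finset.sum_nonneg fun b _ => Finset.prod_nonneg fun i _ => ch.matrix_nonneg _ _ _
    rw [← ENNReal.ofReal_sum_of_nonneg fun j _ => mul_nonneg (hEnn w j) (h1 j)]
    refine ENNReal.ofReal_le_ofReal (le_trans ?_
      (mul_le_mul_of_nonneg_right (hE w) (Real.exp_pos _).le))
    rw [Finset.sum_mul]
    refine Finset.sum_le_sum fun j _ => mul_le_mul_of_nonneg_left ?_ (hEnn w j)
    refine le_trans (le_of_eq (Finset.sum_congr ?_ fun _ _ => rfl)) (hA₁ j)
    ext b; simp
  have hδ1' : ENNReal.ofReal δ < 1 := by rwa [ENNReal.ofReal_lt_one]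
  have hinv : (1 - ENNReal.ofReal δ)⁻¹ = ENNReal.ofReal (1 - δ)⁻¹ := by
    rw [← ENNReal.ofReal_one, ← ENNReal.ofReal_sub _ hδ0, ENNReal.ofReal_inv_of_pos (by linarith)]
  refine ⟨(RoundCode.twoPhase cw φ x₀ x₁ A).repeated, ?_, ?_⟩
  · refine (RoundCode.expectedLength_le _ ch hL hrej).trans (le_of_eq ?_)
    rw [hinv, div_eq_mul_inv, ENNReal.ofReal_mul (by positivity), ENNReal.ofReal_natCast]
  · refine (RoundCode.errorProb_le _ ch hL hδ1' hrej hwr).trans (le_of_eq ?_)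
    rw [hinv, div_eq_mul_inv, ENNReal.ofReal_mul (mul_nonneg hη0 (Real.exp_pos _).le)]

theorem exists_trivial_code [Nonempty X] (ch : BroadcastChannel X Y) :
    ∃ c : VLFTCode 2 X Y, c.expectedLength ch = 0 := by
  refine ⟨⟨fun _ _ _ => Classical.arbitrary X, fun _ _ _ => 0, fun _ _ => 0, fun j n => ?_⟩, ?_⟩
  · have : {ω : Sample 2 Y | (0 : ℕ∞) ≤ (n : ℕ∞)} = Set.univ := by ext; simp
    exact this ▸ MeasurableSet.univ
  · unfold VLFTCode.expectedLength VLFTCode.tau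
    simp

/-- The block code gets time `a * N` and the confirmation `b * N`; the slack `a + b < 1` absorbs the
factor `1 / (1 - δ)` by which repetition lengthens the transmission. -/
theorem achievable_of_params [NeZero K] [Fintype X] [Nonempty X] [MeasurableSpace X]
    [MeasurableSingletonClass X] {ch : BroadcastChannel X Y} (hB : ch.Bmax < ∞) (P : PMF X) {r : ℝ}
    (hr : ∀ j, r < (ch.mutualInfo P j).toReal) (x₀ x₁ : X) {γ : ℝ} (hγ0 : 0 ≤ γ)
    (hγ : γ = 0 ∨ ∀ j, γ < (ch.relEntropy j x₀ x₁).toReal) {R E a b : ℝ} (hR : 0 ≤ R) (hE : 0 ≤ E)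
    (ha : 0 < a) (hb : 0 < b) (hab : a + b < 1) (hr0 : 0 < r) (hRr : R < a * r)
    (hEγ : E ≤ b * γ) : ch.Achievable R E := by
  obtain ⟨θ, hθ0, hθ1, hcode⟩ := exists_repeated_code hB P hr x₀ x₁ hγ
  -- The summand `1` ensures at least two messages, even for `R = 0`.
  set m : ℝ → ℕ := fun N => ⌈Real.exp (R * N)⌉₊ + 1 with hm
  set η : ℝ → ℝ := fun N => K * (θ ^ ⌊a * N⌋₊ + m N * Real.exp (-(⌊a * N⌋₊ * r))) with hη
  set δ : ℝ → ℝ := fun N => η N + K * θ ^ ⌊b * N⌋₊ with hδ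
  have hθt : ∀ t : ℝ, 0 < t → Tendsto (fun N : ℝ => θ ^ ⌊t * N⌋₊) atTop (𝓝 0) := fun t ht =>
    (tendsto_pow_atTop_nhds_zero_of_lt_one hθ0 hθ1).comp
      (tendsto_nat_floor_atTop.comp (tendsto_id.const_mul_atTop ht))
  have hexpt : ∀ t : ℝ, 0 < t → Tendsto (fun N : ℝ => Real.exp (-(t * N))) atTop (𝓝 0) :=
    fun t ht => Real.tendsto_exp_neg_atTop_nhds_zero.comp (tendsto_id.const_mul_atTop ht)
  have hmexp : Tendsto (fun N : ℝ => (m N : ℝ) * Real.exp (-(⌊a * N⌋₊ * r))) atTop (𝓝 0) := by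
    have hbound : Tendsto (fun N : ℝ => Real.exp r *
        (Real.exp (-((a * r - R) * N)) + 2 * Real.exp (-((a * r) * N)))) atTop (𝓝 0) := by
      have := ((hexpt (a * r - R) (by linarith)).add
        ((hexpt (a * r) (by positivity)).const_mul 2)).const_mul (Real.exp r)
      simpa using this
    refine squeeze_zero (fun N => by positivity) (fun N => ?_) hbound
    have h1 : (m N : ℝ) ≤ Real.exp (R * N) + 2 := by
      have := (Nat.ceil_lt_add_one (Real.exp_pos (R * N)).le).le
      simp only [hm, Nat.cast_add, Nat.cast_one]
      linarith
    have h2 : Real.exp (-(⌊a * N⌋₊ * r)) ≤ Real.exp r * Real.exp (-((a * r) * N)) := by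
      rw [← Real.exp_add, Real.exp_le_exp]
      have := mul_le_mul_of_nonneg_right (Nat.lt_floor_add_one (a * N)).le hr0.le
      linarith
    calc (m N : ℝ) * Real.exp (-(⌊a * N⌋₊ * r))
        ≤ (Real.exp (R * N) + 2) * (Real.exp r * Real.exp (-((a * r) * N))) :=
          mul_le_mul h1 h2 (Real.exp_pos _).le (by positivity)
      _ = Real.exp r * (Real.exp (R * N) * Real.exp (-((a * r) * N)) +
          2 * Real.exp (-((a * r) * N))) := by ring
      _ = _ := by rw [← Real.exp_add]; congr 4; ring
  have hηt : Tendsto η atTop (𝓝 0) := by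
    have := ((hθt a ha).add hmexp).const_mul (K : ℝ)
    simpa using this
  have hδt : Tendsto δ atTop (𝓝 0) := by
    have := hηt.add ((hθt b hb).const_mul (K : ℝ))
    simpa using this
  have hη0 : ∀ N, 0 ≤ η N := fun N => by positivity
  -- A code is required for every positive `N`; where `N` is too small for the estimates, the code
  -- that stops at once fills in.
  have hfam : ∀ N : ℝ, ∃ (M : ℕ) (c : VLFTCode M X Y),
      (2 ≤ M ∧ (0 < N → c.expectedLength ch ≤ ENNReal.ofReal N)) ∧
      (1 ≤ a * N → δ N ≤ 1 - (a + b) → Real.exp (R * N) ≤ M ∧ c.errorProb ch ≤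
        ENNReal.ofReal (η N * Real.exp (-(⌊b * N⌋₊ * γ)) / (1 - δ N))) := by
    intro N
    by_cases hgood : 1 ≤ a * N ∧ δ N ≤ 1 - (a + b)
    · obtain ⟨h1, h2⟩ := hgood
      have hN : 0 < N := by
        by_contra h
        have := mul_nonpos_of_nonneg_of_nonpos ha.le (not_lt.1 h)
        linarith
      have hfl : 0 < ⌊a * N⌋₊ := Nat.floor_pos.2 h1
      obtain ⟨c, hc1, hc2⟩ := hcode ⌊a * N⌋₊ ⌊b * N⌋₊ (m N) (Nat.succ_pos _) (by omega) (η N) (δ N)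
        le_rfl le_rfl (by linarith)
      refine ⟨m N, c, ⟨?_, fun _ => hc1.trans (ENNReal.ofReal_le_ofReal ?_)⟩, fun _ _ => ⟨?_, hc2⟩⟩
      · have : 0 < ⌈Real.exp (R * N)⌉₊ := Nat.ceil_pos.2 (Real.exp_pos _)
        simp only [hm]; omega
      · rw [div_le_iff₀ (by linarith)]
        have h3 := Nat.floor_le (mul_nonneg ha.le hN.le)
        have h4 := Nat.floor_le (mul_nonneg hb.le hN.le)
        have h5 : N * (a + b) ≤ N * (1 - δ N) := mul_le_mul_of_nonneg_left (by linarith) hN.le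
        push_cast
        linarith
      · have := Nat.le_ceil (Real.exp (R * N))
        simp only [hm, Nat.cast_add, Nat.cast_one]
        linarith
    · obtain ⟨c, hc⟩ := exists_trivial_code ch
      exact ⟨2, c, ⟨le_rfl, fun _ => by rw [hc]; exact zero_le⟩, fun h1 h2 => absurd ⟨h1, h2⟩ hgood⟩
  choose M c hMc hgood using hfam
  -- Rounding `b * N` down costs a factor `exp γ` in the error, and `1 / (1 - δ)` a factor `2`; both
  -- are absorbed by `η`, which tends to zero.
  have hev : ∀ᶠ N : ℝ in atTop, 0 < N ∧ 1 ≤ a * N ∧ δ N ≤ 1 - (a + b) ∧ δ N ≤ 1 / 2 ∧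
      2 * η N * Real.exp γ ≤ 1 := by
    have h1 : Tendsto (fun N => 2 * η N * Real.exp γ) atTop (𝓝 0) := by
      have := (hηt.const_mul 2).mul_const (Real.exp γ)
      simpa using this
    filter_upwards [eventually_gt_atTop 0,
      (tendsto_id.const_mul_atTop ha).eventually_ge_atTop 1,
      hδt.eventually_le_const (show (0 : ℝ) < 1 - (a + b) by linarith),
      hδt.eventually_le_const (show (0 : ℝ) < 1 / 2 by norm_num),
      h1.eventually_le_const (show (0 : ℝ) < 1 by norm_num)] with N h1 h2 h3 h4 h5
    exact ⟨h1, h2, h3, h4, h5⟩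
  have hPe : ∀ᶠ N : ℝ in atTop, (c N).errorProb ch ≤ ENNReal.ofReal (2 * η N) ∧
      (c N).errorProb ch ≤ ENNReal.ofReal (Real.exp (-(E * N))) := by
    filter_upwards [hev] with N hN
    obtain ⟨hN0, h1, h2, h3, h4⟩ := hN
    have h5 := (hgood N h1 h2).2
    have h6 : η N * Real.exp (-(⌊b * N⌋₊ * γ)) / (1 - δ N) ≤
        2 * η N * Real.exp (-(⌊b * N⌋₊ * γ)) := by
      rw [div_le_iff₀ (by linarith)]
      have : 0 ≤ η N * Real.exp (-(⌊b * N⌋₊ * γ)) := mul_nonneg (hη0 N) (Real.exp_pos _).le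
      nlinarith
    constructor
    · refine h5.trans (ENNReal.ofReal_le_ofReal (h6.trans ?_))
      refine mul_le_of_le_one_right (mul_nonneg zero_le_two (hη0 N)) (Real.exp_le_one_iff.2 ?_)
      rw [Left.neg_nonpos_iff]
      positivity
    · refine h5.trans (ENNReal.ofReal_le_ofReal (h6.trans ?_))
      have h7 : Real.exp (-(⌊b * N⌋₊ * γ)) ≤ Real.exp γ * Real.exp (-(E * N)) := by
        rw [← Real.exp_add, Real.exp_le_exp]
        have h8 := mul_le_mul_of_nonneg_right (Nat.lt_floor_add_one (b * N)).le hγ0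
        have h9 := mul_le_mul_of_nonneg_right hEγ hN0.le
        linarith
      calc 2 * η N * Real.exp (-(⌊b * N⌋₊ * γ))
          ≤ 2 * η N * (Real.exp γ * Real.exp (-(E * N))) :=
            mul_le_mul_of_nonneg_left h7 (mul_nonneg zero_le_two (hη0 N))
        _ = 2 * η N * Real.exp γ * Real.exp (-(E * N)) := by ring
        _ ≤ _ := mul_le_of_le_one_left (Real.exp_pos _).le h4
  refine ⟨hR, hE, M, c, fun N hN => ⟨(hMc N).1, (hMc N).2 hN⟩, ?_, ?_, ?_⟩
  · refine le_liminf_of_le (by isBoundedDefault) ?_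
    filter_upwards [hev] with N hN
    have h1 := (hgood N hN.2.1 hN.2.2.1).1
    rw [EReal.coe_le_coe_iff, le_div_iff₀ hN.1]
    rw [← Real.log_exp (R * N)]
    exact Real.log_le_log (Real.exp_pos _) h1
  · have h1 : Tendsto (fun N => ENNReal.ofReal (2 * η N)) atTop (𝓝 0) := by
      have := ENNReal.tendsto_ofReal (hηt.const_mul 2)
      simpa using this
    exact tendsto_of_tendsto_of_tendsto_of_le_of_le' tendsto_const_nhds h1
      (Eventually.of_forall fun _ => zero_le) (hPe.mono fun N hN => hN.1)
  · refine le_liminf_of_le (by isBoundedDefault) ?_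
    filter_upwards [hPe, eventually_gt_atTop 0] with N hN hN0
    exact (le_neg_log_div_iff hN0).2 hN.2

end Achievability
-- Data processing for finite laws.
section DataProcessing

variable {α β : Type*} [Fintype α] [MeasurableSpace α] [MeasurableSingletonClass α]
  [MeasurableSpace β]

theorem klDiv_toMeasure_bind_le (p q : PMF α) (V : α → PMF β) :
    InformationTheory.klDiv (p.bind V).toMeasure (q.bind V).toMeasure ≤
      InformationTheory.klDiv p.toMeasure q.toMeasure := by
  set κ : Kernel α β := Kernel.ofFunOfCountable fun a => (V a).toMeasure with hκ
  have hκm : IsMarkovKernel κ := ⟨fun _ => PMF.toMeasure.isProbabilityMeasure _⟩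
  have h : ∀ p : PMF α, κ ∘ₘ p.toMeasure = (p.bind V).toMeasure := by
    intro p
    ext s hs
    rw [Measure.bind_apply hs κ.aemeasurable, PMF.toMeasure_bind_apply _ _ _ hs,
      lintegral_fintype, tsum_fintype]
    refine Finset.sum_congr rfl fun a _ => ?_
    rw [PMF.toMeasure_apply_singleton _ _ (measurableSet_singleton a), mul_comm]
    rfl
  rw [← h p, ← h q]
  exact InformationTheory.klDiv_comp_right_le _ _ κ

/-- Puts the product of marginals in a form to which the data processing inequality for `PMF.bind`
applies. -/
theorem toMeasure_prod_eq_bind [Fintype β] [MeasurableSingletonClass β] (p : PMF α) (q : PMF β) :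
    p.toMeasure.prod q.toMeasure = (p.bind fun a => q.map (Prod.mk a)).toMeasure := by
  classical
  refine Measure.ext_of_singleton fun ⟨a, b⟩ => ?_
  rw [← Set.singleton_prod_singleton, Measure.prod_prod, Set.singleton_prod_singleton,
    PMF.toMeasure_apply_singleton _ _ (measurableSet_singleton _),
    PMF.toMeasure_apply_singleton _ _ (measurableSet_singleton _),
    PMF.toMeasure_apply_singleton _ _ (measurableSet_singleton _), PMF.bind_apply,
    tsum_eq_single a, PMF.map_apply, tsum_eq_single b]
  · simp
  · intro b' hb'
    simp [Ne.symm hb']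
  · intro a' ha'
    simp [PMF.map_apply, Ne.symm ha']

end DataProcessing

/-! ### Degraded and less capable channels; the reliability function. -/

variable {K : ℕ} {X : Type*} {Y : Fin K → Type*} [NeZero K] [Fintype X] [MeasurableSpace X]
  [MeasurableSingletonClass X] [∀ j, Fintype (Y j)] [∀ j, MeasurableSpace (Y j)]
  [∀ j, MeasurableSingletonClass (Y j)]

theorem PhysicallyDegraded.stochasticallyDegraded {ch : BroadcastChannel X Y}
    (h : ch.PhysicallyDegraded) : ch.StochasticallyDegraded := by
  intro j hj
  obtain ⟨V, hV⟩ := h j hj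
  refine ⟨V, fun x => ?_⟩
  have := congrArg (PMF.map Prod.snd) (hV x)
  rw [PMF.map_comp, PMF.map_bind] at this
  refine this.trans ?_
  congr 1
  funext y
  rw [PMF.map_comp]
  exact PMF.map_id _

theorem StochasticallyDegraded.relEntropy_le {ch : BroadcastChannel X Y}
    (h : ch.StochasticallyDegraded) (j : Fin K) (x x' : X) :
    ch.relEntropy 0 x x' ≤ ch.relEntropy j x x' := by
  by_cases hj : j = 0
  · rw [hj]
  obtain ⟨V, hV⟩ := h j hj
  unfold relEntropy
  rw [hV, hV]
  exact klDiv_toMeasure_bind_le _ _ V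

/-- Degrading the output while keeping the input is one kernel on pairs. It carries the joint law to
the joint law and the product of marginals to the product of marginals, so data processing applies.
-/
theorem StochasticallyDegraded.mutualInfo_le {ch : BroadcastChannel X Y}
    (h : ch.StochasticallyDegraded) (p : PMF X) (j : Fin K) :
    ch.mutualInfo p 0 ≤ ch.mutualInfo p j := by
  by_cases hj : j = 0
  · rw [hj]
  obtain ⟨V, hV⟩ := h j hj
  unfold mutualInfo
  rw [toMeasure_prod_eq_bind, toMeasure_prod_eq_bind]
  have hV' : ch.marginal 0 = fun x => (ch.marginal j x).bind V := funext hV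
  have hjoint : ∀ (x : X) (q : PMF (Y j)), (q.bind V).map (Prod.mk x) =
      (q.map (Prod.mk x)).bind fun z => (V z.2).map (Prod.mk z.1) := fun x q => by
    rw [PMF.map_bind, PMF.bind_map]
    rfl
  have h1 : (p.bind fun x => (ch.marginal 0 x).map (Prod.mk x)) =
      (p.bind fun x => (ch.marginal j x).map (Prod.mk x)).bind
        fun z => (V z.2).map (Prod.mk z.1) := by
    simp only [PMF.bind_bind, hV', hjoint]
  have h2 : (p.bind fun x => (p.bind (ch.marginal 0)).map (Prod.mk x)) =
      (p.bind fun x => (p.bind (ch.marginal j)).map (Prod.mk x)).bind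
        fun z => (V z.2).map (Prod.mk z.1) := by
    have : p.bind (ch.marginal 0) = (p.bind (ch.marginal j)).bind V := by
      rw [PMF.bind_bind, hV']
    rw [this]
    exact (congrArg p.bind (funext fun x => hjoint x _)).trans (PMF.bind_bind _ _ _).symm
  rw [h1, h2]
  exact klDiv_toMeasure_bind_le _ _ _

theorem StochasticallyDegraded.lessCapable {ch : BroadcastChannel X Y}
    (h : ch.StochasticallyDegraded) : ch.LessCapable :=
  fun p => le_iInf fun j => h.mutualInfo_le p j

theorem StochasticallyDegraded.Bcommon_eq {ch : BroadcastChannel X Y}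
    (h : ch.StochasticallyDegraded) : ch.Bcommon = ch.Buser 0 :=
  iSup_congr fun x => iSup_congr fun x' =>
    le_antisymm (iInf_le _ 0) (le_iInf fun j => h.relEntropy_le j x x')

theorem LessCapable.achievable_of_separation [Nonempty X] {ch : BroadcastChannel X Y}
    (hL : ch.LessCapable) (hB : ch.Bmax < ∞) {R E γ b : ℝ} (hR : 0 ≤ R)
    (hRC : R < (ch.capacity 0).toReal) (hE : 0 ≤ E) (x₀ x₁ : X) (hγ0 : 0 ≤ γ)
    (hγ : γ = 0 ∨ ∀ j, γ < (ch.relEntropy j x₀ x₁).toReal) (hb : 0 < b)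
    (hbR : b < 1 - R / (ch.capacity 0).toReal) (hEγ : E ≤ b * γ) : ch.Achievable R E := by
  set C := (ch.capacity 0).toReal with hCdef
  have hC : 0 < C := hR.trans_lt hRC
  -- The inequality `R / C < a < 1 - b` leaves room for a rate `r` with `R / a < r < C`. Some input
  -- law exceeds `r` for receiver 1, hence for every receiver of a less capable channel.
  obtain ⟨a, ha1, ha2⟩ := exists_between (show R / C < 1 - b by linarith)
  have ha : 0 < a := (div_nonneg hR hC.le).trans_lt ha1
  have hRa : R / a < C := by
    rw [div_lt_iff₀ ha, mul_comm]
    exact (div_lt_iff₀ hC).1 ha1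
  obtain ⟨r, hr1, hr2⟩ := exists_between hRa
  have hr0 : 0 < r := (div_nonneg hR ha.le).trans_lt hr1
  obtain ⟨P, hP⟩ := lt_iSup_iff.1
    ((ENNReal.ofReal_lt_iff_lt_toReal hr0.le (capacity_ne_top hB 0)).2 hr2)
  refine achievable_of_params hB P (r := r) (fun j => ?_) x₀ x₁ hγ0 hγ hR hE ha hb (by linarith)
    hr0 ?_ hEγ
  · exact (ENNReal.ofReal_lt_iff_lt_toReal hr0.le (ch.mutualInfo_ne_top_and_toReal P j).1).1
      (hP.trans_le ((hL P).trans (iInf_le _ j)))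
  · rw [mul_comm]
    exact (div_lt_iff₀ ha).1 hr1

theorem LessCapable.achievable_zero [Nonempty X] {ch : BroadcastChannel X Y}
    (hL : ch.LessCapable) (hB : ch.Bmax < ∞) {R : ℝ} (hR : 0 ≤ R)
    (hRC : R < (ch.capacity 0).toReal) : ch.Achievable R 0 := by
  obtain ⟨x⟩ := ‹Nonempty X›
  have h1 : R / (ch.capacity 0).toReal < 1 := (div_lt_one (hR.trans_lt hRC)).2 hRC
  exact hL.achievable_of_separation hB hR hRC le_rfl x x le_rfl (Or.inl rfl)
    (b := (1 - R / (ch.capacity 0).toReal) / 2) (by linarith) (by linarith) (by simp)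

theorem LessCapable.achievable [Nonempty X] {ch : BroadcastChannel X Y}
    (hL : ch.LessCapable) (hB : ch.Bmax < ∞) {R E : ℝ} (hR : 0 ≤ R)
    (hRC : R < (ch.capacity 0).toReal) (hE : 0 < E)
    (hEB : E < ch.Bcommon.toReal * (1 - R / (ch.capacity 0).toReal)) : ch.Achievable R E := by
  have h1 : 0 < 1 - R / (ch.capacity 0).toReal :=
    sub_pos.2 ((div_lt_one (hR.trans_lt hRC)).2 hRC)
  -- With `γ` between `E / (1 - R / C)` and `B`, the fraction `b = E / γ` of the time suffices for
  -- confirmation and is less than `1 - R / C`.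
  obtain ⟨γ, hγ1, hγ2⟩ := exists_between ((div_lt_iff₀ h1).2 hEB)
  have hγ0 : 0 < γ := (div_pos hE h1).trans hγ1
  have hlt : ENNReal.ofReal γ < ch.Bcommon :=
    (ENNReal.lt_ofReal_iff_toReal_lt ENNReal.ofReal_ne_top |>.2
      (by rwa [ENNReal.toReal_ofReal hγ0.le])).trans_le ENNReal.ofReal_toReal_le
  obtain ⟨x₀, hx₀⟩ := lt_iSup_iff.1 hlt
  obtain ⟨x₁, hx₁⟩ := lt_iSup_iff.1 hx₀
  refine hL.achievable_of_separation hB hR hRC hE.le x₀ x₁ hγ0.le (Or.inr fun j => ?_)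
    (b := E / γ) (div_pos hE hγ0) ?_ (div_mul_cancel₀ E hγ0.ne').ge
  · exact (ENNReal.ofReal_lt_iff_lt_toReal hγ0.le (relEntropy_ne_top hB j x₀ x₁)).1
      (hx₁.trans_le (iInf_le _ j))
  · rw [div_lt_iff₀ hγ0, mul_comm]
    exact (div_lt_iff₀ h1).1 hγ1

theorem LessCapable.le_reliability [Nonempty X] {ch : BroadcastChannel X Y}
    (hL : ch.LessCapable) (hB : ch.Bmax < ∞) {R : ℝ} (hR : 0 ≤ R)
    (hRC : R < (ch.capacity 0).toReal) :
    ((ch.Bcommon.toReal * (1 - R / (ch.capacity 0).toReal) : ℝ) : EReal) ≤ ch.reliability R := by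
  have h0 : ((0 : ℝ) : EReal) ≤ ch.reliability R :=
    le_sSup ⟨0, hL.achievable_zero hB hR hRC, rfl⟩
  refine le_of_forall_lt fun c hc => ?_
  -- Negative bounds are beaten by the exponent `0`; this also settles the case `B = 0`, where no
  -- positive exponent is at hand.
  obtain hc0 | hc0 := lt_or_ge c ((0 : ℝ) : EReal)
  · exact hc0.trans_le h0
  obtain ⟨E, hE1, hE2⟩ := EReal.lt_iff_exists_real_btwn.1 hc
  exact hE1.trans_le (le_sSup ⟨E, hL.achievable hB hR hRC
    (EReal.coe_lt_coe_iff.1 (hc0.trans_lt hE1)) (EReal.coe_lt_coe_iff.1 hE2), rfl⟩)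

theorem reliability_le [Nonempty X] {ch : BroadcastChannel X Y} (hB : ch.Bmax < ∞) (j : Fin K)
    {R : ℝ} (hR : 0 ≤ R) (hRC : R < (ch.capacity j).toReal) :
    ch.reliability R ≤ (((ch.Buser j).toReal * (1 - R / (ch.capacity j).toReal) : ℝ) : EReal) := by
  obtain ⟨l, hl⟩ := exists_channelBounds hB j
    (ENNReal.toReal_pos_iff.1 (hR.trans_lt hRC)).1
  refine sSup_le ?_
  rintro _ ⟨E, hE, rfl⟩
  exact EReal.coe_le_coe_iff.2 (hE.le hl hRC)

end BroadcastChannel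

end

theorem theorem2 {K : ℕ} [NeZero K]
    {X : Type*} [Finite X] [Nonempty X] [MeasurableSpace X] [MeasurableSingletonClass X]
    {Y : Fin K → Type*} [∀ j, Finite (Y j)] [∀ j, MeasurableSpace (Y j)]
    [∀ j, MeasurableSingletonClass (Y j)]
    (ch : BroadcastChannel X Y) (hB : ch.Bmax < ∞) :
    (ch.LessCapable → ∀ R : ℝ, 0 ≤ R → ENNReal.ofReal R < ch.capacity 0 →
      ((ch.Bcommon.toReal * (1 - R / (ch.capacity 0).toReal) : ℝ) : EReal) ≤ ch.reliability R ∧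
      ch.reliability R ≤
        (((ch.Buser 0).toReal * (1 - R / (ch.capacity 0).toReal) : ℝ) : EReal)) ∧
    (ch.StochasticallyDegraded ∨ ch.PhysicallyDegraded →
      ∀ R : ℝ, 0 ≤ R → ENNReal.ofReal R < ch.capacity 0 →
        ch.reliability R =
          (((ch.Buser 0).toReal * (1 - R / (ch.capacity 0).toReal) : ℝ) : EReal)) := by
  cases nonempty_fintype X
  let _ : ∀ j, Fintype (Y j) := fun j => Fintype.ofFinite (Y j)
  have bounds : ch.LessCapable → ∀ R : ℝ, 0 ≤ R → ENNReal.ofReal R < ch.capacity 0 →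
      ((ch.Bcommon.toReal * (1 - R / (ch.capacity 0).toReal) : ℝ) : EReal) ≤ ch.reliability R ∧
      ch.reliability R ≤
        (((ch.Buser 0).toReal * (1 - R / (ch.capacity 0).toReal) : ℝ) : EReal) := by
    intro hL R hR hRC
    have hRC' := (ENNReal.ofReal_lt_iff_lt_toReal hR
      (BroadcastChannel.capacity_ne_top hB 0)).1 hRC
    exact ⟨hL.le_reliability hB hR hRC', BroadcastChannel.reliability_le hB 0 hR hRC'⟩
  refine ⟨bounds, fun h R hR hRC => ?_⟩
  have hS : ch.StochasticallyDegraded := h.elim id fun h => h.stochasticallyDegraded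
  obtain ⟨h1, h2⟩ := bounds hS.lessCapable R hR hRC
  rw [hS.Bcommon_eq] at h1
  exact le_antisymm h2 h1
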